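/- In the electrical distribution network reconfiguration (EDNR) problem one is given a connected undirected graph $G=(V,E)$ with a root $r\in V$, a (rational) demand $d_v\ge 0$ for each $v\in V\setminus\{r\}$ and a (rational) resistance $\rho_e\ge 0$ for each $e\in E$. The task is to find a spanning tree $T=(V,F)$ of $G$ that minimizes the loss $$L(T)=\sum_{e\in F}\rho_e\Bigl(\sum_{v\in \mathrm{des}_T(e)}d_v\Bigr)^2,$$ where $\mathrm{des}_T(e)$ is the vertex set of the connected component of $T-e$ that does not contain $r$. A grid is a graph isomorphic to the Cartesian product of two paths. Corollary. There are a function $\varepsilon:\mathbb N\to\mathbb R$ with $\varepsilon(N)\to 0$ as $N\to\infty$ and a polynomial-time algorithm (on a random access machine, polynomial in the bit length of the input) with the following property. Let an EDNR instance be given in which $G$ is a grid, $r$ is a corner of the grid, $\rho_e=1$ for all $e\in E$, and $d_v\in[d_{\min},d_{\max}]$ for all $v\ne r$, for some real numbers $d_{\min}>0$ and $d_{\max}$. Then the algorithm, given the instance (number of vertices, root, adjacency matrix, demands, resistances), outputs the adjacency matrix of a spanning tree $T$ of $G$ such that for every spanning tree $T'$ of $G$ $$L(T)\le \alpha^2\Bigl(\frac98+\varepsilon(|V|)\Bigr)L(T'),\qquad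 \alpha=\frac{d_{\max}}{d_{\min}}.$$ That is, the EDNR problem on such grids admits a polynomial-time $\alpha^2(9/8+o(1))$-approximation algorithm. -/

import Mathlib

open Filter Topology

/-! ### The electrical distribution network reconfiguration (EDNR) problem -/

/-- An instance of the EDNR problem: a connected graph with a root, a non-negative demand at each
non-root vertex and a non-negative resistance on each edge. The values `demand root` and
`resistance e` for non-edges `e` play no role. Numerical data are rational, so that an instance can
be given to an algorithm. -/
structure EDNRInstance where
  /-- the number of vertices -/
  N : ℕ
  graph : SimpleGraph (Fin N)
  connected : graph.Connected
  root : Fin N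
  demand : Fin N → ℚ≥0
  resistance : Sym2 (Fin N) → ℚ≥0

namespace EDNRInstance

/-- `T` is (the edge set of) a spanning tree of the graph of the instance. -/
def IsSpanningTree (I : EDNRInstance) (T : SimpleGraph (Fin I.N)) : Prop :=
  T ≤ I.graph ∧ T.IsTree

open Classical in
/-- The vertices of `T - e` that are not connected to the root; for an edge `e` of a spanning tree
`T`, this is the component of `T - e` that does not contain the root. -/
noncomputable def des (I : EDNRInstance) (T : SimpleGraph (Fin I.N)) (e : Sym2 (Fin I.N)) :
    Finset (Fin I.N) :=
  Finset.univ.filter fun v => ¬ (T.deleteEdges {e}).Reachable I.root v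

open Classical in
/-- The loss of a spanning tree `T`: the sum over the edges `e` of `T` of the resistance of `e`
times the square of the total demand of `des T e`. -/
noncomputable def loss (I : EDNRInstance) (T : SimpleGraph (Fin I.N)) : ℝ :=
  ∑ e ∈ T.edgeFinset, (I.resistance e : ℝ) * (∑ v ∈ I.des T e, (I.demand v : ℝ)) ^ 2

/-- The graph is a grid, i.e. it is isomorphic to the Cartesian product of two paths, and the root
is one of its corners. -/
def IsCornerRootedGrid (I : EDNRInstance) : Prop :=
  ∃ (n m : ℕ) (φ : I.graph ≃g (SimpleGraph.pathGraph n □ SimpleGraph.pathGraph m)),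
    (((φ I.root).1 : ℕ) = 0 ∨ ((φ I.root).1 : ℕ) + 1 = n) ∧
    (((φ I.root).2 : ℕ) = 0 ∨ ((φ I.root).2 : ℕ) + 1 = m)

end EDNRInstance

/-! ### Machine model: a random access machine with structured control flow -/

namespace RAM

/-- A memory configuration: registers and arrays holding natural numbers (each program refers to
finitely many registers and finitely many arrays by name). -/
structure State where
  reg : ℕ → ℕ
  arr : ℕ → ℕ → ℕ

/-- Expressions: constants, registers, array accesses, addition and truncated subtraction.
There is no multiplication, so (beyond the fixed constants of the program) a unit of cost can at
most double the largest number in memory, and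
polynomially many steps are polynomial time on a Turing machine. -/
inductive Expr where
  | const (c : ℕ)
  | reg (r : ℕ)
  | get (a : ℕ) (i : Expr)
  | add (x y : Expr)
  | sub (x y : Expr)

/-- The value of an expression. -/
def Expr.eval (s : State) : Expr → ℕ
  | .const c => c
  | .reg r => s.reg r
  | .get a i => s.arr a (i.eval s)
  | .add x y => x.eval s + y.eval s
  | .sub x y => x.eval s - y.eval s

/-- The cost of evaluating an expression: the number of its nodes. -/
def Expr.cost : Expr → ℕ
  | .const _ => 1
  | .reg _ => 1
  | .get _ i => i.cost + 1
  | .add x y => x.cost + y.cost + 1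
  | .sub x y => x.cost + y.cost + 1

/-- Programs. -/
inductive Prog where
  | skip
  /-- put the value of `x` into register `r` -/
  | assign (r : ℕ) (x : Expr)
  /-- put the value of `x` into cell `i` of array `a` -/
  | store (a : ℕ) (i x : Expr)
  | seq (p q : Prog)
  /-- run `p` if the value of `b` is not zero, otherwise run `q` -/
  | cond (b : Expr) (p q : Prog)
  /-- while the value of `b` is not zero, run `p` -/
  | loop (b : Expr) (p : Prog)

/-- `Exec p s t s'`: the program `p`, started in `s`, halts in `s'` after exactly `t` steps. -/
inductive Exec : Prog → State → ℕ → State → Prop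
  | skip (s : State) : Exec .skip s 1 s
  | assign (r : ℕ) (x : Expr) (s : State) :
      Exec (.assign r x) s (x.cost + 1) { s with reg := Function.update s.reg r (x.eval s) }
  | store (a : ℕ) (i x : Expr) (s : State) :
      Exec (.store a i x) s (i.cost + x.cost + 1)
        { s with arr := Function.update s.arr a
                          (Function.update (s.arr a) (i.eval s) (x.eval s)) }
  | seq {p q : Prog} {s s' s'' : State} {t t' : ℕ} :
      Exec p s t s' → Exec q s' t' s'' → Exec (.seq p q) s (t + t') s''
  | cond_pos {b : Expr} {p q : Prog} {s s' : State} {t : ℕ} :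
      b.eval s ≠ 0 → Exec p s t s' → Exec (.cond b p q) s (b.cost + 1 + t) s'
  | cond_zero {b : Expr} {p q : Prog} {s s' : State} {t : ℕ} :
      b.eval s = 0 → Exec q s t s' → Exec (.cond b p q) s (b.cost + 1 + t) s'
  | loop_pos {b : Expr} {p : Prog} {s s' s'' : State} {t t' : ℕ} :
      b.eval s ≠ 0 → Exec p s t s' → Exec (.loop b p) s' t' s'' →
        Exec (.loop b p) s (b.cost + 1 + t + t') s''
  | loop_zero {b : Expr} {p : Prog} {s : State} :
      b.eval s = 0 → Exec (.loop b p) s (b.cost + 1) s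

/-- The starting configuration on the input word `x`: array `0` holds `x`, register `0` holds the
length of `x`, and everything else is zero. -/
def State.start (x : List ℕ) : State where
  reg := fun r => if r = 0 then x.length else 0
  arr := fun a i => if a = 0 then x.getD i 0 else 0

/-- The output word of a final configuration: the first `k` entries of array `1`, where `k` is the
content of register `1`. -/
def State.output (s : State) : List ℕ :=
  List.ofFn fun i : Fin (s.reg 1) => s.arr 1 i

/-- On input `x`, the program `p` halts after at most `t` steps with output `y`. -/
def OutputsWithin (p : Prog) (x : List ℕ) (t : ℕ) (y : List ℕ) : Prop :=
  ∃ (c : ℕ) (s : State), Exec p (State.start x) c s ∧ c ≤ t ∧ s.output = y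

/-- The size in bits of a word of natural numbers (in binary, with separators). -/
def bitLength (x : List ℕ) : ℕ := (x.map fun a => Nat.size a + 1).sum

end RAM

/-! ### Encoding of instances and solutions as words -/

open Classical in
/-- The adjacency matrix of a graph, row by row. -/
noncomputable def encodeGraph {N : ℕ} (G : SimpleGraph (Fin N)) : List ℕ :=
  List.ofFn fun k : Fin (N * N) => if G.Adj k.divNat k.modNat then 1 else 0

/-- A list of non-negative rational numbers: all numerators, then all denominators. -/
def encodeRationals {k : ℕ} (f : Fin k → ℚ≥0) : List ℕ :=
  List.ofFn (fun i => (f i).num) ++ List.ofFn (fun i => (f i).den)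

open Classical in
/-- An instance is presented by its number of vertices, its root, its adjacency matrix, the demands
of its non-root vertices (with `0` at the root) and the matrix of the resistances of its edges
(with `0` at the non-edges). -/
noncomputable def EDNRInstance.encode (I : EDNRInstance) : List ℕ :=
  [I.N, (I.root : ℕ)] ++ encodeGraph I.graph ++
    encodeRationals (fun v => if v = I.root then 0 else I.demand v) ++
    encodeRationals (fun k : Fin (I.N * I.N) =>
      if I.graph.Adj k.divNat k.modNat then I.resistance s(k.divNat, k.modNat) else 0)

/-! With unit resistances the loss of a tree is the sum, over the non-root vertices `v`, of the
squared demand below `v`. Bounding demands by `dmin` from below and by `dmax` from above costs the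
factor `α²`, so it suffices to compare sums of squared subtree sizes (`sum_numBelow_sq_le_loss`,
`loss_parentGraph_le`). Put the root at `(0, 0)`, let `n ≤ m` be the sides, and call `a + b` the
rank; an edge changes it by one.

Lower bound (`lower_bound`): every path from the root to a vertex of rank at least `d` meets
diagonal `d`. So the subtree sizes on that diagonal add up to at least the number `F` of vertices of
rank at least `d`, and Cauchy–Schwarz gives `F² / min (d + 1) n`. Summing yields `(nm)² Hₙ + nm³/3`,
up to a multiple of `(nm)²`.

Upper bound (`upper_bound`): the tree has `K = 2 ^ J` trunks, each serving about `nm / K` vertices.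
On a diagonal `0 < d < K` binary splitting distributes them over `d + 1 = 2T + s` vertices: `2T` of
them carry `w` trunks, `s` carry `2w`, and `K = 2(T + s)w`. Compared with the uniform value `K² / (d
+ 1)`, the sum of squares grows by `(2T + 4s)(2T + s) / (4(T + s)²) ≤ 9/8`, with equality at `T =
s`; this is where `9/8` comes from (`sum_numTrunks_sq_le`). Beyond that, each trunk runs to its own
bundle of rows. These transit runs cost about `(nm)² n / K`, the rows about `nm³/3`.

Two errors remain: the relative excess `K / n` of a trunk, and `n / K` relative to `Hₙ`. Taking `n /
K` of order `log log n` makes both vanish. If `n` stays bounded while `m` grows, the harmonic term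
no longer dominates, but then `nm³/3` does, and the spare eighth of it absorbs everything else
(`exists_forall_upperCoeff_le`). Hence the error depends on `nm` only.

The algorithm must find the grid coordinates by itself. Relaxation of edges gives the distances from
the root, from a neighbor of the root, and from the side through the root on which the rows are
counted; these determine the coordinates up to exchange of the axes (`coordinates_spec`). All loops
run as often as there are vertices, so polynomial time is automatic (`exists_exec`). -/

namespace RAM

/-! ### Programs with bounded loops: semantics, frame rules and running time. -/

/-- The state `s` with `v` in register `r`. -/
def State.setReg (s : State) (r v : ℕ) : State := { s with reg := Function.update s.reg r v }

/-- The state `s` with `v` in cell `i` of array `a`. -/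
def State.setArr (s : State) (a i v : ℕ) : State :=
  { s with arr := Function.update s.arr a (Function.update (s.arr a) i v) }

@[simp] lemma State.setReg_reg (s : State) (r v r' : ℕ) :
    (s.setReg r v).reg r' = if r' = r then v else s.reg r' := by
  simp [State.setReg, Function.update_apply]

@[simp] lemma State.setReg_arr (s : State) (r v : ℕ) : (s.setReg r v).arr = s.arr := rfl

@[simp] lemma State.setArr_reg (s : State) (a i v : ℕ) : (s.setArr a i v).reg = s.reg := rfl

@[simp] lemma State.setArr_arr (s : State) (a i v a' i' : ℕ) :
    (s.setArr a i v).arr a' i' = if a' = a ∧ i' = i then v else s.arr a' i' := by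
  by_cases h : a' = a
  · subst h
    simp [State.setArr, Function.update_apply]
  · simp [State.setArr, h]

lemma State.setReg_self (s : State) (r : ℕ) : s.setReg r (s.reg r) = s := by
  simp [State.setReg]

/-- Programs all of whose loops run as many times as register `2` says. -/
inductive ForProg where
  | skip
  | assign (r : ℕ) (x : Expr)
  | store (a : ℕ) (i x : Expr)
  | seq (p q : ForProg)
  | cond (b : Expr) (p q : ForProg)
  /-- run `p` for all values of register `c` below the value of register `2` -/
  | rep (c : ℕ) (p : ForProg)

namespace ForProg

/-- The underlying program. -/
def toProg : ForProg → Prog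
  | skip => .skip
  | assign r x => .assign r x
  | store a i x => .store a i x
  | seq p q => .seq p.toProg q.toProg
  | cond b p q => .cond b p.toProg q.toProg
  | rep c p => .seq (.assign c (.const 0)) (.loop (.sub (.reg 2) (.reg c))
      (.seq p.toProg (.assign c (.add (.reg c) (.const 1)))))

/-- The effect of a program on the state. -/
def denote : ForProg → State → State
  | skip, s => s
  | assign r x, s => s.setReg r (x.eval s)
  | store a i x, s => s.setArr a (i.eval s) (x.eval s)
  | seq p q, s => q.denote (p.denote s)
  | cond b p q, s => if b.eval s ≠ 0 then p.denote s else q.denote s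
  | rep c p, s => (fun s' => (p.denote s').setReg c ((p.denote s').reg c + 1))^[s.reg 2]
      (s.setReg c 0)

/-- The program may write to the register. -/
def writesReg : ForProg → ℕ → Bool
  | skip, _ => false
  | assign r _, r' => r = r'
  | store _ _ _, _ => false
  | seq p q, r' => p.writesReg r' || q.writesReg r'
  | cond _ p q, r' => p.writesReg r' || q.writesReg r'
  | rep c p, r' => c = r' || p.writesReg r'

/-- The program may write to the array. -/
def writesArr : ForProg → ℕ → Bool
  | skip, _ => false
  | assign _ _, _ => false
  | store a _ _, a' => a = a'
  | seq p q, a' => p.writesArr a' || q.writesArr a'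
  | cond _ p q, a' => p.writesArr a' || q.writesArr a'
  | rep _ p, a' => p.writesArr a'

/-- Loop bodies do not write to the counter or to register `2`. -/
def wf : ForProg → Bool
  | skip => true
  | assign _ _ => true
  | store _ _ _ => true
  | seq p q => p.wf && q.wf
  | cond _ p q => p.wf && q.wf
  | rep c p => p.wf && c != 2 && !p.writesReg c && !p.writesReg 2

/-- A bound for the running time in terms of the content of register `2`. -/
noncomputable def time : ForProg → Polynomial ℕ
  | skip => Polynomial.C 1
  | assign _ x => Polynomial.C (x.cost + 1)
  | store _ i x => Polynomial.C (i.cost + x.cost + 1)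
  | seq p q => p.time + q.time
  | cond b p q => Polynomial.C (b.cost + 1) + (p.time + q.time)
  -- Clearing the counter costs 2 and the failing last test 4; each iteration pays 4 for its test
  -- and 4 for incrementing the counter.
  | rep _ p => Polynomial.C 6 + Polynomial.X * (p.time + Polynomial.C 8)

lemma denote_seq (p q : ForProg) (s : State) : (seq p q).denote s = q.denote (p.denote s) := rfl

lemma denote_assign (r : ℕ) (x : Expr) (s : State) :
    (assign r x).denote s = s.setReg r (x.eval s) := rfl

lemma denote_store (a : ℕ) (i x : Expr) (s : State) :
    (store a i x).denote s = s.setArr a (i.eval s) (x.eval s) := rfl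

lemma denote_cond_of_ne_zero {b : Expr} {s : State} (h : b.eval s ≠ 0) (p q : ForProg) :
    (cond b p q).denote s = p.denote s := if_pos h

lemma denote_cond_of_eq_zero {b : Expr} {s : State} (h : b.eval s = 0) (p q : ForProg) :
    (cond b p q).denote s = q.denote s := if_neg (not_not.2 h)

/-- Frame rule. Since `writesReg` computes, its hypothesis is closed by `rfl` for concrete programs.
-/
lemma denote_reg_of_not_writesReg {p : ForProg} {r : ℕ} (h : p.writesReg r = false) (s : State) :
    (p.denote s).reg r = s.reg r := by
  induction p generalizing s with
  | skip => rfl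
  | assign r' x =>
    simp only [writesReg, decide_eq_false_iff_not] at h
    simp [denote, Ne.symm h]
  | store a i x => rfl
  | seq p q ihp ihq =>
    simp only [writesReg, Bool.or_eq_false_iff] at h
    simp [denote, ihp h.1, ihq h.2]
  | cond b p q ihp ihq =>
    simp only [writesReg, Bool.or_eq_false_iff] at h
    simp only [denote]
    split_ifs
    exacts [ihp h.1 s, ihq h.2 s]
  | rep c p ih =>
    simp only [writesReg, Bool.or_eq_false_iff, decide_eq_false_iff_not] at h
    simp only [denote]
    generalize s.reg 2 = k
    induction k with
    | zero => simp [Ne.symm h.1]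
    | succ k ihk => simp [Function.iterate_succ_apply', Ne.symm h.1, ih h.2, ihk]

lemma denote_arr_of_not_writesArr {p : ForProg} {a : ℕ} (h : p.writesArr a = false) (s : State) :
    (p.denote s).arr a = s.arr a := by
  induction p generalizing s with
  | skip => rfl
  | assign r x => rfl
  | store a' i x =>
    simp only [writesArr, decide_eq_false_iff_not] at h
    funext j
    simp [denote, Ne.symm h]
  | seq p q ihp ihq =>
    simp only [writesArr, Bool.or_eq_false_iff] at h
    simp [denote, ihp h.1, ihq h.2]
  | cond b p q ihp ihq =>
    simp only [writesArr, Bool.or_eq_false_iff] at h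
    simp only [denote]
    split_ifs
    exacts [ihp h.1 s, ihq h.2 s]
  | rep c p ih =>
    simp only [writesArr] at h
    simp only [denote]
    generalize s.reg 2 = k
    induction k with
    | zero => simp
    | succ k ihk => simp [Function.iterate_succ_apply', ih h, ihk]

/-- Induction principle for loops: an invariant that holds at the start and is preserved by the
body holds at the end; the registers and arrays that are not written to are unchanged. -/
lemma denote_rep_induction {c : ℕ} {p : ForProg} (hwf : (rep c p).wf = true) (s : State)
    (Inv : ℕ → State → Prop) (h0 : Inv 0 (s.setReg c 0))
    (hstep : ∀ i < s.reg 2, ∀ s' : State, s'.reg c = i →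
      (∀ r, (rep c p).writesReg r = false → s'.reg r = s.reg r) →
      (∀ a, (rep c p).writesArr a = false → s'.arr a = s.arr a) →
      Inv i s' → Inv (i + 1) ((p.denote s').setReg c (i + 1))) :
    Inv (s.reg 2) ((rep c p).denote s) := by
  simp only [wf, Bool.and_eq_true, Bool.not_eq_true', bne_iff_ne] at hwf
  obtain ⟨⟨⟨-, hc⟩, hpc⟩, -⟩ := hwf
  suffices H : ∀ k ≤ s.reg 2,
      let s' := (fun s' => (p.denote s').setReg c ((p.denote s').reg c + 1))^[k] (s.setReg c 0)
      s'.reg c = k ∧ (∀ r, (rep c p).writesReg r = false → s'.reg r = s.reg r) ∧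
      (∀ a, (rep c p).writesArr a = false → s'.arr a = s.arr a) ∧ Inv k s' from
    (H _ le_rfl).2.2.2
  intro k hk
  induction k with
  | zero =>
    refine ⟨by simp, fun r hr => ?_, fun a _ => by simp, h0⟩
    simp only [writesReg, Bool.or_eq_false_iff, decide_eq_false_iff_not] at hr
    simp [Ne.symm hr.1]
  | succ k ih =>
    obtain ⟨h1, h2, h3, h4⟩ := ih (by omega)
    simp only [Function.iterate_succ_apply']
    generalize (fun s' => (p.denote s').setReg c ((p.denote s').reg c + 1))^[k] (s.setReg c 0) = s'
      at h1 h2 h3 h4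
    have hreg : (p.denote s').reg c = k := by rw [denote_reg_of_not_writesReg hpc, h1]
    refine ⟨by simp [hreg], fun r hr => ?_, fun a ha => ?_, ?_⟩
    · have hr' := hr
      simp only [writesReg, Bool.or_eq_false_iff, decide_eq_false_iff_not] at hr'
      simp [Ne.symm hr'.1, denote_reg_of_not_writesReg hr'.2, h2 r hr]
    · have ha' := ha
      simp only [writesArr] at ha'
      simp [denote_arr_of_not_writesArr ha', h3 a ha]
    · rw [hreg]
      exact hstep k (by omega) s' h1 h2 h3 h4

/-- A well-formed program that does not write to register `2` runs in time polynomial in the content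
of that register. -/
lemma exists_exec {p : ForProg} (hwf : p.wf = true) (h2 : p.writesReg 2 = false) (s : State) :
    ∃ t ≤ p.time.eval (s.reg 2), Exec p.toProg s t (p.denote s) := by
  induction p generalizing s with
  | skip => exact ⟨1, by simp [time], .skip s⟩
  | assign r x => exact ⟨_, by simp [time], .assign r x s⟩
  | store a i x => exact ⟨_, by simp [time], .store a i x s⟩
  | seq p q ihp ihq =>
    simp only [writesReg, Bool.or_eq_false_iff] at h2
    simp only [wf, Bool.and_eq_true] at hwf
    obtain ⟨t, ht, hp⟩ := ihp hwf.1 h2.1 s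
    obtain ⟨t', ht', hq⟩ := ihq hwf.2 h2.2 (p.denote s)
    rw [denote_reg_of_not_writesReg h2.1] at ht'
    exact ⟨t + t', by simpa [time] using add_le_add ht ht', .seq hp hq⟩
  | cond b p q ihp ihq =>
    simp only [writesReg, Bool.or_eq_false_iff] at h2
    simp only [wf, Bool.and_eq_true] at hwf
    obtain ⟨t, ht, hp⟩ := ihp hwf.1 h2.1 s
    obtain ⟨t', ht', hq⟩ := ihq hwf.2 h2.2 s
    have ht : b.cost + 1 + t ≤ (cond b p q).time.eval (s.reg 2) := by
      simp only [time, Polynomial.eval_add, Polynomial.eval_C]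
      omega
    have ht' : b.cost + 1 + t' ≤ (cond b p q).time.eval (s.reg 2) := by
      simp only [time, Polynomial.eval_add, Polynomial.eval_C]
      omega
    by_cases hb : b.eval s = 0
    · refine ⟨_, ht', ?_⟩
      rw [denote, if_neg (by simpa using hb)]
      exact .cond_zero hb hq
    · refine ⟨_, ht, ?_⟩
      rw [denote, if_pos hb]
      exact .cond_pos hb hp
  | rep c p ih =>
    simp only [writesReg, Bool.or_eq_false_iff] at h2
    simp only [wf, Bool.and_eq_true, Bool.not_eq_true', bne_iff_ne] at hwf
    obtain ⟨⟨⟨hp, hc⟩, hpc⟩, -⟩ := hwf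
    set N := s.reg 2 with hN
    -- Induction on the number `k` of iterations still to come, which together with the counter
    -- always makes `N`.
    have H : ∀ k, ∀ s' : State, s'.reg 2 = N → s'.reg c + k = N →
        ∃ t ≤ k * (p.time.eval N + 8) + 4,
        Exec (.loop (.sub (.reg 2) (.reg c))
          (.seq p.toProg (.assign c (.add (.reg c) (.const 1))))) s' t
          ((fun s' => (p.denote s').setReg c ((p.denote s').reg c + 1))^[k] s') := by
      intro k
      induction k with
      | zero =>
        intro s' h1 h3
        exact ⟨4, by simp, .loop_zero (by simp [Expr.eval]; omega)⟩
      | succ k ihk =>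
        intro s' h1 h3
        obtain ⟨t, ht, hpt⟩ := ih hp h2.2 s'
        have e1 := denote_reg_of_not_writesReg h2.2 s'
        have e2 := denote_reg_of_not_writesReg hpc s'
        obtain ⟨t', ht', hrest⟩ := ihk ((p.denote s').setReg c ((p.denote s').reg c + 1))
          (by simp [Ne.symm hc, e1, h1]) (by simp [e2]; omega)
        rw [Function.iterate_succ_apply]
        refine ⟨_, ?_, .loop_pos ?_ (.seq hpt (.assign _ _ _)) hrest⟩
        · rw [h1] at ht
          simp only [Expr.cost]
          have : (k + 1) * (p.time.eval N + 8) = k * (p.time.eval N + 8) + p.time.eval N + 8 := by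
            ring
          omega
        · simp [Expr.eval]; omega
    obtain ⟨t, ht, hl⟩ := H N (s.setReg c 0) (by simp [Ne.symm hc, hN]) (by simp)
    refine ⟨_, ?_, .seq (.assign _ _ _) hl⟩
    simp only [time, Polynomial.eval_add, Polynomial.eval_C, Polynomial.eval_mul, Polynomial.eval_X,
      Expr.cost]
    omega

end ForProg

end RAM

/-! ### Spanning trees -/

/-- In a tree with root `r`, each vertex `v ≠ r` has an edge to its parent; the vertices below `v`
are not reachable from `r` without this edge. -/
lemma SimpleGraph.IsTree.exists_parentEdge {V : Type*} {T : SimpleGraph V} (hT : T.IsTree) (r : V) :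
    ∃ e : V → Sym2 V, (∀ v, v ≠ r → e v ∈ T.edgeSet) ∧
      (∀ v w, v ≠ r → w ≠ r → e v = e w → v = w) ∧
      ∀ v x, v ≠ r → (∀ p : T.Walk r x, p.IsPath → v ∈ p.support) →
        ¬ (T.deleteEdges {e v}).Reachable r x := by
  classical
  choose P hP hPu using fun v => hT.existsUnique_path r v
  have hnil : ∀ v, v ≠ r → ¬ (P v).Nil := fun v hv h => hv h.eq.symm
  refine ⟨fun v => s((P v).penultimate, v), fun v hv => ?_, fun v w hv hw h => ?_,
    fun v x hv hx hr => ?_⟩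
  · exact (P v).adj_penultimate (hnil v hv)
  · by_contra hvw
    -- By uniqueness the path to `x` without its last edge is the path to `y`. If two vertices
    -- shared their parent edge, each would be one step farther from `r` than the other.
    have hlen : ∀ x y, x ≠ r → (P x).penultimate = y → (P y).length + 1 = (P x).length := by
      intro x y hx hxy
      subst hxy
      have hd : (P x).dropLast.IsPath := (hP x).take _
      rw [← hPu _ _ hd]
      conv_rhs => rw [← SimpleGraph.Walk.concat_dropLast ((P x).adj_penultimate (hnil x hx))]
      simp only [SimpleGraph.Walk.length_concat]
    rw [Sym2.eq_iff] at h
    rcases h with h | h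
    · exact hvw h.2
    · have h1 := hlen v w hv h.1
      have h2 := hlen w v hw h.2.symm
      omega
  · rw [SimpleGraph.reachable_deleteEdges_iff_exists_walk] at hr
    obtain ⟨p, hp⟩ := hr
    -- A walk that avoids `e v` shortens to a path through `v`; its part up to `v` is `P v`, whose
    -- last edge is `e v`.
    have hq := p.bypass_isPath
    have hv' := hx _ hq
    have := hPu v _ (hq.takeUntil hv')
    have hmem := (P v).mk_penultimate_end_mem_edges (hnil v hv)
    have hmem' : s((P v).penultimate, v) ∈ (p.bypass.takeUntil v hv').edges := by rwa [this]
    exact hp (p.edges_bypass_subset_edges (p.bypass.edges_takeUntil_subset_edges hv' hmem'))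

/-- A walk along which a rank changes by at most one visits all intermediate ranks. -/
lemma SimpleGraph.Walk.exists_mem_support_eq {V : Type*} {G : SimpleGraph V} {D : V → ℕ}
    (hD : ∀ u v, G.Adj u v → D v ≤ D u + 1) {u x : V} (p : G.Walk u x) {d : ℕ} (hu : D u ≤ d)
    (hx : d ≤ D x) : ∃ v ∈ p.support, D v = d := by
  induction p with
  | nil => exact ⟨_, by simp, le_antisymm hu hx⟩
  | @cons u v x h p ih =>
    rcases hu.eq_or_lt with h1 | h1
    · exact ⟨u, by simp, h1⟩
    · obtain ⟨w, hw, hwd⟩ := ih (by have := hD u v h; omega) hx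
      exact ⟨w, by simp [hw], hwd⟩

/-- The graph joining each vertex to its parent. -/
def parentGraph {V : Type*} (π : V → V) : SimpleGraph V where
  Adj u v := u ≠ v ∧ (π u = v ∨ π v = u)
  symm := ⟨fun _ _ h => ⟨h.1.symm, h.2.symm⟩⟩
  loopless := ⟨fun _ h => h.1 rfl⟩

open Classical in
/-- The number of vertices from which `v` is reached by iterating the parent map `π`. -/
noncomputable def numDesc {V : Type*} [Fintype V] (π : V → V) (v : V) : ℕ :=
  (Finset.univ.filter fun x => ∃ k, π^[k] x = v).card

section parentGraph

variable {V : Type*} {π : V → V} {r : V} {D : V → ℕ}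

lemma parentGraph_adj_parent (hD : ∀ v, v ≠ r → D (π v) < D v) {v : V} (hv : v ≠ r) :
    (parentGraph π).Adj (π v) v :=
  ⟨fun h => by have := hD v hv; rw [h] at this; exact lt_irrefl _ this, Or.inr rfl⟩

lemma edgeSet_parentGraph (hr : π r = r) (hD : ∀ v, v ≠ r → D (π v) < D v) :
    (parentGraph π).edgeSet = (fun v => s(π v, v)) '' {v | v ≠ r} := by
  ext e
  induction e with
  | _ u v =>
    simp only [SimpleGraph.mem_edgeSet, Set.mem_image, Set.mem_ofPred_eq]
    constructor
    · rintro ⟨hne, h | h⟩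
      · refine ⟨u, ?_, by rw [h, Sym2.eq_swap]⟩
        rintro rfl
        exact hne (hr.symm.trans h)
      · refine ⟨v, ?_, by rw [h]⟩
        rintro rfl
        exact hne (h.symm.trans hr)
    · rintro ⟨w, hw, h⟩
      have := parentGraph_adj_parent hD hw
      rw [← SimpleGraph.mem_edgeSet, h] at this
      exact this

/-- Following parents decreases `D` until `r` is reached, so the graph is connected; each vertex
other than `r` contributes at most one edge, so there are at most `|V| - 1` edges. -/
lemma isTree_parentGraph [Finite V] (hr : π r = r) (hD : ∀ v, v ≠ r → D (π v) < D v) :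
    (parentGraph π).IsTree := by
  classical
  have := Fintype.ofFinite V
  have hreach : ∀ k, ∀ v, D v ≤ k → (parentGraph π).Reachable r v := by
    intro k
    induction k with
    | zero =>
      intro v hv
      by_cases h : v = r
      · rw [h]
      · have := hD v h
        omega
    | succ k ih =>
      intro v hv
      by_cases h : v = r
      · rw [h]
      · have := hD v h
        exact (ih (π v) (by omega)).trans (parentGraph_adj_parent hD h).reachable
  have hconn : (parentGraph π).Connected :=
    { preconnected := fun u v => (hreach _ u le_rfl).symm.trans (hreach _ v le_rfl)
      nonempty := ⟨r⟩ }
  refine SimpleGraph.isTree_iff_connected_and_card.2 ⟨hconn,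
    le_antisymm ?_ hconn.card_vert_le_card_edgeSet_add_one⟩
  rw [edgeSet_parentGraph hr hD, Nat.card_coe_set_eq]
  have h1 := Set.ncard_image_le (f := fun v => s(π v, v)) (Set.toFinite {v | v ≠ r})
  have h2 : Set.ncard {v | v ≠ r} + 1 = Nat.card V := by
    have := Set.ncard_add_ncard_compl {v | v ≠ r}
    have h3 : {v | v ≠ r}ᶜ = {r} := by ext; simp
    rwa [h3, Set.ncard_singleton] at this
  omega

end parentGraph

/-! ### Loss and subtree sizes under unit resistances. -/

namespace EDNRInstance

variable (I : EDNRInstance)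

lemma root_notMem_des (T : SimpleGraph (Fin I.N)) (e : Sym2 (Fin I.N)) : I.root ∉ I.des T e := by
  simp [des]

open Classical in
/-- The number of vertices below `v` in the tree `T`. -/
noncomputable def numBelow (T : SimpleGraph (Fin I.N)) (v : Fin I.N) : ℕ :=
  (Finset.univ.filter fun x => ∀ p : T.Walk I.root x, p.IsPath → v ∈ p.support).card

lemma one_le_numBelow (T : SimpleGraph (Fin I.N)) (v : Fin I.N) : 1 ≤ I.numBelow T v := by
  classical
  exact Finset.card_pos.2 ⟨v, by simp⟩

/-- Distinct vertices have distinct parent edges, and deleting the parent edge of `v` cuts off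
everything below `v`, where each vertex has demand at least `dmin`. -/
lemma sum_numBelow_sq_le_loss (hres : ∀ e ∈ I.graph.edgeSet, I.resistance e = 1) {dmin : ℝ}
    (hd0 : 0 ≤ dmin) (hdem : ∀ v, v ≠ I.root → dmin ≤ (I.demand v : ℝ))
    {T : SimpleGraph (Fin I.N)} (hT : I.IsSpanningTree T) :
    dmin ^ 2 * ∑ v ∈ Finset.univ.erase I.root, (I.numBelow T v : ℝ) ^ 2 ≤ I.loss T := by
  classical
  obtain ⟨e, he, hinj, hbelow⟩ := hT.2.exists_parentEdge I.root
  set f : Sym2 (Fin I.N) → ℝ := fun e =>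
    (I.resistance e : ℝ) * (∑ v ∈ I.des T e, (I.demand v : ℝ)) ^ 2 with hf
  have h1 : ∑ v ∈ Finset.univ.erase I.root, f (e v) ≤ I.loss T := by
    rw [← Finset.sum_image (f := f) (g := e)]
    · unfold loss
      refine Finset.sum_le_sum_of_subset_of_nonneg ?_ fun _ _ _ => by positivity
      intro x hx
      simp only [Finset.mem_image, Finset.mem_erase, Finset.mem_univ, and_true] at hx
      obtain ⟨v, hv, rfl⟩ := hx
      simpa using he v hv
    · intro v hv w hw h
      exact hinj v w (by simpa using hv) (by simpa using hw) h
  refine le_trans ?_ h1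
  rw [Finset.mul_sum]
  refine Finset.sum_le_sum fun v hv => ?_
  have hv : v ≠ I.root := by simpa using hv
  have hr : I.resistance (e v) = 1 := hres _ (SimpleGraph.edgeSet_mono hT.1 (he v hv))
  simp only [hf, hr]
  rw [← mul_pow, NNRat.cast_one, one_mul]
  refine pow_le_pow_left₀ (by positivity) ?_ 2
  calc dmin * (I.numBelow T v : ℝ)
      ≤ dmin * ((I.des T (e v)).card : ℝ) := by
        refine mul_le_mul_of_nonneg_left ?_ hd0
        refine Nat.cast_le.2 (Finset.card_le_card fun x hx => ?_)
        simp only [Finset.mem_filter, Finset.mem_univ, true_and] at hx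
        simpa [des] using hbelow v x hv hx
    _ = ∑ x ∈ I.des T (e v), dmin := by simp [mul_comm]
    _ ≤ _ := Finset.sum_le_sum fun x hx => hdem x fun h => I.root_notMem_des T (e v) (h ▸ hx)

/-- A vertex whose line of ancestors misses `v` still reaches the root along this line when the
parent edge of `v` is deleted. So only descendants of `v` are cut off. -/
lemma loss_parentGraph_le {π : Fin I.N → Fin I.N} {D : Fin I.N → ℕ} (hr : π I.root = I.root)
    (hD : ∀ v, v ≠ I.root → D (π v) < D v) (hle : parentGraph π ≤ I.graph)
    (hres : ∀ e ∈ I.graph.edgeSet, I.resistance e = 1) {dmax : ℝ}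
    (hdem : ∀ v, v ≠ I.root → (I.demand v : ℝ) ≤ dmax) :
    I.loss (parentGraph π) ≤
      dmax ^ 2 * ∑ v ∈ Finset.univ.erase I.root, (numDesc π v : ℝ) ^ 2 := by
  classical
  set f : Sym2 (Fin I.N) → ℝ := fun e =>
    (I.resistance e : ℝ) * (∑ v ∈ I.des (parentGraph π) e, (I.demand v : ℝ)) ^ 2 with hf
  have himg : (parentGraph π).edgeFinset = (Finset.univ.erase I.root).image fun v => s(π v, v) := by
    ext e
    rw [SimpleGraph.mem_edgeFinset, edgeSet_parentGraph hr hD]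
    simp
  have h1 : I.loss (parentGraph π) ≤ ∑ v ∈ Finset.univ.erase I.root, f s(π v, v) := by
    have : I.loss (parentGraph π) = ∑ e ∈ (Finset.univ.erase I.root).image fun v => s(π v, v), f e := by
      rw [← himg]
      unfold loss
      congr!
    rw [this]
    exact Finset.sum_image_le_of_nonneg fun _ _ => by positivity
  refine h1.trans ?_
  rw [Finset.mul_sum]
  refine Finset.sum_le_sum fun v hv => ?_
  have hv : v ≠ I.root := by simpa using hv
  have hre : I.resistance s(π v, v) = 1 :=
    hres _ (SimpleGraph.edgeSet_mono hle (parentGraph_adj_parent hD hv))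
  have hdm : 0 ≤ dmax := le_trans (by positivity) (hdem v hv)
  simp only [hf, hre]
  rw [← mul_pow, NNRat.cast_one, one_mul]
  refine pow_le_pow_left₀ (by positivity) ?_ 2
  calc ∑ x ∈ I.des (parentGraph π) s(π v, v), (I.demand x : ℝ)
      ≤ ∑ x ∈ I.des (parentGraph π) s(π v, v), dmax :=
        Finset.sum_le_sum fun x hx => hdem x fun h => I.root_notMem_des _ _ (h ▸ hx)
    _ = dmax * ((I.des (parentGraph π) s(π v, v)).card : ℝ) := by simp [mul_comm]
    _ ≤ dmax * (numDesc π v : ℝ) := by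
      refine mul_le_mul_of_nonneg_left ?_ hdm
      refine Nat.cast_le.2 (Finset.card_le_card fun x hx => ?_)
      simp only [des, Finset.mem_filter, Finset.mem_univ, true_and] at hx ⊢
      by_contra hx'
      refine hx ?_
      have key : ∀ k, ∀ x, D x ≤ k → (¬ ∃ k, π^[k] x = v) →
          ((parentGraph π).deleteEdges {s(π v, v)}).Reachable I.root x := by
        intro k
        induction k with
        | zero =>
          intro x hx _
          by_cases h : x = I.root
          · rw [h]
          · have := hD x h
            omega
        | succ k ih =>
          intro x hx hxv
          by_cases h : x = I.root
          · rw [h]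
          · have hlt := hD x h
            refine (ih (π x) (by omega) ?_).trans (SimpleGraph.Adj.reachable ?_)
            · rintro ⟨j, hj⟩
              exact hxv ⟨j + 1, by rwa [Function.iterate_succ_apply]⟩
            · rw [SimpleGraph.deleteEdges_adj]
              refine ⟨parentGraph_adj_parent hD h, fun hmem => ?_⟩
              -- The edge from `x` to `π x` is the deleted one only if `x = v` or `π x = v`; either
              -- way `v` is an iterate of `x`.
              rw [Set.mem_singleton_iff, Sym2.eq_iff] at hmem
              rcases hmem with hmem | hmem
              · exact hxv ⟨0, hmem.2⟩
              · exact hxv ⟨1, hmem.1⟩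
      exact key _ x le_rfl hx'

end EDNRInstance

/-! ### Grid coordinates -/

/-- `a` and `b` are coordinates that identify `G` with the `n × m` grid and `r` with its corner
`(0, 0)`. -/
structure IsGridCoord {V : Type*} (G : SimpleGraph V) (r : V) (n m : ℕ) (a b : V → ℕ) : Prop where
  a_lt : ∀ v, a v < n
  b_lt : ∀ v, b v < m
  inj : ∀ u v, a u = a v → b u = b v → u = v
  surj : ∀ i < n, ∀ j < m, ∃ v, a v = i ∧ b v = j
  adj_iff : ∀ u v, G.Adj u v ↔ (a u = a v ∧ (b u + 1 = b v ∨ b v + 1 = b u)) ∨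
    (b u = b v ∧ (a u + 1 = a v ∨ a v + 1 = a u))
  a_root : a r = 0
  b_root : b r = 0

/-- Reflecting each axis on which the root is at the far end moves the root to `(0, 0)` and
preserves adjacency. -/
lemma EDNRInstance.IsCornerRootedGrid.exists_isGridCoord {I : EDNRInstance}
    (h : I.IsCornerRootedGrid) : ∃ n m a b, IsGridCoord I.graph I.root n m a b := by
  obtain ⟨n, m, φ, h1, h2⟩ := h
  have hflip : ∀ (k c : ℕ), (c = 0 ∨ c + 1 = k) → ∃ f : ℕ → ℕ, f c = 0 ∧ (∀ x < k, f x < k) ∧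
      (∀ x < k, f (f x) = x) ∧ ∀ x < k, ∀ y < k,
        ((x + 1 = y ∨ y + 1 = x) ↔ (f x + 1 = f y ∨ f y + 1 = f x)) := by
    intro k c hc
    rcases hc with rfl | hc
    · exact ⟨id, by simp⟩
    · exact ⟨fun x => k - 1 - x, by simp; omega, fun x _ => by grind, fun x _ => by grind,
        fun x _ y _ => by grind⟩
  obtain ⟨f, f1, f2, f3, f4⟩ := hflip n _ h1
  obtain ⟨g, g1, g2, g3, g4⟩ := hflip m _ h2
  have finj : ∀ x < n, ∀ y < n, f x = f y → x = y := fun x hx y hy h => by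
    rw [← f3 x hx, h, f3 y hy]
  have ginj : ∀ x < m, ∀ y < m, g x = g y → x = y := fun x hx y hy h => by
    rw [← g3 x hx, h, g3 y hy]
  refine ⟨n, m, fun v => f (φ v).1, fun v => g (φ v).2, fun v => f2 _ (φ v).1.2,
    fun v => g2 _ (φ v).2.2, fun u v hu hv => ?_, fun i hi j hj => ?_, fun u v => ?_, f1, g1⟩
  · exact φ.injective (Prod.ext (Fin.ext (finj _ (φ u).1.2 _ (φ v).1.2 hu))
      (Fin.ext (ginj _ (φ u).2.2 _ (φ v).2.2 hv)))
  · refine ⟨φ.symm (⟨f i, f2 i hi⟩, ⟨g j, g2 j hj⟩), ?_, ?_⟩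
    · simp [f3 i hi]
    · simp [g3 j hj]
  · rw [← φ.map_adj_iff, SimpleGraph.boxProd_adj, SimpleGraph.pathGraph_adj,
      SimpleGraph.pathGraph_adj, f4 _ (φ u).1.2 _ (φ v).1.2, g4 _ (φ u).2.2 _ (φ v).2.2]
    have e1 : (φ u).1 = (φ v).1 ↔ f (φ u).1 = f (φ v).1 :=
      ⟨fun h => by rw [h], fun h => Fin.ext (finj _ (φ u).1.2 _ (φ v).1.2 h)⟩
    have e2 : (φ u).2 = (φ v).2 ↔ g (φ u).2 = g (φ v).2 :=
      ⟨fun h => by rw [h], fun h => Fin.ext (ginj _ (φ u).2.2 _ (φ v).2.2 h)⟩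
    rw [e1, e2]
    tauto

namespace IsGridCoord

variable {V : Type*} {G : SimpleGraph V} {r : V} {n m : ℕ} {a b : V → ℕ}

lemma swap (h : IsGridCoord G r n m a b) : IsGridCoord G r m n b a where
  a_lt := h.b_lt
  b_lt := h.a_lt
  inj u v h1 h2 := h.inj u v h2 h1
  surj i hi j hj := by
    obtain ⟨v, hv⟩ := h.surj j hj i hi
    exact ⟨v, hv.symm⟩
  adj_iff u v := by rw [h.adj_iff]; tauto
  a_root := h.b_root
  b_root := h.a_root

lemma rank_le (h : IsGridCoord G r n m a b) (u v : V) (huv : G.Adj u v) :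
    a v + b v ≤ a u + b u + 1 := by
  have := (h.adj_iff u v).1 huv
  omega

lemma eq_root_iff (h : IsGridCoord G r n m a b) (v : V) : v = r ↔ a v + b v = 0 := by
  refine ⟨fun hv => by rw [hv, h.a_root, h.b_root], fun hv => h.inj _ _ ?_ ?_⟩
  · rw [h.a_root]; omega
  · rw [h.b_root]; omega

lemma n_pos (h : IsGridCoord G r n m a b) : 0 < n := (Nat.zero_le _).trans_lt (h.a_lt r)

lemma m_pos (h : IsGridCoord G r n m a b) : 0 < m := (Nat.zero_le _).trans_lt (h.b_lt r)

variable [Fintype V]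

lemma sum_eq {M : Type*} [AddCommMonoid M] (h : IsGridCoord G r n m a b) (f : ℕ → ℕ → M) :
    ∑ v, f (a v) (b v) = ∑ i ∈ Finset.range n, ∑ j ∈ Finset.range m, f i j := by
  rw [← Finset.sum_product']
  refine Finset.sum_bij (fun v _ => (a v, b v)) (fun v _ => ?_) (fun u _ v _ huv => ?_)
    (fun x hx => ?_) fun v _ => rfl
  · simp [h.a_lt, h.b_lt]
  · rw [Prod.mk.injEq] at huv
    exact h.inj u v huv.1 huv.2
  · simp only [Finset.mem_product, Finset.mem_range] at hx
    obtain ⟨v, h1, h2⟩ := h.surj x.1 hx.1 x.2 hx.2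
    exact ⟨v, by simp, Prod.ext h1 h2⟩

lemma card_eq (h : IsGridCoord G r n m a b) : Fintype.card V = n * m := by
  have := h.sum_eq fun _ _ => 1
  simpa using this

end IsGridCoord

/-! ### The lower bound -/

namespace IsGridCoord

variable {V : Type*} [Fintype V] {G : SimpleGraph V} {r : V} {n m : ℕ} {a b : V → ℕ}

/-- On a diagonal a vertex is determined by its first coordinate, which is at most `d` and less than
`n`. -/
lemma card_layer_le (h : IsGridCoord G r n m a b) (d : ℕ) :
    (Finset.univ.filter fun v => a v + b v = d).card ≤ min (d + 1) n := by
  have H : ∀ k, (∀ v, a v + b v = d → a v < k) →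
      (Finset.univ.filter fun v => a v + b v = d).card ≤ k := by
    intro k hk
    rw [← Finset.card_range k]
    refine Finset.card_le_card_of_injOn a (fun v hv => ?_) fun u hu v hv huv => ?_
    · simpa using hk v (by simpa using hv)
    · have h1 : a u + b u = d := by simpa using hu
      have h2 : a v + b v = d := by simpa using hv
      exact h.inj u v huv (by omega)
  exact le_min (H _ fun v hv => by omega) (H _ fun v _ => h.a_lt v)

/-- The diagonals before `d` have at most `1, 2, …, d` vertices. This estimate serves the diagonals
`d < n`, `le_card_beyond'` the diagonals `n ≤ d < m`. -/
lemma le_card_beyond (h : IsGridCoord G r n m a b) (d : ℕ) :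
    (n * m : ℝ) - d * (d + 1) / 2 ≤ ((Finset.univ.filter fun v => d ≤ a v + b v).card : ℝ) := by
  have h1 : (Finset.univ.filter fun v => ¬ d ≤ a v + b v).card ≤ ∑ i ∈ Finset.range d, (i + 1) := by
    classical
    calc _ ≤ ((Finset.range d).biUnion fun i => Finset.univ.filter fun v => a v + b v = i).card :=
          Finset.card_le_card fun v hv => by simpa using hv
      _ ≤ ∑ i ∈ Finset.range d, (Finset.univ.filter fun v => a v + b v = i).card :=
          Finset.card_biUnion_le
      _ ≤ _ := Finset.sum_le_sum fun i _ => (h.card_layer_le i).trans (min_le_left _ _)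
  have h2 := Finset.card_filter_add_card_filter_not (s := Finset.univ) (fun v => d ≤ a v + b v)
  rw [Finset.card_univ, h.card_eq] at h2
  have h3 : ∀ k : ℕ, ((∑ i ∈ Finset.range k, (i + 1) : ℕ) : ℝ) = k * (k + 1) / 2 := by
    intro k
    induction k with
    | zero => simp
    | succ k ih => rw [Finset.sum_range_succ]; push_cast at ih ⊢; rw [ih]; ring
  have h4 : ((Finset.univ.filter fun v => ¬ d ≤ a v + b v).card : ℝ) ≤ d * (d + 1) / 2 := by
    rw [← h3]
    exact_mod_cast h1
  have h5 : ((Finset.univ.filter fun v => d ≤ a v + b v).card : ℝ) +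
      ((Finset.univ.filter fun v => ¬ d ≤ a v + b v).card : ℝ) = n * m := by exact_mod_cast h2
  linarith

lemma le_card_beyond' (h : IsGridCoord G r n m a b) (d : ℕ) :
    n * (m - d) ≤ (Finset.univ.filter fun v => d ≤ a v + b v).card := by
  have h1 := h.sum_eq fun _ j => if d ≤ j then 1 else 0
  simp only [Finset.sum_boole, Finset.sum_const, Finset.card_range, smul_eq_mul] at h1
  have h2 : ((Finset.range m).filter fun j => d ≤ j) = Finset.Ico d m := by
    ext; simp; omega
  rw [h2, Nat.card_Ico] at h1
  simp only [Nat.cast_id] at h1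
  rw [← h1]
  exact Finset.card_le_card fun v hv => by simp at hv ⊢; omega

/-- Cauchy–Schwarz on one diagonal. -/
lemma sq_card_beyond_le {d : ℕ} (c : V → ℕ) {s : ℝ} (hs0 : 0 < s)
    (hs : ((Finset.univ.filter fun v => a v + b v = d).card : ℝ) ≤ s)
    (hc : (Finset.univ.filter fun v => d ≤ a v + b v).card ≤
      ∑ v ∈ Finset.univ.filter (fun v => a v + b v = d), c v) :
    ((Finset.univ.filter fun v => d ≤ a v + b v).card : ℝ) ^ 2 / s ≤
      ∑ v ∈ Finset.univ.filter (fun v => a v + b v = d), (c v : ℝ) ^ 2 := by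
  rw [div_le_iff₀ hs0]
  have h1 : ((Finset.univ.filter fun v => d ≤ a v + b v).card : ℝ) ≤
      ∑ v ∈ Finset.univ.filter (fun v => a v + b v = d), (c v : ℝ) := by exact_mod_cast hc
  calc _ ≤ (∑ v ∈ Finset.univ.filter (fun v => a v + b v = d), (c v : ℝ)) ^ 2 :=
        pow_le_pow_left₀ (by positivity) h1 2
    _ ≤ _ := sq_sum_le_card_mul_sum_sq
    _ ≤ s * _ := mul_le_mul_of_nonneg_right hs (Finset.sum_nonneg fun _ _ => by positivity)
    _ = _ := mul_comm _ _

/-- Functions on the vertices of a grid whose sum over each layer is at least the number of the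
vertices in or beyond this layer have a large sum of squares. -/
lemma lower_bound (h : IsGridCoord G r n m a b) (hnm : n ≤ m) (c : V → ℕ)
    (hc : ∀ d, (Finset.univ.filter fun v => d ≤ a v + b v).card ≤
      ∑ v ∈ Finset.univ.filter (fun v => a v + b v = d), c v) :
    ((n * m : ℕ) : ℝ) ^ 2 * ((∑ i ∈ Finset.range n, 1 / ((i : ℝ) + 1)) - 5 / 2) + n * (m : ℝ) ^ 3 / 3
      ≤ ∑ v ∈ Finset.univ.filter (fun v => 1 ≤ a v + b v), (c v : ℝ) ^ 2 := by
  classical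
  set g : ℕ → ℝ := fun d => ∑ v ∈ Finset.univ.filter (fun v => a v + b v = d), (c v : ℝ) ^ 2
    with hg
  have hn0 : (0 : ℝ) < n := by exact_mod_cast h.n_pos
  have hm0 : (0 : ℝ) < m := by exact_mod_cast h.m_pos
  have hnm' : (n : ℝ) ≤ m := by exact_mod_cast hnm
  have h1 : ∑ d ∈ Finset.Ico 1 m, g d ≤
      ∑ v ∈ Finset.univ.filter (fun v => 1 ≤ a v + b v), (c v : ℝ) ^ 2 := by
    rw [hg, ← Finset.sum_biUnion]
    · refine Finset.sum_le_sum_of_subset_of_nonneg (fun v hv => ?_) fun _ _ _ => by positivity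
      simp only [Finset.mem_biUnion, Finset.mem_Ico, Finset.mem_filter, Finset.mem_univ,
        true_and] at hv ⊢
      omega
    · intro d _ d' _ hdd
      refine Finset.disjoint_filter.2 fun v _ h1 h2 => hdd (h1.symm.trans h2)
  refine le_trans ?_ h1
  rw [← Finset.sum_Ico_consecutive g h.n_pos hnm]
  -- Diagonals `1 ≤ d < n`. Of the loss `3/2`, `1` is the missing term `d = 0` of the harmonic sum
  -- and `1/2` comes from summing the errors `n m d`.
  have hA : ((n * m : ℕ) : ℝ) ^ 2 * ((∑ i ∈ Finset.range n, 1 / ((i : ℝ) + 1)) - 3 / 2) ≤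
      ∑ d ∈ Finset.Ico 1 n, g d := by
    have hterm : ∀ d ∈ Finset.Ico 1 n,
        ((n * m : ℕ) : ℝ) ^ 2 * (1 / ((d : ℝ) + 1)) - n * m * d ≤ g d := by
      intro d hd
      rw [Finset.mem_Ico] at hd
      have hd1 : (0 : ℝ) < (d : ℝ) + 1 := by positivity
      have hs : ((Finset.univ.filter fun v => a v + b v = d).card : ℝ) ≤ (d : ℝ) + 1 := by
        exact_mod_cast (h.card_layer_le d).trans (min_le_left _ _)
      refine le_trans ?_ (sq_card_beyond_le c hd1 hs (hc d))
      have hF := h.le_card_beyond d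
      have hdn : (d : ℝ) + 1 ≤ n := by exact_mod_cast hd.2
      have hx : (0 : ℝ) ≤ (n * m : ℝ) - d * (d + 1) / 2 := by
        have : (d : ℝ) * (d + 1) ≤ n * m :=
          mul_le_mul (by linarith) (by linarith) hd1.le hn0.le
        have : 0 ≤ (d : ℝ) * (d + 1) := by positivity
        linarith
      rw [le_div_iff₀ hd1]
      refine le_trans ?_ (pow_le_pow_left₀ hx hF 2)
      have e : (((n * m : ℕ) : ℝ) ^ 2 * (1 / ((d : ℝ) + 1)) - n * m * d) * ((d : ℝ) + 1) =
          (n * m : ℝ) ^ 2 - n * m * (d * (d + 1)) := by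
        push_cast
        field_simp
      rw [e]
      nlinarith [sq_nonneg ((d : ℝ) * (d + 1) / 2)]
    refine le_trans ?_ (Finset.sum_le_sum hterm)
    rw [Finset.sum_sub_distrib, ← Finset.mul_sum, ← Finset.mul_sum]
    have e1 : ∑ i ∈ Finset.range n, 1 / ((i : ℝ) + 1) = 1 + ∑ d ∈ Finset.Ico 1 n, 1 / ((d : ℝ) + 1) := by
      rw [Finset.range_eq_Ico, Finset.sum_eq_sum_Ico_succ_bot h.n_pos]
      simp
    have e2 : ∀ k : ℕ, ∑ d ∈ Finset.Ico 1 k, (d : ℝ) ≤ (k : ℝ) ^ 2 / 2 := by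
      intro k
      induction k with
      | zero => simp
      | succ k ih =>
        rcases Nat.eq_zero_or_pos k with rfl | hk
        · simp
        · rw [Finset.sum_Ico_succ_top hk]
          push_cast
          nlinarith
    rw [e1]
    have e3 : (n * m : ℝ) * ∑ d ∈ Finset.Ico 1 n, (d : ℝ) ≤ (n * m : ℝ) * ((n * m : ℝ) / 2) := by
      refine mul_le_mul_of_nonneg_left ((e2 n).trans ?_) (by positivity)
      nlinarith
    push_cast
    nlinarith
  -- Diagonals `n ≤ d < m`. The terms `n (m - d)²` add up to at least `n (m - n)³ / 3`, and `(m -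
  -- n)³ ≥ m³ - 3 m² n` accounts for the loss of `(nm)²`.
  have hB : (n : ℝ) * (m : ℝ) ^ 3 / 3 - ((n * m : ℕ) : ℝ) ^ 2 ≤ ∑ d ∈ Finset.Ico n m, g d := by
    have hterm : ∀ d ∈ Finset.Ico n m, (n : ℝ) * ((m : ℝ) - d) ^ 2 ≤ g d := by
      intro d hd
      rw [Finset.mem_Ico] at hd
      have hs : ((Finset.univ.filter fun v => a v + b v = d).card : ℝ) ≤ n := by
        exact_mod_cast (h.card_layer_le d).trans (min_le_right _ _)
      refine le_trans ?_ (sq_card_beyond_le c hn0 hs (hc d))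
      have hF := h.le_card_beyond' d
      have hF' : (n : ℝ) * ((m : ℝ) - d) ≤
          ((Finset.univ.filter fun v => d ≤ a v + b v).card : ℝ) := by
        rw [← Nat.cast_sub hd.2.le]
        exact_mod_cast hF
      rw [le_div_iff₀ hn0]
      have hmd : (0 : ℝ) ≤ (m : ℝ) - d := by
        rw [← Nat.cast_sub hd.2.le]
        positivity
      refine le_trans (le_of_eq ?_) (pow_le_pow_left₀ (by positivity) hF' 2)
      ring
    refine le_trans ?_ (Finset.sum_le_sum hterm)
    rw [← Finset.mul_sum]
    have e2 : ∀ k : ℕ, n ≤ k → k ≤ m → (((m : ℝ) - n) ^ 3 - ((m : ℝ) - k) ^ 3) / 3 ≤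
        ∑ d ∈ Finset.Ico n k, ((m : ℝ) - d) ^ 2 := by
      intro k hk
      induction k, hk using Nat.le_induction with
      | base => simp
      | succ k hk ih =>
        intro hkm
        have h1 := ih (by omega)
        have h2 : (k : ℝ) + 1 ≤ m := by exact_mod_cast hkm
        rw [Finset.sum_Ico_succ_top hk]
        push_cast
        nlinarith
    have e3 := mul_le_mul_of_nonneg_left (e2 m hnm le_rfl) hn0.le
    refine le_trans ?_ e3
    rw [sub_self]
    push_cast
    have e4 : (m : ℝ) ^ 3 - 3 * m ^ 2 * n ≤ ((m : ℝ) - n) ^ 3 - 0 ^ 3 := by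
      nlinarith [mul_nonneg (sq_nonneg (n : ℝ)) (sub_nonneg.2 hnm'), sq_nonneg (n : ℝ)]
    have e5 := mul_le_mul_of_nonneg_left e4 hn0.le
    linarith
  push_cast at hA hB ⊢
  linarith

end IsGridCoord

/-! ### The tree in coordinates -/

/-- The parent of the grid vertex `(a, b)` is `(a, b - 1)`. Below the diagonal `K`, the trunks
split one after the other; beyond it, they run vertically until they reach the line from `(n, 0)`
to `(0, K)`, where the rows branch off. -/
def IsHorizontal (K n a b : ℕ) : Prop :=
  if a + b < K then 2 ^ (Nat.log 2 (a + b) + 1) ≤ a + 2 * b else K * n ≤ a * K + b * n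

instance (K n a b : ℕ) : Decidable (IsHorizontal K n a b) := by
  unfold IsHorizontal
  infer_instance

/-- The parent of a grid vertex. -/
def parentCoord (K n : ℕ) (x : ℕ × ℕ) : ℕ × ℕ :=
  if IsHorizontal K n x.1 x.2 then (x.1, x.2 - 1) else (x.1 - 1, x.2)

/-- The position on the diagonal `d` of the ancestor of the trunk `i`, where there are `2 ^ J`
trunks. -/
def trunkPos (J d i : ℕ) : ℕ :=
  if d = 0 then 0 else
    if i / 2 ^ (J - Nat.log 2 d - 1) < 2 * (d - 2 ^ Nat.log 2 d) + 2 then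
      i / 2 ^ (J - Nat.log 2 d - 1)
    else i / 2 ^ (J - Nat.log 2 d - 1) / 2 + (d - 2 ^ Nat.log 2 d) + 1

/-- The grid vertex `x` is on the path from the root to the trunk `i`, or below the trunk `i`. -/
def OnTrunk (J n : ℕ) (x : ℕ × ℕ) (i : ℕ) : Prop :=
  if x.1 + x.2 < 2 ^ J then trunkPos J (x.1 + x.2) i = x.1
  else i = if IsHorizontal (2 ^ J) n x.1 x.2 then x.1 * 2 ^ J / n else 2 ^ J - 1 - x.2

instance (J n : ℕ) (x : ℕ × ℕ) (i : ℕ) : Decidable (OnTrunk J n x i) := by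
  unfold OnTrunk
  infer_instance

/-! ### Parents stay inside the grid, and trunks are closed under taking parents. -/

section rank

variable {K n a b : ℕ}

/-- Ensures that the subtraction in `parentCoord` does not truncate: for `b = 0` the horizontality
conditions read `2 ^ (log a + 1) ≤ a` and `K n ≤ a K`, both impossible for `a < n`. -/
lemma IsHorizontal.pos (hK0 : 0 < K) (h : IsHorizontal K n a b) (ha : a < n) (h0 : a + b ≠ 0) : 0 < b := by
  unfold IsHorizontal at h
  rcases Nat.eq_zero_or_pos b with rfl | hb
  · split_ifs at h with hK
    · have := Nat.lt_pow_succ_log_self (b := 2) (by norm_num) (a + 0)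
      omega
    · have : a * K < n * K := Nat.mul_lt_mul_of_pos_right ha hK0
      nlinarith
  · exact hb

lemma pos_of_not_isHorizontal (h : ¬ IsHorizontal K n a b) (h0 : a + b ≠ 0) : 0 < a := by
  unfold IsHorizontal at h
  rcases Nat.eq_zero_or_pos a with rfl | ha
  · split_ifs at h with hK
    · have := Nat.pow_log_le_self 2 h0
      rw [pow_succ] at h
      omega
    · exact absurd (by nlinarith [Nat.mul_le_mul_right n (not_lt.1 hK)]) h
  · exact ha

end rank

/-- All splits are complete on the diagonal `2 ^ J - 1`: groups have one trunk and each has its own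
vertex. -/
lemma trunkPos_last {J i : ℕ} (hi : i < 2 ^ J) : trunkPos J (2 ^ J - 1) i = i := by
  unfold trunkPos
  rcases Nat.eq_zero_or_pos J with rfl | hJ
  · simp at hi ⊢
    exact hi.symm
  · obtain ⟨j, rfl⟩ : ∃ j, J = j + 1 := ⟨J - 1, by omega⟩
    have h1 : 0 < 2 ^ j := by positivity
    have hlog : Nat.log 2 (2 ^ (j + 1) - 1) = j := by
      rw [Nat.log_eq_iff (Or.inr ⟨by norm_num, by rw [pow_succ]; omega⟩)]
      rw [pow_succ]
      omega
    rw [hlog, pow_succ] at *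
    simp only [Nat.add_sub_cancel_left, Nat.sub_self, pow_zero, Nat.div_one]
    split_ifs <;> omega

/-- Write `d = 2 ^ j + t`; the condition `2 ^ (j + 1) ≤ a + 2 b` says `a ≤ 2 t`. Going from `d` to
`d - 1` merges the positions `2 t` and `2 t + 1`: those up to `2 t` stay and those after it move by
one. So each diagonal performs one split. -/
lemma trunkPos_pred {J d a b i : ℕ} (hi : i < 2 ^ J) (hd : d ≠ 0) (hdJ : d < 2 ^ J)
    (hab : a + b = d) (h : trunkPos J d i = a) :
    trunkPos J (d - 1) i = if 2 ^ (Nat.log 2 d + 1) ≤ a + 2 * b then a else a - 1 := by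
  set j := Nat.log 2 d with hj
  have h1 : 2 ^ j ≤ d := Nat.pow_log_le_self 2 hd
  have h2 : d < 2 ^ (j + 1) := Nat.lt_pow_succ_log_self (by norm_num) d
  have hjJ : j < J := by
    by_contra hcon
    have := Nat.pow_le_pow_right (n := 2) (by norm_num) (not_lt.1 hcon)
    omega
  rw [trunkPos, if_neg hd, ← hj] at h
  set f := i / 2 ^ (J - j - 1) with hf
  have hpow : 2 ^ (j + 1) = 2 * 2 ^ j := by ring
  rw [hpow] at h2 ⊢
  -- At a power of two the level changes: all groups are separate on diagonal `d - 1`, and each of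
  -- them consists of two groups of the level of `d`.
  by_cases ht : d = 2 ^ j
  · rcases Nat.eq_zero_or_pos j with hj0 | hj0
    · rw [hj0] at ht h2
      have hd1 : d = 1 := by simpa using ht
      subst hd1
      simp [trunkPos, hj0]
      split_ifs <;> omega
    · obtain ⟨l, hl⟩ : ∃ l, j = l + 1 := ⟨j - 1, by omega⟩
      have hlpos : 0 < 2 ^ l := by positivity
      have e : 2 ^ j = 2 * 2 ^ l := by rw [hl]; ring
      have hlog : Nat.log 2 (d - 1) = l := by
        rw [Nat.log_eq_iff (Or.inr ⟨by norm_num, by omega⟩)]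
        rw [← hl]
        omega
      have hf2 : i / 2 ^ (J - l - 1) = f / 2 := by
        rw [hf, Nat.div_div_eq_div_mul]
        congr 1
        rw [← pow_succ]
        congr 1
        omega
      have hlt : f / 2 < 2 ^ j := by
        rw [← hf2, Nat.div_lt_iff_lt_mul (by positivity), ← pow_add]
        refine hi.trans_le (Nat.pow_le_pow_right (by norm_num) (by omega))
      rw [trunkPos, if_neg (by omega), hlog, hf2]
      split_ifs at h ⊢ <;> omega
  · have hlog : Nat.log 2 (d - 1) = j := by
      rw [Nat.log_eq_iff (Or.inr ⟨by norm_num, by omega⟩), hpow]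
      omega
    rw [trunkPos, if_neg (by have : 0 < 2 ^ j := by positivity
                             omega), hlog, ← hf]
    split_ifs at h ⊢ <;> omega

/-- The delicate cases are the entrance into the splitting region, where the numbering by columns or
rows must match `trunkPos`, and the passage from a row to a vertical run, where the two numberings
beyond the diagonal must agree. -/
lemma OnTrunk.parentCoord {J n i : ℕ} {x : ℕ × ℕ} (hn : 2 ^ J ≤ n) (hi : i < 2 ^ J)
    (hx : x.1 < n) (h0 : x.1 + x.2 ≠ 0) (h : OnTrunk J n x i) :
    OnTrunk J n (parentCoord (2 ^ J) n x) i := by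
  obtain ⟨a, b⟩ := x
  dsimp only at hx h0
  have hn0 : 0 < n := by omega
  have hb := fun hh : IsHorizontal (2 ^ J) n a b => hh.pos (by positivity) hx h0
  have ha := fun hh : ¬ IsHorizontal (2 ^ J) n a b => pos_of_not_isHorizontal hh h0
  rcases lt_trichotomy (a + b) (2 ^ J) with hd | hd | hd
  · have h1 : trunkPos J (a + b) i = a := by simpa [OnTrunk, hd] using h
    have h2 := trunkPos_pred hi h0 hd rfl h1
    have hH : IsHorizontal (2 ^ J) n a b ↔ 2 ^ (Nat.log 2 (a + b) + 1) ≤ a + 2 * b := by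
      simp [IsHorizontal, hd]
    by_cases hh : IsHorizontal (2 ^ J) n a b
    · have := hb hh
      rw [if_pos (hH.1 hh)] at h2
      have e : a + (b - 1) = a + b - 1 := by omega
      simp only [_root_.parentCoord, hh, if_true, OnTrunk]
      rw [if_pos (by omega), e, h2]
    · have := ha hh
      rw [if_neg (hH.not.1 hh)] at h2
      have e : a - 1 + b = a + b - 1 := by omega
      simp only [_root_.parentCoord, hh, if_false, OnTrunk]
      rw [if_pos (by omega), e, h2]
  · have h1 : i = if IsHorizontal (2 ^ J) n a b then a * 2 ^ J / n else 2 ^ J - 1 - b := by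
      simpa [OnTrunk, hd] using h
    by_cases hh : IsHorizontal (2 ^ J) n a b
    · have := hb hh
      rw [if_pos hh] at h1
      have e : a + (b - 1) = 2 ^ J - 1 := by omega
      simp only [_root_.parentCoord, hh, if_true, OnTrunk]
      rw [if_pos (by omega), e, trunkPos_last hi, h1]
      simp only [IsHorizontal, hd, lt_irrefl, if_false] at hh
      rw [← hd, add_mul] at hh
      -- On diagonal `K = 2 ^ J` a horizontal vertex has `a = 0` or `n = K`; in both cases `a K / n
      -- = a`.
      have hle : a * n ≤ a * (a + b) := by omega
      rcases Nat.eq_zero_or_pos a with rfl | ha0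
      · simp
      · have := Nat.le_of_mul_le_mul_left hle ha0
        have : n = 2 ^ J := by omega
        rw [← this, Nat.mul_div_cancel _ hn0]
    · have := ha hh
      rw [if_neg hh] at h1
      have e : a - 1 + b = 2 ^ J - 1 := by omega
      simp only [_root_.parentCoord, hh, if_false, OnTrunk]
      rw [if_pos (by omega), e, trunkPos_last hi, h1]
      omega
  · have h1 : i = if IsHorizontal (2 ^ J) n a b then a * 2 ^ J / n else 2 ^ J - 1 - b := by
      simpa [OnTrunk, hd.not_gt] using h
    by_cases hh : IsHorizontal (2 ^ J) n a b
    · have hb0 := hb hh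
      rw [if_pos hh] at h1
      simp only [_root_.parentCoord, hh, if_true, OnTrunk]
      rw [if_neg (by omega), h1]
      split_ifs with h3
      · rfl
      · simp only [IsHorizontal, if_neg hd.not_gt] at hh
        rw [IsHorizontal, if_neg (by omega)] at h3
        -- The vertex is horizontal and its parent is not, so `a K` lies between `(K - b) n` and `(K
        -- - b + 1) n`. The quotient is therefore `K - b`, the trunk of column `b - 1`.
        obtain ⟨c, rfl⟩ : ∃ c, b = c + 1 := ⟨b - 1, by omega⟩
        rw [Nat.add_sub_cancel] at h3 ⊢
        have hc : c < 2 ^ J := by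
          by_contra hcon
          have := Nat.mul_le_mul_right n (not_lt.1 hcon)
          omega
        obtain ⟨e, he⟩ : ∃ e, 2 ^ J = c + 1 + e := ⟨2 ^ J - 1 - c, by omega⟩
        rw [he] at hh h3 ⊢
        have : c + 1 + e - 1 - c = e := by omega
        rw [this]
        refine Nat.div_eq_of_lt_le ?_ ?_ <;> nlinarith
    · have ha0 := ha hh
      rw [if_neg hh] at h1
      simp only [_root_.parentCoord, hh, if_false, OnTrunk]
      rw [if_neg (by omega), h1]
      rw [if_neg]
      intro h3
      simp only [IsHorizontal, if_neg hd.not_gt] at hh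
      rw [IsHorizontal, if_neg (by omega)] at h3
      have := Nat.mul_le_mul_right (2 ^ J) (Nat.sub_le a 1)
      omega

/-- With `t = d - 2 ^ j`, position `a` is reached by the first trunk of group `a` if this group
stands alone, and of group `2 (a - t - 1)` if groups are still paired. -/
lemma exists_onTrunk {J n : ℕ} {x : ℕ × ℕ} (hx : x.1 < n) :
    ∃ i < 2 ^ J, OnTrunk J n x i := by
  obtain ⟨a, b⟩ := x
  dsimp only at hx
  have hK : 0 < 2 ^ J := by positivity
  by_cases hd : a + b < 2 ^ J
  · simp only [OnTrunk, hd, if_true]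
    by_cases h0 : a + b = 0
    · exact ⟨0, hK, by simp [trunkPos, h0]; omega⟩
    set j := Nat.log 2 (a + b) with hj
    have h1 : 2 ^ j ≤ a + b := Nat.pow_log_le_self 2 h0
    have h2 : a + b < 2 ^ (j + 1) := Nat.lt_pow_succ_log_self (by norm_num) _
    have hjJ : j < J := by
      by_contra hcon
      have := Nat.pow_le_pow_right (n := 2) (by norm_num) (not_lt.1 hcon)
      omega
    have hpow : 2 ^ (j + 1) = 2 * 2 ^ j := by ring
    have hw : 0 < 2 ^ (J - j - 1) := by positivity
    have hKw : 2 ^ J = 2 ^ (j + 1) * 2 ^ (J - j - 1) := by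
      rw [← pow_add]; congr 1; omega
    simp only [trunkPos, h0, if_false, ← hj]
    by_cases hlt : a < 2 * (a + b - 2 ^ j) + 2
    · refine ⟨a * 2 ^ (J - j - 1), ?_, ?_⟩
      · rw [hKw]
        exact Nat.mul_lt_mul_of_pos_right (by omega) hw
      · rw [Nat.mul_div_cancel _ hw, if_pos hlt]
    · refine ⟨2 * (a - (a + b - 2 ^ j) - 1) * 2 ^ (J - j - 1), ?_, ?_⟩
      · rw [hKw]
        exact Nat.mul_lt_mul_of_pos_right (by omega) hw
      · rw [Nat.mul_div_cancel _ hw, if_neg (by omega)]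
        omega
  · simp only [OnTrunk, hd, if_false, exists_eq_right]
    split_ifs with h
    · rw [Nat.div_lt_iff_lt_mul (by omega), mul_comm]
      exact Nat.mul_lt_mul_of_pos_left hx hK
    · omega

lemma card_div_eq_le (k w c : ℕ) (hw : 0 < w) :
    ((Finset.range k).filter fun i => i / w = c).card ≤ w := by
  calc _ ≤ (Finset.Ico (c * w) (c * w + w)).card := by
        refine Finset.card_le_card fun i hi => ?_
        simp only [Finset.mem_filter, Finset.mem_range, Finset.mem_Ico] at hi ⊢
        obtain ⟨-, rfl⟩ := hi
        have h1 := Nat.div_add_mod i w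
        have h2 := Nat.mod_lt i hw
        rw [mul_comm] at h1
        omega
    _ = w := by simp

/-- The number of trunks that pass through or end at a vertex. -/
def numTrunks (J n : ℕ) (x : ℕ × ℕ) : ℕ := ((Finset.range (2 ^ J)).filter (OnTrunk J n x)).card

lemma numTrunks_le_one {J n : ℕ} {x : ℕ × ℕ} (hx : 2 ^ J ≤ x.1 + x.2) : numTrunks J n x ≤ 1 := by
  unfold numTrunks
  rw [Finset.card_le_one]
  intro i hi i' hi'
  simp only [Finset.mem_filter, OnTrunk, hx.not_gt, if_false] at hi hi'
  rw [hi.2, hi'.2]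

/-- On each diagonal, the sum of squares exceeds that of a uniform distribution by a factor of at
most `9 / 8`. -/
lemma sum_numTrunks_sq_le {J n d : ℕ} (hd : d ≠ 0) (hdJ : d < 2 ^ J) :
    ∑ a ∈ Finset.range (d + 1), (numTrunks J n (a, d - a) : ℝ) ^ 2 ≤
      9 / 8 * (2 ^ J) ^ 2 * (1 / ((d : ℝ) + 1)) := by
  set j := Nat.log 2 d with hj
  have h1 : 2 ^ j ≤ d := Nat.pow_log_le_self 2 hd
  have h2 : d < 2 ^ (j + 1) := Nat.lt_pow_succ_log_self (by norm_num) d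
  have hjJ : j < J := by
    by_contra hcon
    have := Nat.pow_le_pow_right (n := 2) (by norm_num) (not_lt.1 hcon)
    omega
  set w := 2 ^ (J - j - 1) with hw
  have hw0 : 0 < w := by positivity
  have hKw : 2 ^ J = 2 * 2 ^ j * w := by
    rw [hw, ← pow_succ', ← pow_add]; congr 1; omega
  -- The first `2 t + 2` vertices of the diagonal carry at most `w` trunks each, the remaining `s`
  -- at most `2 w`; moreover `d + 1 = 2 (t + 1) + s` and `2 ^ J = 2 (t + 1 + s) w`.
  obtain ⟨t, ht⟩ : ∃ t, d = 2 ^ j + t := ⟨d - 2 ^ j, by omega⟩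
  obtain ⟨s, hs⟩ : ∃ s, 2 ^ j = t + 1 + s := ⟨2 ^ j - t - 1, by rw [pow_succ] at h2; omega⟩
  have hpos : ∀ i, trunkPos J d i = if i / w < 2 * t + 2 then i / w else i / w / 2 + t + 1 := by
    intro i
    rw [trunkPos, if_neg hd, ← hj, ← hw]
    have : d - 2 ^ j = t := by omega
    rw [this]
  have hnum : ∀ a ∈ Finset.range (d + 1), numTrunks J n (a, d - a) =
      ((Finset.range (2 ^ J)).filter fun i => trunkPos J d i = a).card := by
    intro a ha
    rw [Finset.mem_range] at ha
    have e : a + (d - a) = d := by omega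
    exact congrArg _ (Finset.filter_congr fun i _ => by simp [OnTrunk, e, hdJ])
  have hfine : ∀ a ∈ Finset.range (2 * t + 2), (numTrunks J n (a, d - a) : ℝ) ^ 2 ≤ (w : ℝ) ^ 2 := by
    intro a ha
    rw [Finset.mem_range] at ha
    rw [hnum a (by rw [Finset.mem_range]; omega)]
    refine pow_le_pow_left₀ (Nat.cast_nonneg _) (Nat.cast_le.2 ?_) 2
    refine le_trans (Finset.card_le_card fun i hi => ?_) (card_div_eq_le (2 ^ J) w a hw0)
    rw [Finset.mem_filter, hpos] at hi
    rw [Finset.mem_filter]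
    refine ⟨hi.1, ?_⟩
    have := hi.2
    split_ifs at this <;> omega
  have hcoarse : ∀ a ∈ Finset.Ico (2 * t + 2) (d + 1), (numTrunks J n (a, d - a) : ℝ) ^ 2 ≤
      4 * (w : ℝ) ^ 2 := by
    intro a ha
    rw [Finset.mem_Ico] at ha
    rw [hnum a (by rw [Finset.mem_range]; omega)]
    have e : (4 : ℝ) * (w : ℝ) ^ 2 = ((w * 2 : ℕ) : ℝ) ^ 2 := by push_cast; ring
    rw [e]
    refine pow_le_pow_left₀ (Nat.cast_nonneg _) (Nat.cast_le.2 ?_) 2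
    refine le_trans (Finset.card_le_card fun i hi => ?_)
      (card_div_eq_le (2 ^ J) (w * 2) (a - t - 1) (by omega))
    rw [Finset.mem_filter, hpos] at hi
    rw [Finset.mem_filter, ← Nat.div_div_eq_div_mul]
    refine ⟨hi.1, ?_⟩
    have := hi.2
    split_ifs at this <;> omega
  rw [Finset.range_eq_Ico, ← Finset.sum_Ico_consecutive _ (Nat.zero_le (2 * t + 2)) (by omega),
    ← Finset.range_eq_Ico]
  refine (add_le_add (Finset.sum_le_sum hfine) (Finset.sum_le_sum hcoarse)).trans ?_
  have e1 : d + 1 - (2 * t + 2) = s := by omega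
  have e2 : ((2 : ℝ) ^ J) = 2 * ((t : ℝ) + 1 + s) * w := by exact_mod_cast hs ▸ hKw
  have e3 : (d : ℝ) + 1 = 2 * (t + 1) + s := by
    have : d + 1 = 2 * (t + 1) + s := by omega
    exact_mod_cast this
  simp only [Finset.sum_const, Finset.card_range, Nat.card_Ico, e1, nsmul_eq_mul]
  rw [e2, e3, mul_one_div, le_div_iff₀ (by positivity)]
  push_cast
  -- Half of this expression is the difference of the two sides.
  have : 0 ≤ (w : ℝ) ^ 2 * ((t : ℝ) + 1 - s) ^ 2 := by positivity
  nlinarith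

/-- The three summands are a bundle of at most `n / K + 1` rows, the single column `K - 1 - i`, and
one vertex on each diagonal below `K`. -/
lemma card_onTrunk_le {J n m i : ℕ} (hn : 0 < n) :
    ((Finset.range n ×ˢ Finset.range m).filter fun x => OnTrunk J n x i).card ≤
      (n / 2 ^ J + 1) * m + n + 2 ^ J := by
  set K := 2 ^ J with hK
  have hK0 : 0 < K := by positivity
  set S := Finset.range n ×ˢ Finset.range m with hS
  have h1 : (S.filter fun x => x.1 + x.2 < K ∧ trunkPos J (x.1 + x.2) i = x.1).card ≤ K := by
    rw [← Finset.card_range K]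
    refine Finset.card_le_card_of_injOn (fun x => x.1 + x.2) (fun x hx => ?_) fun x hx y hy hxy => ?_
    · have hx := (Finset.mem_filter.1 hx).2.1
      simpa using hx
    · have hx := (Finset.mem_filter.1 hx).2.2
      have hy := (Finset.mem_filter.1 hy).2.2
      dsimp only at hxy
      rw [hxy] at hx
      have : x.1 = y.1 := hx.symm.trans hy
      exact Prod.ext this (by omega)
  have h2 : (S.filter fun x => x.1 * K / n = i).card ≤ (n / K + 1) * m := by
    -- The first row of the bundle, `i n / K` rounded up.
    set a0 := (i * n + K - 1) / K with ha0
    have ha1 : i * n ≤ a0 * K := by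
      have := Nat.lt_div_mul_add (a := i * n + K - 1) hK0
      rw [← ha0] at this
      omega
    calc _ ≤ (Finset.Icc a0 (a0 + n / K) ×ˢ Finset.range m).card := by
          refine Finset.card_le_card fun x hx => ?_
          simp only [hS, Finset.mem_filter, Finset.mem_product, Finset.mem_range,
            Finset.mem_Icc] at hx ⊢
          obtain ⟨⟨-, hm⟩, hx⟩ := hx
          have h3 := Nat.div_mul_le_self (x.1 * K) n
          have h4 := Nat.lt_div_mul_add (a := x.1 * K) hn
          rw [hx] at h3 h4
          refine ⟨⟨?_, ?_⟩, hm⟩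
          · rw [ha0, Nat.div_le_iff_le_mul_add_pred hK0]
            rw [mul_comm K]
            omega
          · rw [← Nat.sub_le_iff_le_add', Nat.le_div_iff_mul_le hK0, Nat.sub_mul]
            omega
      _ = (n / K + 1) * m := by
          rw [Finset.card_product, Nat.card_Icc, Finset.card_range, Nat.add_assoc,
            Nat.add_sub_cancel_left]
  have h3 : (S.filter fun x => x.2 = K - 1 - i).card ≤ n := by
    calc _ ≤ (Finset.range n ×ˢ {K - 1 - i}).card := by
          refine Finset.card_le_card fun x hx => ?_
          simp only [hS, Finset.mem_filter, Finset.mem_product, Finset.mem_range,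
            Finset.mem_singleton] at hx ⊢
          exact ⟨hx.1.1, hx.2⟩
      _ = n := by simp
  have h4 : (S.filter fun x => OnTrunk J n x i) ⊆
      ((S.filter fun x => x.1 * K / n = i) ∪ (S.filter fun x => x.2 = K - 1 - i)) ∪
      (S.filter fun x => x.1 + x.2 < K ∧ trunkPos J (x.1 + x.2) i = x.1) := by
    intro x hx
    rw [Finset.mem_filter] at hx
    obtain ⟨hxS, hx⟩ := hx
    simp only [Finset.mem_union, Finset.mem_filter, hxS, true_and]
    unfold OnTrunk at hx
    rw [← hK] at hx
    split_ifs at hx with h5 h6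
    · exact Or.inr ⟨h5, hx⟩
    · exact Or.inl (Or.inl hx.symm)
    · refine Or.inl (Or.inr ?_)
      rw [IsHorizontal, if_neg h5] at h6
      have : x.2 < K := by
        by_contra hcon
        have := Nat.mul_le_mul_right n (not_lt.1 hcon)
        omega
      omega
  refine (Finset.card_le_card h4).trans ((Finset.card_union_le _ _).trans ?_)
  exact add_le_add ((Finset.card_union_le _ _).trans (add_le_add h2 h3)) h1

/-! ### The upper bound -/

namespace IsGridCoord

variable {V : Type*} {G : SimpleGraph V} {r : V} {n m : ℕ} {a b : V → ℕ}

lemma exists_parent (h : IsGridCoord G r n m a b) (K : ℕ) :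
    ∃ π : V → V, ∀ v, (a (π v), b (π v)) = parentCoord K n (a v, b v) := by
  have : ∀ v, ∃ u, (a u, b u) = parentCoord K n (a v, b v) := by
    intro v
    have h1 : (parentCoord K n (a v, b v)).1 < n := by
      have := h.a_lt v
      unfold parentCoord
      split_ifs
      exacts [this, (Nat.sub_le _ _).trans_lt this]
    have h2 : (parentCoord K n (a v, b v)).2 < m := by
      have := h.b_lt v
      unfold parentCoord
      split_ifs
      exacts [(Nat.sub_le _ _).trans_lt this, this]
    obtain ⟨u, hu⟩ := h.surj _ h1 _ h2
    exact ⟨u, Prod.ext hu.1 hu.2⟩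
  choose π hπ using this
  exact ⟨π, hπ⟩

variable {π : V → V} {K : ℕ}

lemma parent_of_isHorizontal (hπ : ∀ v, (a (π v), b (π v)) = parentCoord K n (a v, b v)) {v : V}
    (hv : IsHorizontal K n (a v) (b v)) : a (π v) = a v ∧ b (π v) = b v - 1 := by
  have := hπ v
  simpa [parentCoord, hv] using this

lemma parent_of_not_isHorizontal (hπ : ∀ v, (a (π v), b (π v)) = parentCoord K n (a v, b v)) {v : V}
    (hv : ¬ IsHorizontal K n (a v) (b v)) : a (π v) = a v - 1 ∧ b (π v) = b v := by
  have := hπ v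
  simpa [parentCoord, hv] using this

lemma parent_root (h : IsGridCoord G r n m a b)
    (hπ : ∀ v, (a (π v), b (π v)) = parentCoord K n (a v, b v)) : π r = r := by
  rw [h.eq_root_iff]
  by_cases hr : IsHorizontal K n (a r) (b r)
  · obtain ⟨h1, h2⟩ := parent_of_isHorizontal hπ hr
    rw [h1, h2, h.a_root, h.b_root]
  · obtain ⟨h1, h2⟩ := parent_of_not_isHorizontal hπ hr
    rw [h1, h2, h.a_root, h.b_root]

lemma rank_parent (h : IsGridCoord G r n m a b) (hK : 0 < K)
    (hπ : ∀ v, (a (π v), b (π v)) = parentCoord K n (a v, b v)) {v : V} (hv : v ≠ r) :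
    a (π v) + b (π v) + 1 = a v + b v := by
  have h0 := (h.eq_root_iff v).not.1 hv
  by_cases hh : IsHorizontal K n (a v) (b v)
  · obtain ⟨h1, h2⟩ := parent_of_isHorizontal hπ hh
    have := hh.pos hK (h.a_lt v) h0
    omega
  · obtain ⟨h1, h2⟩ := parent_of_not_isHorizontal hπ hh
    have := pos_of_not_isHorizontal hh h0
    omega

lemma parentGraph_le (h : IsGridCoord G r n m a b) (hK : 0 < K)
    (hπ : ∀ v, (a (π v), b (π v)) = parentCoord K n (a v, b v)) : parentGraph π ≤ G := by
  have key : ∀ v, v ≠ π v → G.Adj (π v) v := by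
    intro v hne
    have hv : v ≠ r := by
      rintro rfl
      exact hne (h.parent_root hπ).symm
    have h0 := h.rank_parent hK hπ hv
    rw [h.adj_iff]
    by_cases hh : IsHorizontal K n (a v) (b v)
    · obtain ⟨h1, h2⟩ := parent_of_isHorizontal hπ hh
      omega
    · obtain ⟨h1, h2⟩ := parent_of_not_isHorizontal hπ hh
      omega
  intro u v huv
  obtain ⟨hne, huv | huv⟩ := huv
  · have := key u (by rw [huv]; exact hne)
    rw [huv] at this
    exact this.symm
  · have := key v (by rw [huv]; exact hne.symm)
    rwa [huv] at this

variable [Fintype V]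

/-- Each descendant of `v` lies on some trunk, and this trunk is inherited by all its ancestors,
hence by `v`. So the trunks at `v` cover all its descendants. -/
lemma numDesc_le (h : IsGridCoord G r n m a b) {J : ℕ} (hJ : 2 ^ J ≤ n)
    (hπ : ∀ v, (a (π v), b (π v)) = parentCoord (2 ^ J) n (a v, b v)) (v : V) :
    numDesc π v ≤ numTrunks J n (a v, b v) * ((n / 2 ^ J + 1) * m + n + 2 ^ J) := by
  classical
  have hstep : ∀ k i x, i < 2 ^ J → OnTrunk J n (a x, b x) i →
      OnTrunk J n (a (π^[k] x), b (π^[k] x)) i := by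
    intro k i x hi hx
    induction k with
    | zero => exact hx
    | succ k ih =>
      rw [Function.iterate_succ_apply']
      set y := π^[k] x
      by_cases hy : y = r
      · rw [hy, h.parent_root hπ, ← hy]
        exact ih
      · rw [hπ y]
        exact OnTrunk.parentCoord hJ hi (h.a_lt y) ((h.eq_root_iff y).not.1 hy) ih
  unfold numDesc
  calc _ ≤ (((Finset.range (2 ^ J)).filter (OnTrunk J n (a v, b v))).biUnion fun i =>
        Finset.univ.filter fun x => OnTrunk J n (a x, b x) i).card := by
        refine Finset.card_le_card fun x hx => ?_
        simp only [Finset.mem_filter, Finset.mem_univ, true_and] at hx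
        obtain ⟨k, hk⟩ := hx
        obtain ⟨i, hi, hxi⟩ := exists_onTrunk (J := J) (x := (a x, b x)) (h.a_lt x)
        have := hstep k i x hi hxi
        rw [hk] at this
        rw [Finset.mem_biUnion]
        exact ⟨i, Finset.mem_filter.2 ⟨Finset.mem_range.2 hi, this⟩,
          Finset.mem_filter.2 ⟨Finset.mem_univ _, hxi⟩⟩
    _ ≤ _ := Finset.card_biUnion_le_card_mul _ _ _ fun i _ => ?_
  refine le_trans ?_ (card_onTrunk_le (J := J) (m := m) (i := i) h.n_pos)
  refine Finset.card_le_card_of_injOn (fun x => (a x, b x)) (fun x hx => ?_) fun x _ y _ hxy => ?_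
  · have hx : OnTrunk J n (a x, b x) i := by simpa using hx
    simp [h.a_lt, h.b_lt, hx]
  · rw [Prod.mk.injEq] at hxy
    exact h.inj x y hxy.1 hxy.2

/-- Beyond diagonal `K` the horizontal region is closed under increasing either coordinate, so a
line of ancestors that ends at `v` never leaves the row of `v`. -/
lemma numDesc_le_of_isHorizontal (h : IsGridCoord G r n m a b)
    (hπ : ∀ v, (a (π v), b (π v)) = parentCoord K n (a v, b v)) {v : V} (hK : K ≤ a v + b v)
    (hv : IsHorizontal K n (a v) (b v)) : numDesc π v ≤ m - b v := by
  classical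
  have hmono : ∀ a b a' b', K ≤ a + b → IsHorizontal K n a b → a ≤ a' → b ≤ b' →
      IsHorizontal K n a' b' := by
    intro a b a' b' h0 h1 ha hb
    rw [IsHorizontal, if_neg (by omega)] at h1 ⊢
    exact h1.trans (add_le_add (Nat.mul_le_mul_right _ ha) (Nat.mul_le_mul_right _ hb))
  have hstep : ∀ k x, π^[k] x = v → a x = a v ∧ b v ≤ b x := by
    intro k
    induction k with
    | zero => rintro x rfl; exact ⟨rfl, le_rfl⟩
    | succ k ih =>
      intro x hx
      rw [Function.iterate_succ_apply] at hx
      obtain ⟨h1, h2⟩ := ih _ hx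
      by_cases hh : IsHorizontal K n (a x) (b x)
      · obtain ⟨h3, h4⟩ := parent_of_isHorizontal hπ hh
        omega
      · obtain ⟨h3, h4⟩ := parent_of_not_isHorizontal hπ hh
        exact absurd (hmono _ _ _ _ hK hv (by omega) (by omega)) hh
  rw [← Nat.card_Ico]
  refine Finset.card_le_card_of_injOn b (fun x hx => ?_) fun x hx y hy hxy => ?_
  · obtain ⟨k, hk⟩ : ∃ k, π^[k] x = v := by simpa using hx
    simpa [h.b_lt] using (hstep k x hk).2
  · obtain ⟨k, hk⟩ : ∃ k, π^[k] x = v := by simpa using hx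
    obtain ⟨l, hl⟩ : ∃ k, π^[k] y = v := by simpa using hy
    exact h.inj x y ((hstep k x hk).1.trans (hstep l y hl).1.symm) hxy

/-- The three summands bound the diagonals below `K`, the vertical runs and the rows. Vertices on
vertical runs have `b < K`, so there are at most `n K` of them, each serving at most one trunk. -/
lemma upper_bound (h : IsGridCoord G r n m a b) {J : ℕ} (hJ : 2 ^ J ≤ n)
    (hπ : ∀ v, (a (π v), b (π v)) = parentCoord (2 ^ J) n (a v, b v)) :
    ∑ v ∈ Finset.univ.filter (fun v => 1 ≤ a v + b v), (numDesc π v : ℝ) ^ 2 ≤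
      9 / 8 * (2 ^ J * (((n / 2 ^ J + 1) * m + n + 2 ^ J : ℕ) : ℝ)) ^ 2 *
          (∑ i ∈ Finset.range n, 1 / ((i : ℝ) + 1)) +
        n * 2 ^ J * (((n / 2 ^ J + 1) * m + n + 2 ^ J : ℕ) : ℝ) ^ 2 +
        (n * (m : ℝ) ^ 3 / 3 + n * (m : ℝ) ^ 2) := by
  classical
  set M := (n / 2 ^ J + 1) * m + n + 2 ^ J with hM
  set g : V → ℝ := fun v => (numDesc π v : ℝ) ^ 2 with hg
  have hg0 : ∀ v, 0 ≤ g v := fun v => by positivity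
  have hK0 : 0 < 2 ^ J := by positivity
  have hsub : Finset.univ.filter (fun v => 1 ≤ a v + b v) ⊆
      (((Finset.Ico 1 (2 ^ J)).biUnion fun d => Finset.univ.filter fun v => a v + b v = d) ∪
        (Finset.univ.filter fun v => 2 ^ J ≤ a v + b v ∧ ¬ IsHorizontal (2 ^ J) n (a v) (b v))) ∪
        (Finset.univ.filter fun v => 2 ^ J ≤ a v + b v ∧ IsHorizontal (2 ^ J) n (a v) (b v)) := by
    intro v hv
    simp only [Finset.mem_union, Finset.mem_biUnion, Finset.mem_Ico, Finset.mem_filter,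
      Finset.mem_univ, true_and] at hv ⊢
    by_cases h1 : 2 ^ J ≤ a v + b v
    · tauto
    · exact Or.inl (Or.inl ⟨_, ⟨hv, not_le.1 h1⟩, rfl⟩)
  have hunion : ∀ s t : Finset V, ∑ v ∈ s ∪ t, g v ≤ ∑ v ∈ s, g v + ∑ v ∈ t, g v := by
    intro s t
    rw [← Finset.sum_union_inter]
    exact le_add_of_nonneg_right (Finset.sum_nonneg fun v _ => hg0 v)
  refine (Finset.sum_le_sum_of_subset_of_nonneg hsub fun v _ _ => hg0 v).trans ?_
  refine (hunion _ _).trans (add_le_add ((hunion _ _).trans (add_le_add ?_ ?_)) ?_)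
  · rw [Finset.sum_biUnion]
    swap
    · intro d _ d' _ hdd
      exact Finset.disjoint_filter.2 fun v _ h1 h2 => hdd (h1.symm.trans h2)
    have hlayer : ∀ d ∈ Finset.Ico 1 (2 ^ J), ∑ v ∈ Finset.univ.filter (fun v => a v + b v = d), g v
        ≤ 9 / 8 * (2 ^ J * (M : ℝ)) ^ 2 * (1 / ((d : ℝ) + 1)) := by
      intro d hd
      rw [Finset.mem_Ico] at hd
      have h1 := mul_le_mul_of_nonneg_right
        (sum_numTrunks_sq_le (J := J) (n := n) (by omega : d ≠ 0) hd.2) (sq_nonneg (M : ℝ))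
      calc _ ≤ ∑ v ∈ Finset.univ.filter (fun v => a v + b v = d),
            (numTrunks J n (a v, d - a v) : ℝ) ^ 2 * (M : ℝ) ^ 2 := by
            refine Finset.sum_le_sum fun v hv => ?_
            have hv : a v + b v = d := by simpa using hv
            have hb : d - a v = b v := by omega
            rw [hb, ← mul_pow, hg]
            refine pow_le_pow_left₀ (Nat.cast_nonneg _) ?_ 2
            exact_mod_cast h.numDesc_le hJ hπ v
        _ = ∑ i ∈ (Finset.univ.filter fun v => a v + b v = d).image a,
            (numTrunks J n (i, d - i) : ℝ) ^ 2 * (M : ℝ) ^ 2 := by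
            rw [Finset.sum_image]
            intro u hu v hv huv
            have hu : a u + b u = d := by simpa using hu
            have hv : a v + b v = d := by simpa using hv
            exact h.inj u v huv (by omega)
        _ ≤ ∑ i ∈ Finset.range (d + 1), (numTrunks J n (i, d - i) : ℝ) ^ 2 * (M : ℝ) ^ 2 := by
            refine Finset.sum_le_sum_of_subset_of_nonneg (fun i hi => ?_) fun _ _ _ => by positivity
            rw [Finset.mem_image] at hi
            obtain ⟨v, hv, rfl⟩ := hi
            have hv : a v + b v = d := by simpa using hv
            rw [Finset.mem_range]
            omega
        _ = (∑ i ∈ Finset.range (d + 1), (numTrunks J n (i, d - i) : ℝ) ^ 2) * (M : ℝ) ^ 2 := by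
            rw [Finset.sum_mul]
        _ ≤ _ := h1
        _ = _ := by ring
    refine (Finset.sum_le_sum hlayer).trans ?_
    rw [← Finset.mul_sum]
    refine mul_le_mul_of_nonneg_left ?_ (by positivity)
    refine Finset.sum_le_sum_of_subset_of_nonneg (fun d hd => ?_) fun _ _ _ => by positivity
    rw [Finset.mem_Ico] at hd
    rw [Finset.mem_range]
    omega
  · have h1 : (Finset.univ.filter fun v => 2 ^ J ≤ a v + b v ∧
        ¬ IsHorizontal (2 ^ J) n (a v) (b v)).card ≤ n * 2 ^ J := by
      rw [← Finset.card_range n, ← Finset.card_range (2 ^ J), ← Finset.card_product]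
      simp only [Finset.card_range]
      refine Finset.card_le_card_of_injOn (fun x => (a x, b x)) (fun x hx => ?_)
        fun x _ y _ hxy => ?_
      · have hx := (Finset.mem_filter.1 (Finset.mem_coe.1 hx)).2
        rw [IsHorizontal, if_neg hx.1.not_gt] at hx
        refine Finset.mem_coe.2 (Finset.mem_product.2 ⟨Finset.mem_range.2 (h.a_lt x),
          Finset.mem_range.2 ?_⟩)
        by_contra hcon
        have := Nat.mul_le_mul_right n (not_lt.1 hcon)
        exact hx.2 (this.trans (Nat.le_add_left _ _))
      · rw [Prod.mk.injEq] at hxy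
        exact h.inj x y hxy.1 hxy.2
    calc _ ≤ ∑ v ∈ Finset.univ.filter (fun v => 2 ^ J ≤ a v + b v ∧
            ¬ IsHorizontal (2 ^ J) n (a v) (b v)), (M : ℝ) ^ 2 := by
          refine Finset.sum_le_sum fun v hv => ?_
          rw [Finset.mem_filter] at hv
          refine pow_le_pow_left₀ (Nat.cast_nonneg _) (Nat.cast_le.2 ?_) 2
          refine (h.numDesc_le hJ hπ v).trans ?_
          have := Nat.mul_le_mul_right M (numTrunks_le_one (n := n) (x := (a v, b v)) hv.2.1)
          rwa [one_mul] at this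
      _ ≤ _ := by
          rw [Finset.sum_const, nsmul_eq_mul]
          refine mul_le_mul_of_nonneg_right ?_ (sq_nonneg _)
          exact_mod_cast h1
  · calc _ ≤ ∑ v ∈ Finset.univ.filter (fun v => 2 ^ J ≤ a v + b v ∧
            IsHorizontal (2 ^ J) n (a v) (b v)), (((m : ℝ) - b v) ^ 2) := by
          refine Finset.sum_le_sum fun v hv => ?_
          rw [Finset.mem_filter] at hv
          refine pow_le_pow_left₀ (Nat.cast_nonneg _) ?_ 2
          rw [← Nat.cast_sub (h.b_lt v).le]
          exact_mod_cast h.numDesc_le_of_isHorizontal hπ hv.2.1 hv.2.2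
      _ ≤ ∑ v, ((m : ℝ) - b v) ^ 2 :=
          Finset.sum_le_sum_of_subset_of_nonneg (Finset.filter_subset _ _)
            fun _ _ _ => by positivity
      _ = ∑ i ∈ Finset.range n, ∑ j ∈ Finset.range m, ((m : ℝ) - j) ^ 2 :=
          h.sum_eq fun _ j => ((m : ℝ) - j) ^ 2
      _ ≤ _ := ?_
    have e : ∀ k : ℕ, k ≤ m → ∑ j ∈ Finset.range k, ((m : ℝ) - j) ^ 2 ≤
        ((m : ℝ) ^ 3 - ((m : ℝ) - k) ^ 3) / 3 + k * m := by
      intro k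
      induction k with
      | zero => simp
      | succ k ih =>
        intro hk
        have h1 := ih (by omega)
        have h2 : (k : ℝ) + 1 ≤ m := by exact_mod_cast hk
        have h3 : (0 : ℝ) ≤ k := Nat.cast_nonneg k
        rw [Finset.sum_range_succ]
        push_cast
        nlinarith
    have e1 := mul_le_mul_of_nonneg_left (e m le_rfl) (Nat.cast_nonneg (α := ℝ) n)
    rw [Finset.sum_const, Finset.card_range, nsmul_eq_mul]
    refine e1.trans (le_of_eq ?_)
    ring

end IsGridCoord

/-! ### Comparison of the bounds -/

/-- The logarithm of the number of trunks in a grid whose shorter side has `n` vertices. -/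
def trunkExp (n : ℕ) : ℕ := Nat.log 2 n - Nat.log 2 (Nat.log 2 (Nat.log 2 n))

/-- The `n`-th harmonic number. -/
noncomputable def harm (n : ℕ) : ℝ := ∑ i ∈ Finset.range n, 1 / ((i : ℝ) + 1)

lemma two_pow_trunkExp_mul_le {n : ℕ} (hn : 0 < n) :
    2 ^ trunkExp n * 2 ^ Nat.log 2 (Nat.log 2 (Nat.log 2 n)) ≤ n := by
  have h1 : ∀ x, Nat.log 2 x ≤ x := fun x => Nat.log_le_self 2 x
  have h2 : Nat.log 2 (Nat.log 2 (Nat.log 2 n)) ≤ Nat.log 2 n := (h1 _).trans (h1 _)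
  rw [← pow_add, trunkExp, Nat.sub_add_cancel h2]
  exact Nat.pow_log_le_self 2 hn.ne'

lemma lt_two_pow_trunkExp_mul (n : ℕ) :
    n < 2 ^ trunkExp n * 2 ^ (Nat.log 2 (Nat.log 2 (Nat.log 2 n)) + 1) := by
  have h1 : ∀ x, Nat.log 2 x ≤ x := fun x => Nat.log_le_self 2 x
  have h2 : Nat.log 2 (Nat.log 2 (Nat.log 2 n)) ≤ Nat.log 2 n := (h1 _).trans (h1 _)
  rw [← pow_add, trunkExp, ← add_assoc, Nat.sub_add_cancel h2]
  exact Nat.lt_pow_succ_log_self (by norm_num) n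

/-- Each dyadic block of the harmonic sum contributes at least `1/2`. -/
lemma log_le_harm (n : ℕ) : (Nat.log 2 n : ℝ) / 2 ≤ harm n := by
  have key : ∀ k : ℕ, (k : ℝ) / 2 ≤ harm (2 ^ k) := by
    intro k
    induction k with
    | zero => simp [harm]
    | succ k ih =>
      have e : (2 : ℕ) ^ (k + 1) = 2 ^ k + 2 ^ k := by ring
      rw [harm, e, Finset.sum_range_add]
      have h1 : (1 : ℝ) / 2 ≤ ∑ x ∈ Finset.range (2 ^ k), 1 / (((2 ^ k + x : ℕ) : ℝ) + 1) := by
        calc (1 : ℝ) / 2 = ∑ x ∈ Finset.range (2 ^ k), 1 / ((2 : ℝ) * 2 ^ k) := by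
              rw [Finset.sum_const, Finset.card_range, nsmul_eq_mul]
              push_cast
              field_simp
          _ ≤ _ := by
              refine Finset.sum_le_sum fun x hx => ?_
              rw [Finset.mem_range] at hx
              have : ((2 ^ k + x : ℕ) : ℝ) + 1 ≤ 2 * 2 ^ k := by
                have : 2 ^ k + x + 1 ≤ 2 * 2 ^ k := by omega
                exact_mod_cast this
              exact one_div_le_one_div_of_le (by positivity) this
      have : harm (2 ^ k) = ∑ x ∈ Finset.range (2 ^ k), 1 / ((x : ℝ) + 1) := rfl
      push_cast at ih ⊢
      push_cast at h1
      rw [this] at ih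
      linarith
  rcases Nat.eq_zero_or_pos n with rfl | hn
  · simp [harm]
  · refine (key _).trans ?_
    refine Finset.sum_le_sum_of_subset_of_nonneg ?_ fun _ _ _ => by positivity
    exact Finset.range_subset_range.2 (Nat.pow_log_le_self 2 hn.ne')

lemma tendsto_log_two : Tendsto (Nat.log 2) atTop atTop :=
  tendsto_atTop_atTop.2 fun k => ⟨2 ^ k, fun _ hn => Nat.le_log_of_pow_le (by norm_num) hn⟩

lemma tendsto_harm : Tendsto harm atTop atTop := by
  refine tendsto_atTop_mono log_le_harm ?_
  exact (tendsto_natCast_atTop_atTop.comp tendsto_log_two).atTop_div_const (by norm_num)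

/-- The proportion of the trunks. -/
noncomputable def trunkRatio (n : ℕ) : ℝ := 2 ^ trunkExp n / n

lemma tendsto_trunkRatio : Tendsto trunkRatio atTop (𝓝 0) := by
  have h1 : Tendsto (fun n => ((1 : ℝ) / 2) ^ Nat.log 2 (Nat.log 2 (Nat.log 2 n))) atTop (𝓝 0) :=
    (tendsto_pow_atTop_nhds_zero_of_lt_one (by norm_num) (by norm_num)).comp
      (tendsto_log_two.comp (tendsto_log_two.comp tendsto_log_two))
  refine squeeze_zero' (Eventually.of_forall fun n => by unfold trunkRatio; positivity) ?_ h1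
  filter_upwards [eventually_gt_atTop 0] with n hn
  have hn' : (0 : ℝ) < n := by exact_mod_cast hn
  have := two_pow_trunkExp_mul_le hn
  rw [trunkRatio, div_pow, one_pow, div_le_div_iff₀ hn' (by positivity), one_mul]
  exact_mod_cast this

/-- The reason for the iterated logarithm in `trunkExp`: `n / K` is at most `2 log log n`, whereas
`harm n` is at least `log n / 2`; yet `K / n` still tends to zero by `tendsto_trunkRatio`. -/
lemma tendsto_inv_trunkRatio_div_harm :
    Tendsto (fun n => (trunkRatio n)⁻¹ / harm n) atTop (𝓝 0) := by
  have h1 : Tendsto (fun l : ℕ => 4 * ((l : ℝ) ^ 1 / 2 ^ l)) atTop (𝓝 (4 * 0)) :=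
    (tendsto_pow_const_div_const_pow_of_one_lt 1 (by norm_num)).const_mul 4
  have h2 := h1.comp (tendsto_log_two.comp tendsto_log_two)
  rw [mul_zero] at h2
  refine squeeze_zero' (Eventually.of_forall fun n => ?_) ?_ h2
  · have : 0 ≤ harm n := Finset.sum_nonneg fun _ _ => by positivity
    unfold trunkRatio
    positivity
  · have e1 : ∀ᶠ n in atTop, 0 < Nat.log 2 (Nat.log 2 n) :=
      (tendsto_log_two.comp tendsto_log_two).eventually_gt_atTop 0
    filter_upwards [e1, eventually_gt_atTop 0] with n hn hn0
    have hn1 : Nat.log 2 n ≠ 0 := by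
      intro h
      simp [h] at hn
    have h3 := lt_two_pow_trunkExp_mul n
    have h4 := Nat.pow_log_le_self 2 hn.ne'
    have h5 := Nat.pow_log_le_self 2 hn1
    have h6 := log_le_harm n
    simp only [Function.comp_apply, pow_one]
    set l := Nat.log 2 (Nat.log 2 n) with hl
    have h7 : (2 : ℝ) ^ l ≤ 2 * harm n := by
      have : (2 : ℝ) ^ l ≤ (Nat.log 2 n : ℝ) := by exact_mod_cast h5
      linarith
    have h8 : (trunkRatio n)⁻¹ ≤ 2 * l := by
      rw [trunkRatio, inv_div, div_le_iff₀ (by positivity)]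
      have : n ≤ 2 * l * 2 ^ trunkExp n := by
        rw [pow_succ] at h3
        nlinarith [Nat.mul_le_mul_left (2 ^ trunkExp n) h4]
      exact_mod_cast this
    have h9 : (0 : ℝ) < 2 ^ l := by positivity
    have h10 : 0 < harm n := by linarith
    rw [div_le_iff₀ h10]
    have : 4 * ((l : ℝ) / 2 ^ l) * harm n = 2 * l * (2 * harm n / 2 ^ l) := by ring
    rw [this]
    refine h8.trans (le_mul_of_one_le_right (by positivity) ?_)
    rwa [one_le_div h9]

/-- The coefficient of `(n m)²` in the upper bound. -/
noncomputable def upperCoeff (n : ℕ) : ℝ :=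
  9 / 8 * (1 + 3 * trunkRatio n) ^ 2 * harm n + 16 * (trunkRatio n)⁻¹ + 1

/-- After division by `harm n` the difference of the two sides tends to `δ`. -/
lemma eventually_upperCoeff_le {δ : ℝ} (hδ : 0 < δ) :
    ∀ᶠ n in atTop, upperCoeff n ≤ (9 / 8 + δ) * (harm n - 5 / 2) := by
  have hinv : Tendsto (fun n => (harm n)⁻¹) atTop (𝓝 0) := tendsto_inv_atTop_zero.comp tendsto_harm
  have h1 : Tendsto (fun n => (9 / 8 + δ) * (1 - 5 / 2 * (harm n)⁻¹) -
      (9 / 8 * (1 + 3 * trunkRatio n) ^ 2 + 16 * ((trunkRatio n)⁻¹ / harm n) + (harm n)⁻¹))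
      atTop (𝓝 ((9 / 8 + δ) * (1 - 5 / 2 * 0) - (9 / 8 * (1 + 3 * 0) ^ 2 + 16 * 0 + 0))) := by
    refine Tendsto.sub ((tendsto_const_nhds.sub (hinv.const_mul _)).const_mul _)
      (((((tendsto_trunkRatio.const_mul _).const_add _).pow 2).const_mul _).add
        (tendsto_inv_trunkRatio_div_harm.const_mul _) |>.add hinv)
  have h2 : (0 : ℝ) < (9 / 8 + δ) * (1 - 5 / 2 * 0) - (9 / 8 * (1 + 3 * 0) ^ 2 + 16 * 0 + 0) := by
    linarith
  filter_upwards [h1.eventually_const_lt h2, tendsto_harm.eventually_gt_atTop 0] with n hn hh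
  have := mul_pos hn hh
  have e : ((9 / 8 + δ) * (1 - 5 / 2 * (harm n)⁻¹) -
      (9 / 8 * (1 + 3 * trunkRatio n) ^ 2 + 16 * ((trunkRatio n)⁻¹ / harm n) + (harm n)⁻¹)) * harm n
      = (9 / 8 + δ) * (harm n - 5 / 2) - upperCoeff n := by
    unfold upperCoeff
    field_simp
  linarith

/-- The trunk bound `M` satisfies `K M ≤ n m + 3 K m`, because `K ≤ n ≤ m` bounds each of the three
rounding terms by `K m`. The constant `16` bounds `(1 + 3 K / n)²`. -/
lemma upper_bound_le_upperCoeff {n m : ℕ} (hn : 0 < n) (hnm : n ≤ m) :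
    9 / 8 * (2 ^ trunkExp n * (((n / 2 ^ trunkExp n + 1) * m + n + 2 ^ trunkExp n : ℕ) : ℝ)) ^ 2 *
          harm n +
        n * 2 ^ trunkExp n *
          (((n / 2 ^ trunkExp n + 1) * m + n + 2 ^ trunkExp n : ℕ) : ℝ) ^ 2 +
        (n * (m : ℝ) ^ 3 / 3 + n * (m : ℝ) ^ 2) ≤
      ((n * m : ℕ) : ℝ) ^ 2 * upperCoeff n + n * (m : ℝ) ^ 3 / 3 := by
  have hKn : 2 ^ trunkExp n ≤ n :=
    (Nat.le_mul_of_pos_right _ (by positivity)).trans (two_pow_trunkExp_mul_le hn)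
  have hdiv := Nat.mul_div_le n (2 ^ trunkExp n)
  set M : ℕ := (n / 2 ^ trunkExp n + 1) * m + n + 2 ^ trunkExp n with hM
  set K := 2 ^ trunkExp n with hK
  have hK0 : 0 < K := by positivity
  have hratio : trunkRatio n = K / n := by simp [trunkRatio, hK]
  have hcast : (2 : ℝ) ^ trunkExp n = K := by simp [hK]
  have h1 : K * M ≤ n * m + 3 * K * m := by
    have h2 := Nat.mul_le_mul_right m hdiv
    have h3 := Nat.mul_le_mul_left K hnm
    have h4 := Nat.mul_le_mul_left K (hKn.trans hnm)
    rw [hM]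
    nlinarith
  have hn' : (0 : ℝ) < n := by exact_mod_cast hn
  have hm' : (1 : ℝ) ≤ m := by exact_mod_cast hn.trans_le hnm
  have hn1 : (1 : ℝ) ≤ n := by exact_mod_cast hn
  have hK' : (0 : ℝ) < K := by exact_mod_cast hK0
  have hKn' : (K : ℝ) ≤ n := by exact_mod_cast hKn
  have h2 : (K : ℝ) * M ≤ (n * m : ℕ) * (1 + 3 * trunkRatio n) := by
    have : (K : ℝ) * M ≤ n * m + 3 * K * m := by exact_mod_cast h1
    refine this.trans (le_of_eq ?_)
    rw [hratio]
    push_cast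
    field_simp
  have hr1 : trunkRatio n ≤ 1 := by rw [hratio, div_le_one hn']; exact hKn'
  have hr0 : 0 < trunkRatio n := by rw [hratio]; positivity
  have h3 : ((K : ℝ) * M) ^ 2 ≤ ((n * m : ℕ) : ℝ) ^ 2 * (1 + 3 * trunkRatio n) ^ 2 := by
    rw [← mul_pow]
    exact pow_le_pow_left₀ (by positivity) h2 2
  have h4 : (1 + 3 * trunkRatio n) ^ 2 ≤ 16 := by nlinarith
  have hh : 0 ≤ harm n := Finset.sum_nonneg fun _ _ => by positivity
  rw [hcast, upperCoeff]
  have e1 : 9 / 8 * ((K : ℝ) * M) ^ 2 * harm n ≤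
      9 / 8 * (((n * m : ℕ) : ℝ) ^ 2 * (1 + 3 * trunkRatio n) ^ 2) * harm n := by gcongr
  have e2 : (n : ℝ) * K * (M : ℝ) ^ 2 ≤ ((n * m : ℕ) : ℝ) ^ 2 * (16 * (trunkRatio n)⁻¹) := by
    have : (n : ℝ) * K * (M : ℝ) ^ 2 = ((K : ℝ) * M) ^ 2 * (trunkRatio n)⁻¹ := by
      rw [hratio]; field_simp
    rw [this]
    calc _ ≤ ((n * m : ℕ) : ℝ) ^ 2 * (1 + 3 * trunkRatio n) ^ 2 * (trunkRatio n)⁻¹ := by gcongr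
      _ ≤ ((n * m : ℕ) : ℝ) ^ 2 * 16 * (trunkRatio n)⁻¹ := by gcongr
      _ = _ := by ring
  have e3 : (n : ℝ) * (m : ℝ) ^ 2 ≤ ((n * m : ℕ) : ℝ) ^ 2 := by
    push_cast
    rw [mul_pow]
    gcongr
    nlinarith
  nlinarith

/-- For large `n` the coefficients of `(nm)²` compare. For the finitely many other `n` their excess
is at most a constant `U`; then `m` is large, and `(nm)² U` is absorbed by `nm³ / 24`, the surplus
eighth of `nm³ / 3`. -/
lemma exists_forall_upperCoeff_le {δ : ℝ} (hδ : 0 < δ) : ∃ N₀ : ℕ, ∀ n m : ℕ, 0 < n → n ≤ m →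
    N₀ ≤ n * m → ((n * m : ℕ) : ℝ) ^ 2 * upperCoeff n + n * (m : ℝ) ^ 3 / 3 ≤
      (9 / 8 + δ) * (((n * m : ℕ) : ℝ) ^ 2 * (harm n - 5 / 2) + n * (m : ℝ) ^ 3 / 3) := by
  obtain ⟨n₀, hn₀⟩ := eventually_atTop.1 (eventually_upperCoeff_le hδ)
  set U : ℝ := ∑ n ∈ Finset.range n₀, |upperCoeff n - (9 / 8 + δ) * (harm n - 5 / 2)| with hU
  have hU0 : 0 ≤ U := Finset.sum_nonneg fun _ _ => abs_nonneg _
  obtain ⟨k, hk⟩ := exists_nat_ge (24 * n₀ * U)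
  refine ⟨n₀ * (k + 1), fun n m hn hnm hN => ?_⟩
  have hn' : (0 : ℝ) < n := by exact_mod_cast hn
  have hm' : (0 : ℝ) < m := by exact_mod_cast hn.trans_le hnm
  have hB : (0 : ℝ) ≤ n * (m : ℝ) ^ 3 / 3 := by positivity
  rcases le_or_gt n₀ n with h | h
  · have h1 := mul_le_mul_of_nonneg_left (hn₀ n h) (sq_nonneg ((n * m : ℕ) : ℝ))
    nlinarith
  · have h1 : upperCoeff n - (9 / 8 + δ) * (harm n - 5 / 2) ≤ U :=
      (le_abs_self _).trans (Finset.single_le_sum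
        (f := fun n => |upperCoeff n - (9 / 8 + δ) * (harm n - 5 / 2)|)
        (fun _ _ => abs_nonneg _) (Finset.mem_range.2 h))
    have hm : k ≤ m := by
      by_contra hcon
      have h2 : n * m ≤ n₀ * m := Nat.mul_le_mul_right m h.le
      have h3 : n₀ * (m + 1) ≤ n₀ * k := Nat.mul_le_mul_left n₀ (by omega)
      nlinarith
    have h2 : 24 * n * U ≤ m := by
      have h3 : (k : ℝ) ≤ m := by exact_mod_cast hm
      have h4 : (n : ℝ) ≤ n₀ := by exact_mod_cast h.le
      have h5 : 24 * (n : ℝ) * U ≤ 24 * n₀ * U := by gcongr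
      linarith
    have h3 := mul_le_mul_of_nonneg_left h1 (sq_nonneg ((n * m : ℕ) : ℝ))
    have h4 : ((n * m : ℕ) : ℝ) ^ 2 * U ≤ n * (m : ℝ) ^ 3 / 24 := by
      have h5 := mul_le_mul_of_nonneg_left h2 (by positivity : (0 : ℝ) ≤ n * (m : ℝ) ^ 2 / 24)
      push_cast
      nlinarith
    nlinarith

/-! ### The approximation guarantee -/

/-- For each `N` take the smallest value `1 / (k + 1)` with `k ≤ N` that is admissible, if any. No
monotonicity of `P` in `δ` is needed. -/
lemma exists_tendsto_of_forall_eventually {P : ℕ → ℝ → Prop}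
    (h1 : ∀ δ : ℝ, 0 < δ → ∃ N₀, ∀ N ≥ N₀, P N δ) (h2 : ∀ N, ∃ δ, P N δ) :
    ∃ ε : ℕ → ℝ, Tendsto ε atTop (𝓝 0) ∧ ∀ N, P N (ε N) := by
  classical
  choose f hf using h2
  refine ⟨fun N => if ∃ k ≤ N, P N (1 / ((k : ℝ) + 1)) then
    1 / ((Nat.findGreatest (fun k => P N (1 / ((k : ℝ) + 1))) N : ℝ) + 1) else f N, ?_, ?_⟩
  · rw [Metric.tendsto_atTop]
    intro δ hδ
    obtain ⟨k, hk⟩ := exists_nat_one_div_lt hδ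
    obtain ⟨N₀, hN₀⟩ := h1 (1 / ((k : ℝ) + 1)) (by positivity)
    refine ⟨max N₀ k, fun N hN => ?_⟩
    have hP := hN₀ N ((le_max_left _ _).trans hN)
    have hkN : k ≤ N := (le_max_right _ _).trans hN
    have hg := Nat.le_findGreatest (P := fun k => P N (1 / ((k : ℝ) + 1))) hkN hP
    rw [if_pos ⟨k, hkN, hP⟩, Real.dist_eq, sub_zero, abs_of_nonneg (by positivity)]
    refine lt_of_le_of_lt (one_div_le_one_div_of_le (by positivity) ?_) hk
    have : (k : ℝ) ≤ (Nat.findGreatest (fun k => P N (1 / ((k : ℝ) + 1))) N : ℝ) := by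
      exact_mod_cast hg
    linarith
  · intro N
    dsimp only
    split_ifs with h
    · obtain ⟨k, hkN, hk⟩ := h
      exact Nat.findGreatest_spec (P := fun k => P N (1 / ((k : ℝ) + 1))) hkN hk
    · exact hf N

/-- The tree is within a factor of `9 / 8 + o(1)` of the optimum for uniform demands. -/
lemma EDNRInstance.exists_forall_sum_numDesc_sq_le :
    ∃ ε : ℕ → ℝ, Tendsto ε atTop (𝓝 0) ∧ ∀ (I : EDNRInstance) (n m : ℕ) (a b : Fin I.N → ℕ)
      (π : Fin I.N → Fin I.N) (T : SimpleGraph (Fin I.N)),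
      IsGridCoord I.graph I.root n m a b → n ≤ m →
      (∀ v, (a (π v), b (π v)) = parentCoord (2 ^ trunkExp n) n (a v, b v)) →
      I.IsSpanningTree T →
      ∑ v ∈ Finset.univ.erase I.root, (numDesc π v : ℝ) ^ 2 ≤
        (9 / 8 + ε I.N) * ∑ v ∈ Finset.univ.erase I.root, (I.numBelow T v : ℝ) ^ 2 := by
  have := exists_tendsto_of_forall_eventually (P := fun N δ => ∀ (I : EDNRInstance) (n m : ℕ)
      (a b : Fin I.N → ℕ) (π : Fin I.N → Fin I.N) (T : SimpleGraph (Fin I.N)), I.N = N →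
      IsGridCoord I.graph I.root n m a b → n ≤ m →
      (∀ v, (a (π v), b (π v)) = parentCoord (2 ^ trunkExp n) n (a v, b v)) →
      I.IsSpanningTree T →
      ∑ v ∈ Finset.univ.erase I.root, (numDesc π v : ℝ) ^ 2 ≤
        (9 / 8 + δ) * ∑ v ∈ Finset.univ.erase I.root, (I.numBelow T v : ℝ) ^ 2) ?_ ?_
  · obtain ⟨ε, h1, h2⟩ := this
    exact ⟨ε, h1, fun I n m a b π T => h2 I.N I n m a b π T rfl⟩
  · intro δ hδ
    obtain ⟨N₀, hN₀⟩ := exists_forall_upperCoeff_le hδ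
    refine ⟨N₀, fun N hN I n m a b π T hIN h hnm hπ hT => ?_⟩
    classical
    have hcard : I.N = n * m := by simpa using h.card_eq
    have hset : Finset.univ.erase I.root = Finset.univ.filter fun v => 1 ≤ a v + b v := by
      ext v
      simp only [Finset.mem_erase, Finset.mem_univ, and_true, Finset.mem_filter, true_and, ne_eq]
      rw [h.eq_root_iff]
      omega
    rw [hset]
    have hKn : 2 ^ trunkExp n ≤ n :=
      (Nat.le_mul_of_pos_right _ (by positivity)).trans (two_pow_trunkExp_mul_le h.n_pos)
    refine (h.upper_bound hKn hπ).trans ?_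
    refine (upper_bound_le_upperCoeff h.n_pos hnm).trans ?_
    refine (hN₀ n m h.n_pos hnm (by omega)).trans ?_
    refine mul_le_mul_of_nonneg_left (h.lower_bound hnm _ fun d => ?_) (by positivity)
    -- The unique path from the root to a vertex of rank at least `d` crosses diagonal `d`, so this
    -- vertex is below some vertex of the diagonal.
    calc _ ≤ ((Finset.univ.filter fun v => a v + b v = d).biUnion fun v =>
          Finset.univ.filter fun x => ∀ p : T.Walk I.root x, p.IsPath → v ∈ p.support).card := by
          refine Finset.card_le_card fun x hx => ?_
          have hx : d ≤ a x + b x := by simpa using hx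
          obtain ⟨p, hp, hpu⟩ := hT.2.existsUnique_path I.root x
          obtain ⟨v, hv, hvd⟩ := p.exists_mem_support_eq (D := fun v => a v + b v) (d := d)
            (fun u v huv => h.rank_le u v (hT.1 huv)) (by simp [h.a_root, h.b_root]) hx
          rw [Finset.mem_biUnion]
          refine ⟨v, by simpa using hvd, ?_⟩
          simp only [Finset.mem_filter, Finset.mem_univ, true_and]
          intro q hq
          rwa [hpu q hq]
      _ ≤ _ := Finset.card_biUnion_le
  · intro N
    -- A crude factor for small `N`: there are at most `N` descendants, and every vertex is below
    -- itself.
    refine ⟨(N : ℝ) ^ 2, fun I n m a b π T hIN h hnm hπ hT => ?_⟩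
    rw [Finset.mul_sum]
    refine Finset.sum_le_sum fun v _ => ?_
    have h1 : (numDesc π v : ℝ) ≤ N := by
      have : numDesc π v ≤ Fintype.card (Fin I.N) := Finset.card_le_univ _
      rw [Fintype.card_fin] at this
      exact_mod_cast this.trans hIN.le
    have h2 : (1 : ℝ) ≤ I.numBelow T v := by exact_mod_cast I.one_le_numBelow T v
    have h3 : (numDesc π v : ℝ) ^ 2 ≤ (N : ℝ) ^ 2 := pow_le_pow_left₀ (Nat.cast_nonneg _) h1 2
    have h4 : (1 : ℝ) ≤ (I.numBelow T v : ℝ) ^ 2 := one_le_pow₀ h2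
    nlinarith [sq_nonneg (N : ℝ)]

/-! ### Subprograms -/

namespace RAM

namespace ForProg

/-- Register `2` holds the number of vertices, array `0` the graph, and array `2` the row offsets of
its adjacency matrix. -/
structure Holds {N : ℕ} (G : SimpleGraph (Fin N)) (s : State) : Prop where
  reg_two : s.reg 2 = N
  adj : ∀ u v : Fin N, s.arr 0 (2 + s.arr 2 u + v) ≠ 0 ↔ G.Adj u v

lemma Holds.congr {N : ℕ} {G : SimpleGraph (Fin N)} {s s' : State} (h : Holds G s)
    (h2 : s'.reg 2 = s.reg 2) (h0 : s'.arr 0 = s.arr 0) (h2' : s'.arr 2 = s.arr 2) :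
    Holds G s' :=
  ⟨h2.trans h.reg_two, fun u v => by rw [h0, h2', h.adj]⟩

/-- The entry of the adjacency matrix for the vertices in registers `u` and `v`. -/
def adjExpr (u v : ℕ) : Expr := .get 0 (.add (.add (.const 2) (.get 2 (.reg u))) (.reg v))

lemma Holds.adjExpr_ne_zero {N : ℕ} {G : SimpleGraph (Fin N)} {s : State} (h : Holds G s)
    {i j : ℕ} {u v : Fin N} (hu : s.reg i = u) (hv : s.reg j = v) :
    (adjExpr i j).eval s ≠ 0 ↔ G.Adj u v := by
  rw [← h.adj u v]
  simp [adjExpr, Expr.eval, hu, hv]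

/-- The relaxation of the edge between the vertices in registers `11` and `12` for the distances in
array `D`. -/
def relaxEdge (D : ℕ) : ForProg :=
  cond (adjExpr 11 12)
    (cond (.sub (.get D (.reg 12)) (.add (.get D (.reg 11)) (.const 1)))
      (store D (.reg 12) (.add (.get D (.reg 11)) (.const 1))) skip) skip

/-- Bellman–Ford relaxation of the distances in array `D`. -/
def relax (D : ℕ) : ForProg := rep 10 (rep 11 (rep 12 (relaxEdge D)))

lemma relaxEdge_arr {N : ℕ} {G : SimpleGraph (Fin N)} {s : State} (h : Holds G s) (D : ℕ)
    {u v : Fin N} (hu : s.reg 11 = u) (hv : s.reg 12 = v) (w : Fin N) :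
    (((relaxEdge D).denote s).arr D w = s.arr D w ∧
      (w = v → G.Adj u v → s.arr D w ≤ s.arr D u + 1)) ∨
    (((relaxEdge D).denote s).arr D w = s.arr D u + 1 ∧ w = v ∧ G.Adj u v ∧
      s.arr D u + 1 < s.arr D w) := by
  have hadj := h.adjExpr_ne_zero hu hv
  simp only [relaxEdge, denote]
  split_ifs with h1 h2
  · have hlt : s.arr D u + 1 < s.arr D v := by
      simp only [Expr.eval, hu, hv] at h2
      omega
    by_cases hw : w = v
    · subst hw
      right
      simp [Expr.eval, hu, hv, hadj.1 h1, hlt]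
    · left
      simp [Expr.eval, hu, hv, hw, Fin.ext_iff.not.1 hw]
  · left
    refine ⟨rfl, fun hw _ => ?_⟩
    subst hw
    simp only [Expr.eval, hu, hv] at h2
    omega
  · left
    exact ⟨rfl, fun hw ha => absurd (hadj.2 ha) h1⟩

/-- The hypotheses say that `f` is the distance to its zero set, so several sources are allowed.
Entries never fall below `f`, and after `k` rounds those with `f ≤ k` are final; `N` rounds suffice
as `f ≤ N`. -/
lemma relax_arr {N : ℕ} {G : SimpleGraph (Fin N)} {s : State} (h : Holds G s) {D : ℕ}
    (hD0 : D ≠ 0) (hD2 : D ≠ 2) {f : Fin N → ℕ} (hf : ∀ v, f v ≤ N)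
    (hlip : ∀ u v, G.Adj u v → f v ≤ f u + 1)
    (hpred : ∀ v, f v ≠ 0 → ∃ u, G.Adj u v ∧ f u + 1 = f v)
    (hge : ∀ v, f v ≤ s.arr D v) (hzero : ∀ v, f v = 0 → s.arr D v = 0) (v : Fin N) :
    ((relax D).denote s).arr D v = f v := by
  have key := denote_rep_induction (c := 10) (p := rep 11 (rep 12 (relaxEdge D))) (by rfl) s
    (fun k s' => (∀ w, f w ≤ s'.arr D w) ∧ ∀ w, f w ≤ k → s'.arr D w ≤ f w) ?_ ?_
  · rw [h.reg_two] at key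
    exact le_antisymm (key.2 v (hf v)) (key.1 v)
  · refine ⟨by simpa using hge, fun w hw => ?_⟩
    simp [hzero w (by omega)]
  · intro k hk s₁ _ hreg₁ harr₁ hinv₁
    have h1 : Holds G s₁ := h.congr (hreg₁ 2 rfl) (harr₁ 0 (by simp [writesArr, relaxEdge, hD0]))
      (harr₁ 2 (by simp [writesArr, relaxEdge, hD2]))
    have key := denote_rep_induction (c := 11) (p := rep 12 (relaxEdge D)) (by rfl) s₁
      (fun i s' => (∀ w, f w ≤ s'.arr D w) ∧ (∀ w, f w ≤ k → s'.arr D w ≤ f w) ∧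
        ∀ u : Fin N, u < i → ∀ w, G.Adj u w → f u = k → s'.arr D w ≤ k + 1) ?_ ?_
    · rw [h1.reg_two] at key
      simp only [State.setReg_arr]
      refine ⟨key.1, fun w hw => ?_⟩
      rcases Nat.lt_or_ge k (f w) with hkw | hkw
      · obtain ⟨u, hu, huf⟩ := hpred w (by omega)
        have := key.2.2 u u.2 w hu (by omega)
        omega
      · exact key.2.1 w hkw
    · simpa using hinv₁
    · intro i hi s₂ hi₂ hreg₂ harr₂ hinv₂
      have h2 : Holds G s₂ := h1.congr (hreg₂ 2 rfl) (harr₂ 0 (by simp [writesArr, relaxEdge, hD0]))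
        (harr₂ 2 (by simp [writesArr, relaxEdge, hD2]))
      rw [h1.reg_two] at hi
      have key := denote_rep_induction (c := 12) (p := relaxEdge D) (by rfl) s₂
        (fun j s' => (∀ w, f w ≤ s'.arr D w) ∧ (∀ w, f w ≤ k → s'.arr D w ≤ f w) ∧
          (∀ u : Fin N, u < i → ∀ w, G.Adj u w → f u = k → s'.arr D w ≤ k + 1) ∧
          ∀ w : Fin N, w < j → G.Adj ⟨i, hi⟩ w → f ⟨i, hi⟩ = k → s'.arr D w ≤ k + 1) ?_ ?_
      · rw [h2.reg_two] at key
        simp only [State.setReg_arr]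
        refine ⟨key.1, key.2.1, fun u hu w huw huk => ?_⟩
        rcases Nat.lt_succ_iff_lt_or_eq.1 hu with hu | hu
        · exact key.2.2.1 u hu w huw huk
        · obtain rfl : u = ⟨i, hi⟩ := Fin.ext hu
          exact key.2.2.2 w w.2 huw huk
      · simpa using hinv₂
      · intro j hj s₃ hj₃ hreg₃ harr₃ hinv₃
        have h3 : Holds G s₃ := h2.congr (hreg₃ 2 rfl)
          (harr₃ 0 (by simp [writesArr, relaxEdge, hD0]))
          (harr₃ 2 (by simp [writesArr, relaxEdge, hD2]))
        rw [h2.reg_two] at hj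
        have hi₃ : s₃.reg 11 = (⟨i, hi⟩ : Fin N) := (hreg₃ 11 rfl).trans hi₂
        have hstep := relaxEdge_arr h3 D (v := ⟨j, hj⟩) hi₃ hj₃
        obtain ⟨I1, I2, I3, I4⟩ := hinv₃
        have hle : ∀ w : Fin N, ((relaxEdge D).denote s₃).arr D w ≤ s₃.arr D w := by
          intro w
          rcases hstep w with hw | hw <;> omega
        simp only [State.setReg_arr]
        refine ⟨fun w => ?_, fun w hw => (hle w).trans (I2 w hw),
          fun u hu w huw huk => (hle w).trans (I3 u hu w huw huk), fun w hw hadj hk => ?_⟩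
        · rcases hstep w with hw | ⟨hw, hwj, hadj, -⟩
          · rw [hw.1]
            exact I1 w
          · rw [hw]
            subst hwj
            exact (hlip _ _ hadj).trans (Nat.add_le_add_right (I1 _) 1)
        · rcases Nat.lt_succ_iff_lt_or_eq.1 hw with hw | hw
          · exact (hle w).trans (I4 w hw hadj hk)
          · obtain rfl : w = ⟨j, hj⟩ := Fin.ext hw
            have := I2 ⟨i, hi⟩ hk.le
            rcases hstep ⟨j, hj⟩ with hw | hw
            · have := hw.2 rfl hadj
              omega
            · omega

/-- The distances from the vertex in register `r`, in array `D`. -/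
def distFrom (D r : ℕ) : ForProg :=
  seq (rep 4 (store D (.reg 4) (.reg 2))) (seq (store D (.reg r) (.const 0)) (relax D))

lemma distFrom_arr {N : ℕ} {G : SimpleGraph (Fin N)} {s : State} (h : Holds G s) {D r : ℕ}
    (hD0 : D ≠ 0) (hD2 : D ≠ 2) (hr4 : r ≠ 4) {f : Fin N → ℕ} (hf : ∀ v, f v ≤ N)
    (hlip : ∀ u v, G.Adj u v → f v ≤ f u + 1)
    (hpred : ∀ v, f v ≠ 0 → ∃ u, G.Adj u v ∧ f u + 1 = f v) {x : Fin N} (hx : s.reg r = x)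
    (hfx : ∀ v, f v = 0 ↔ v = x) (v : Fin N) :
    ((distFrom D r).denote s).arr D v = f v := by
  have key := denote_rep_induction (c := 4) (p := store D (.reg 4) (.reg 2)) (by rfl) s
    (fun i s' => ∀ w : Fin N, w < i → s'.arr D w = N) (by simp) ?_
  · rw [h.reg_two] at key
    have e0 := denote_arr_of_not_writesArr (p := rep 4 (store D (.reg 4) (.reg 2))) (a := 0)
      (by simp [writesArr, hD0]) s
    have e2 := denote_arr_of_not_writesArr (p := rep 4 (store D (.reg 4) (.reg 2))) (a := 2)
      (by simp [writesArr, hD2]) s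
    have e3 := denote_reg_of_not_writesReg (p := rep 4 (store D (.reg 4) (.reg 2))) (r := 2)
      (by rfl) s
    have e4 := denote_reg_of_not_writesReg (p := rep 4 (store D (.reg 4) (.reg 2))) (r := r)
      (by simp [writesReg, hr4.symm]) s
    simp only [distFrom, denote_seq]
    set s₁ := (rep 4 (store D (.reg 4) (.reg 2))).denote s
    have e5 : (store D (.reg r) (.const 0)).denote s₁ = s₁.setArr D x 0 := by
      simp [denote, Expr.eval, e4, hx]
    rw [e5]
    refine relax_arr ((h.congr e3 e0 e2).congr (by simp) ?_ ?_) hD0 hD2 hf hlip hpred ?_ ?_ v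
    · funext j; simp [hD0.symm]
    · funext j; simp [hD2.symm]
    · intro w
      by_cases hw : w = x
      · simp [hw, (hfx x).2 rfl]
      · simp [Fin.ext_iff.not.1 hw, key w w.2, hf w]
    · intro w hw
      simp [(hfx w).1 hw]
  · intro i hi s' hi' hreg _ hinv w hw
    simp only [denote, Expr.eval, State.setReg_arr, State.setArr_arr, hi', true_and]
    split_ifs with hwi
    · rw [hreg 2 rfl, h.reg_two]
    · exact hinv w (by omega)

/-- Put a neighbor of the vertex in register `3` into register `5`, if there is one. -/
def findNeighbor : ForProg :=
  seq (assign 5 (.reg 3)) (rep 4 (cond (adjExpr 3 4) (assign 5 (.reg 4)) skip))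

/-- The second alternative is needed for the one-vertex grid. -/
lemma findNeighbor_reg {N : ℕ} {G : SimpleGraph (Fin N)} {s : State} (h : Holds G s) {r : Fin N}
    (hr : s.reg 3 = r) : ∃ x : Fin N, (findNeighbor.denote s).reg 5 = x ∧
      (G.Adj r x ∨ (x = r ∧ ∀ v, ¬ G.Adj r v)) := by
  simp only [findNeighbor, denote_seq]
  set s₀ := (assign 5 (.reg 3)).denote s with hs₀
  have h0 : Holds G s₀ := h.congr (by simp [hs₀, denote]) rfl rfl
  have hr0 : s₀.reg 3 = r := by simp [hs₀, denote, hr]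
  have key := denote_rep_induction (c := 4) (p := cond (adjExpr 3 4) (assign 5 (.reg 4)) skip)
    (by rfl) s₀ (fun i s' => ∃ x : Fin N, s'.reg 5 = x ∧
      (G.Adj r x ∨ (x = r ∧ ∀ v : Fin N, v < i → ¬ G.Adj r v))) ?_ ?_
  · rw [h0.reg_two] at key
    obtain ⟨x, hx, hx'⟩ := key
    exact ⟨x, hx, hx'.imp_right fun hx' => ⟨hx'.1, fun v => hx'.2 v v.2⟩⟩
  · exact ⟨r, by simp [hs₀, denote, Expr.eval, hr], Or.inr ⟨rfl, by simp⟩⟩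
  · intro i hi s' hi' hreg harr hinv
    rw [h0.reg_two] at hi
    have h1 : Holds G s' := h0.congr (hreg 2 rfl) (harr 0 rfl) (harr 2 rfl)
    have hadj := h1.adjExpr_ne_zero (u := r) (v := ⟨i, hi⟩) ((hreg 3 rfl).trans hr0) hi'
    simp only [denote]
    split_ifs with hc
    · exact ⟨⟨i, hi⟩, by simp [Expr.eval, hi'], Or.inl (hadj.1 hc)⟩
    · obtain ⟨x, hx, hx'⟩ := hinv
      refine ⟨x, by simp [hx], hx'.imp_right fun hx' => ⟨hx'.1, fun v hv => ?_⟩⟩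
      rcases Nat.lt_succ_iff_lt_or_eq.1 hv with hv | hv
      · exact hx'.2 v hv
      · obtain rfl : v = ⟨i, hi⟩ := Fin.ext hv
        exact fun ha => hc (hadj.2 ha)

end ForProg

end RAM

/-! ### Predecessors for the distance functions of a grid. -/

namespace IsGridCoord

variable {V : Type*} {G : SimpleGraph V} {r : V} {n m : ℕ} {a b : V → ℕ}

lemma exists_adj_rank (h : IsGridCoord G r n m a b) (v : V) (hv : a v + b v ≠ 0) :
    ∃ u, G.Adj u v ∧ a u + b u + 1 = a v + b v := by
  have ha := h.a_lt v
  have hb := h.b_lt v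
  rcases Nat.eq_zero_or_pos (b v) with h0 | h0
  · obtain ⟨u, hu, hu'⟩ := h.surj (a v - 1) (by omega) (b v) hb
    exact ⟨u, (h.adj_iff u v).2 (by omega), by omega⟩
  · obtain ⟨u, hu, hu'⟩ := h.surj (a v) ha (b v - 1) (by omega)
    exact ⟨u, (h.adj_iff u v).2 (by omega), by omega⟩

lemma exists_adj_row (h : IsGridCoord G r n m a b) (v : V) (hv : a v ≠ 0) :
    ∃ u, G.Adj u v ∧ a u + 1 = a v := by
  have ha := h.a_lt v
  obtain ⟨u, hu, hu'⟩ := h.surj (a v - 1) (by omega) (b v) (h.b_lt v)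
  exact ⟨u, (h.adj_iff u v).2 (by omega), by omega⟩

/-- The distance from the vertex `(1, 0)`. -/
lemma exists_adj_shifted_rank (h : IsGridCoord G r n m a b) (hn : 1 < n) (v : V)
    (hv : (if a v = 0 then b v + 1 else a v - 1 + b v) ≠ 0) :
    ∃ u, G.Adj u v ∧ (if a u = 0 then b u + 1 else a u - 1 + b u) + 1 =
      if a v = 0 then b v + 1 else a v - 1 + b v := by
  have ha := h.a_lt v
  have hb := h.b_lt v
  by_cases h1 : a v = 0
  · obtain ⟨u, hu, hu'⟩ := h.surj 1 hn (b v) hb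
    refine ⟨u, (h.adj_iff u v).2 (by omega), ?_⟩
    rw [if_pos h1, if_neg (by omega)]
    omega
  · rw [if_neg h1] at hv ⊢
    rcases Nat.eq_zero_or_pos (b v) with h0 | h0
    · obtain ⟨u, hu, hu'⟩ := h.surj (a v - 1) (by omega) (b v) hb
      refine ⟨u, (h.adj_iff u v).2 (by omega), ?_⟩
      rw [if_neg (by omega)]
      omega
    · obtain ⟨u, hu, hu'⟩ := h.surj (a v) ha (b v - 1) (by omega)
      refine ⟨u, (h.adj_iff u v).2 (by omega), ?_⟩
      rw [if_neg (by omega)]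
      omega

lemma rank_lt [Fintype V] (h : IsGridCoord G r n m a b) (v : V) : a v + b v + 1 ≤ Fintype.card V := by
  rw [h.card_eq]
  have ha := h.a_lt v
  have hb := h.b_lt v
  nlinarith [Nat.mul_le_mul (show 1 ≤ n by omega) (show 1 ≤ m by omega)]

end IsGridCoord

/-! ### Recovering the coordinates from the adjacency matrix. -/

namespace RAM

namespace ForProg

/-- The coordinates: ranks in array `3` and rows in array `5`, for one of the two orientations of
the grid. -/
def coordinates : ForProg :=
  seq (distFrom 3 3) (seq findNeighbor (seq (distFrom 4 5)
    (seq (rep 4 (cond (.sub (.get 3 (.reg 4)) (.get 4 (.reg 4)))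
      (store 5 (.reg 4) (.reg 2)) (store 5 (.reg 4) (.const 0)))) (relax 5))))

/-- The distance from the root is `a + b`. A neighbor `x` of the root may be taken as `(1, 0)`, and
a vertex is closer to `x` than to the root exactly if `a ≠ 0`. The distance from the set `a = 0` is
then `a`. -/
lemma coordinates_spec {N : ℕ} {G : SimpleGraph (Fin N)} {s : State} (h : Holds G s) {r : Fin N}
    (hr : s.reg 3 = r) (hgrid : ∃ n m a b, IsGridCoord G r n m a b) :
    ∃ n m a b, IsGridCoord G r n m a b ∧
      ∀ v : Fin N, (coordinates.denote s).arr 3 v = a v + b v ∧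
        (coordinates.denote s).arr 5 v = a v := by
  simp only [coordinates, denote_seq]
  obtain ⟨n, m, a, b, hc⟩ := hgrid
  have hN : ∀ v, a v + b v + 1 ≤ N := fun v => by simpa using hc.rank_lt v
  have hD0 := distFrom_arr h (D := 3) (r := 3) (by norm_num) (by norm_num) (by norm_num)
    (f := fun v => a v + b v) (fun v => by have := hN v; omega) (fun u v huv => hc.rank_le u v huv)
    (fun v hv => hc.exists_adj_rank v hv) hr (fun v => (hc.eq_root_iff v).symm)
  have g1 : Holds G ((distFrom 3 3).denote s) := h.congr (denote_reg_of_not_writesReg rfl s)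
    (denote_arr_of_not_writesArr rfl s) (denote_arr_of_not_writesArr rfl s)
  have hr1 := (denote_reg_of_not_writesReg (p := distFrom 3 3) (r := 3) rfl s).trans hr
  set s₁ := (distFrom 3 3).denote s
  obtain ⟨x, hx, hx'⟩ := findNeighbor_reg g1 hr1
  have g2 : Holds G (findNeighbor.denote s₁) := g1.congr (denote_reg_of_not_writesReg rfl s₁)
    (denote_arr_of_not_writesArr rfl s₁) (denote_arr_of_not_writesArr rfl s₁)
  have hD1 := denote_arr_of_not_writesArr (p := findNeighbor) (a := 3) rfl s₁
  set s₂ := findNeighbor.denote s₁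
  have hD2 := denote_arr_of_not_writesArr (p := distFrom 4 5) (a := 3) rfl s₂
  have g3 : Holds G ((distFrom 4 5).denote s₂) := g2.congr (denote_reg_of_not_writesReg rfl s₂)
    (denote_arr_of_not_writesArr rfl s₂) (denote_arr_of_not_writesArr rfl s₂)
  -- The axes are named anew so that the neighbor found becomes `(1, 0)`. Without a neighbor, `n ≤
  -- 1` forces `a = 0` everywhere and the two distances agree.
  obtain ⟨n, m, a, b, hc, hab, h4⟩ : ∃ n m a b, IsGridCoord G r n m a b ∧
      (∀ v : Fin N, s₁.arr 3 v = a v + b v) ∧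
      ∀ v : Fin N, ((distFrom 4 5).denote s₂).arr 4 v < a v + b v ↔ a v ≠ 0 := by
    rcases hx' with hadj | ⟨hxr, hadj⟩
    · have hx1 : ∃ n m a b, IsGridCoord G r n m a b ∧ (∀ v : Fin N, s₁.arr 3 v = a v + b v) ∧
          a x = 1 ∧ b x = 0 := by
        have := (hc.adj_iff r x).1 hadj
        rw [hc.a_root, hc.b_root] at this
        rcases this with h1 | h1
        · exact ⟨m, n, b, a, hc.swap, fun v => by rw [hD0, add_comm], by omega, by omega⟩
        · exact ⟨n, m, a, b, hc, hD0, by omega, by omega⟩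
      obtain ⟨n, m, a, b, hc, hab, hxa, hxb⟩ := hx1
      have hN : ∀ v, a v + b v + 1 ≤ N := fun v => by simpa using hc.rank_lt v
      refine ⟨n, m, a, b, hc, hab, fun v => ?_⟩
      rw [distFrom_arr g2 (by norm_num) (by norm_num) (by norm_num)
        (f := fun v => if a v = 0 then b v + 1 else a v - 1 + b v) (fun v => ?_)
        (fun u v huv => ?_)
        (hc.exists_adj_shifted_rank (by have := hc.a_lt x; omega)) hx (fun v => ?_)]
      · split_ifs <;> omega
      · have := hN v
        split_ifs <;> omega
      · have := (hc.adj_iff u v).1 huv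
        split_ifs <;> omega
      · constructor
        · intro hv
          refine hc.inj _ _ ?_ ?_ <;> split_ifs at hv <;> omega
        · rintro rfl
          rw [if_neg (by omega)]
          omega
    · have hn : n ≤ 1 := by
        by_contra hn
        obtain ⟨v, hv, hv'⟩ := hc.surj 1 (by omega) 0 hc.m_pos
        exact hadj v ((hc.adj_iff r v).2 (by rw [hc.a_root, hc.b_root]; omega))
      refine ⟨n, m, a, b, hc, hD0, fun v => ?_⟩
      rw [distFrom_arr g2 (by norm_num) (by norm_num) (by norm_num)
        (f := fun v => a v + b v) (fun v => by have := hN v; omega)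
        (fun u v huv => hc.rank_le u v huv) hc.exists_adj_rank hx
        (fun v => by rw [hxr]; exact (hc.eq_root_iff v).symm)]
      have := hc.a_lt v
      omega
  refine ⟨n, m, a, b, hc, ?_⟩
  have hN : ∀ v, a v + b v + 1 ≤ N := fun v => by simpa using hc.rank_lt v
  set s₃ := (distFrom 4 5).denote s₂
  set p := rep 4 (cond (.sub (.get 3 (.reg 4)) (.get 4 (.reg 4)))
      (store 5 (.reg 4) (.reg 2)) (store 5 (.reg 4) (.const 0))) with hp
  have g4 : Holds G (p.denote s₃) := g3.congr (denote_reg_of_not_writesReg rfl s₃)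
    (denote_arr_of_not_writesArr rfl s₃) (denote_arr_of_not_writesArr rfl s₃)
  have hD3 := denote_arr_of_not_writesArr (p := p) (a := 3) rfl s₃
  have hD4 := denote_arr_of_not_writesArr (p := relax 5) (a := 3) rfl (p.denote s₃)
  have key := denote_rep_induction (c := 4) (p := cond (.sub (.get 3 (.reg 4)) (.get 4 (.reg 4)))
      (store 5 (.reg 4) (.reg 2)) (store 5 (.reg 4) (.const 0))) rfl s₃
    (fun i s' => ∀ v : Fin N, v < i → s'.arr 5 v = if a v = 0 then 0 else N) (by simp) ?_
  · rw [g3.reg_two] at key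
    intro v
    refine ⟨by rw [hD4, hD3, hD2, hD1, hab], ?_⟩
    refine relax_arr g4 (f := a) (by norm_num) (by norm_num) (fun v => by have := hN v; omega)
      (fun u v huv => ?_) hc.exists_adj_row (fun v => ?_) (fun v hv => ?_) v
    · have := (hc.adj_iff u v).1 huv
      omega
    · rw [key v v.2]
      have := hN v
      split_ifs <;> omega
    · rw [key v v.2, if_pos hv]
  · intro i hi s' hi' hreg harr hinv v hv
    rcases Nat.lt_succ_iff_lt_or_eq.1 hv with hv | hv
    · have hne : (v : ℕ) ≠ i := hv.ne
      rw [← hinv v hv]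
      simp only [denote, State.setReg_arr]
      split_ifs with h1 <;> simp [Expr.eval, hi', hne]
    · have e3 : s'.arr 3 v = a v + b v := by rw [harr 3 rfl, hD2, hD1, hab]
      have e4 := h4 v
      rw [← harr 4 rfl, ← e3] at e4
      have e2 : s'.reg 2 = N := (hreg 2 rfl).trans g3.reg_two
      simp only [denote, State.setReg_arr]
      have e5 : (Expr.sub (.get 3 (.reg 4)) (.get 4 (.reg 4))).eval s' ≠ 0 ↔ a v ≠ 0 := by
        simp only [Expr.eval, hi', ← hv, ← e4]
        omega
      simp only [e5]
      by_cases h1 : a v = 0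
      · simp [Expr.eval, hi', hv, h1]
      · simp [Expr.eval, hi', hv, h1, e2]

lemma denote_cond_max (r : ℕ) (x : Expr) (s : State) :
    (cond (.sub x (.reg r)) (assign r x) skip).denote s =
      s.setReg r (max (s.reg r) (x.eval s)) := by
  by_cases h : s.reg r < x.eval s
  · rw [denote_cond_of_ne_zero (by simp only [Expr.eval]; omega), denote_assign, max_eq_right h.le]
  · rw [denote_cond_of_eq_zero (by simp only [Expr.eval]; omega), max_eq_left (not_lt.1 h),
      State.setReg_self]
    rfl

/-- Exchange rows and columns if there are more rows than columns, and put the number of rows into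
register `6`. -/
def orient : ForProg :=
  seq (assign 6 (.const 0)) (seq (assign 7 (.const 0)) (seq
    (rep 4 (seq
      (cond (.sub (.get 5 (.reg 4)) (.reg 6)) (assign 6 (.get 5 (.reg 4))) skip)
      (cond (.sub (.sub (.get 3 (.reg 4)) (.get 5 (.reg 4))) (.reg 7))
        (assign 7 (.sub (.get 3 (.reg 4)) (.get 5 (.reg 4)))) skip)))
    (seq (cond (.sub (.reg 6) (.reg 7))
      (seq (rep 4 (store 5 (.reg 4) (.sub (.get 3 (.reg 4)) (.get 5 (.reg 4)))))
        (assign 6 (.reg 7))) skip)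
      (assign 6 (.add (.reg 6) (.const 1))))))

lemma orient_spec {N : ℕ} {G : SimpleGraph (Fin N)} {s : State} (h : s.reg 2 = N) {r : Fin N}
    {n m : ℕ} {a b : Fin N → ℕ} (hc : IsGridCoord G r n m a b)
    (h3 : ∀ v : Fin N, s.arr 3 v = a v + b v) (h5 : ∀ v : Fin N, s.arr 5 v = a v) :
    ∃ n m a b, IsGridCoord G r n m a b ∧ n ≤ m ∧ (orient.denote s).reg 6 = n ∧
      (∀ v : Fin N, (orient.denote s).arr 3 v = a v + b v) ∧
      ∀ v : Fin N, (orient.denote s).arr 5 v = a v := by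
  have e3 := denote_arr_of_not_writesArr (p := orient) (a := 3) rfl s
  simp only [e3]
  simp only [orient, denote_seq]
  set s₁ := (assign 7 (.const 0)).denote ((assign 6 (.const 0)).denote s) with hs₁
  have h31 : ∀ v : Fin N, s₁.arr 3 v = a v + b v := h3
  have h51 : ∀ v : Fin N, s₁.arr 5 v = a v := h5
  have h21 : s₁.reg 2 = N := by simp [hs₁, denote, h]
  have key := denote_rep_induction (c := 4) (p := seq
      (cond (.sub (.get 5 (.reg 4)) (.reg 6)) (assign 6 (.get 5 (.reg 4))) skip)
      (cond (.sub (.sub (.get 3 (.reg 4)) (.get 5 (.reg 4))) (.reg 7))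
        (assign 7 (.sub (.get 3 (.reg 4)) (.get 5 (.reg 4)))) skip)) rfl s₁
    (fun i s' => s'.reg 6 < n ∧ s'.reg 7 < m ∧
      ∀ v : Fin N, v < i → a v ≤ s'.reg 6 ∧ b v ≤ s'.reg 7) ?_ ?_
  · rw [h21] at key
    set p := rep 4 (seq
      (cond (.sub (.get 5 (.reg 4)) (.reg 6)) (assign 6 (.get 5 (.reg 4))) skip)
      (cond (.sub (.sub (.get 3 (.reg 4)) (.get 5 (.reg 4))) (.reg 7))
        (assign 7 (.sub (.get 3 (.reg 4)) (.get 5 (.reg 4)))) skip)) with hp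
    have h22 : (p.denote s₁).reg 2 = N := (denote_reg_of_not_writesReg rfl s₁).trans h21
    have h32 : ∀ v : Fin N, (p.denote s₁).arr 3 v = a v + b v := fun v => by
      rw [denote_arr_of_not_writesArr rfl s₁, h31]
    have h52 : ∀ v : Fin N, (p.denote s₁).arr 5 v = a v := fun v => by
      rw [denote_arr_of_not_writesArr rfl s₁, h51]
    set s₂ := p.denote s₁
    obtain ⟨k6, k7, k⟩ := key
    have hn : s₂.reg 6 + 1 = n := by
      obtain ⟨v, hv, -⟩ := hc.surj (n - 1) (by omega) 0 hc.m_pos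
      have := (k v v.2).1
      omega
    have hm : s₂.reg 7 + 1 = m := by
      obtain ⟨v, -, hv⟩ := hc.surj 0 hc.n_pos (m - 1) (by omega)
      have := (k v v.2).2
      omega
    by_cases hlt : s₂.reg 7 < s₂.reg 6
    · refine ⟨m, n, b, a, hc.swap, by omega, ?_⟩
      have hb : (Expr.sub (.reg 6) (.reg 7)).eval s₂ ≠ 0 := by
        simp only [Expr.eval]
        omega
      rw [denote_cond_of_ne_zero hb, denote_seq]
      set q := rep 4 (store 5 (.reg 4) (.sub (.get 3 (.reg 4)) (.get 5 (.reg 4)))) with hq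
      have h73 : (q.denote s₂).reg 7 = s₂.reg 7 := denote_reg_of_not_writesReg rfl s₂
      -- The rows are overwritten in place; cell `v` still holds `a v` when it is visited.
      have key := denote_rep_induction (c := 4)
        (p := store 5 (.reg 4) (.sub (.get 3 (.reg 4)) (.get 5 (.reg 4)))) rfl s₂
        (fun i s' => ∀ v : Fin N, s'.arr 5 v = if v < i then b v else a v) ?_ ?_
      · rw [h22] at key
        refine ⟨by simp [denote, Expr.eval, h73, hm], fun v => by rw [h3, add_comm], fun v => ?_⟩
        have := key v
        rw [if_pos v.2] at this
        exact this
      · simpa using h52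
      · intro i hi s' hi' hreg harr hinv v
        by_cases hvi : (v : ℕ) = i
        · have e1 := hinv v
          have e2 := h32 v
          rw [← harr 3 rfl] at e2
          rw [if_neg (by omega)] at e1
          rw [if_pos (by omega)]
          simp [denote, Expr.eval, hi', ← hvi, e1, e2]
        · have : (v : ℕ) < i + 1 ↔ (v : ℕ) < i := by omega
          simp [denote, Expr.eval, hi', hvi, hinv v, this]
    · refine ⟨n, m, a, b, hc, by omega, ?_⟩
      have hb : (Expr.sub (.reg 6) (.reg 7)).eval s₂ = 0 := by
        simp only [Expr.eval]
        omega
      rw [denote_cond_of_eq_zero hb]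
      exact ⟨by simp [denote, Expr.eval, hn], h3, h52⟩
  · simp [hs₁, denote, Expr.eval, hc.n_pos, hc.m_pos]
  · intro i hi s' hi' hreg harr hinv
    rw [h21] at hi
    have e3 : s'.arr 3 i = a ⟨i, hi⟩ + b ⟨i, hi⟩ := by rw [harr 3 rfl]; exact h31 ⟨i, hi⟩
    have e5 : s'.arr 5 i = a ⟨i, hi⟩ := by rw [harr 5 rfl]; exact h51 ⟨i, hi⟩
    rw [denote_seq, denote_cond_max, denote_cond_max]
    have ha := hc.a_lt ⟨i, hi⟩
    have hb := hc.b_lt ⟨i, hi⟩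
    simp only [Expr.eval, State.setReg_reg, State.setReg_arr, hi', e5]
    simp only [Nat.reduceEqDiff, if_false, if_true, e3, e5]
    obtain ⟨I1, I2, I3⟩ := hinv
    refine ⟨by omega, by omega, fun v hv => ?_⟩
    rcases Nat.lt_succ_iff_lt_or_eq.1 hv with hv | hv
    · have := I3 v hv
      omega
    · obtain rfl : v = ⟨i, hi⟩ := Fin.ext hv
      omega

end ForProg

end RAM

/-! ### The number of trunks and the direction of the parent, without multiplication. -/

namespace RAM

namespace ForProg

/-- The binary logarithm of the content of register `x`, in register `y`, with register `z` for
auxiliary use. -/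
def binaryLog (x y z : ℕ) : ForProg :=
  seq (assign y (.const 0)) (seq (assign z (.const 1))
    (rep 4 (cond (.sub (.add (.reg x) (.const 1)) (.add (.reg z) (.reg z)))
      (seq (assign z (.add (.reg z) (.reg z))) (assign y (.add (.reg y) (.const 1)))) skip)))

/-- Register `z` holds `2 ^ y` and is doubled as long as the result does not exceed `x`. Enough
rounds are available because `log x ≤ x`. -/
lemma binaryLog_reg {x y z : ℕ} (hxy : x ≠ y) (hxz : x ≠ z) (hyz : y ≠ z) (hx4 : x ≠ 4)
    (hy4 : y ≠ 4) (hz4 : z ≠ 4) (hy2 : y ≠ 2) (hz2 : z ≠ 2) {s : State} (h : s.reg x ≤ s.reg 2) :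
    ((binaryLog x y z).denote s).reg y = Nat.log 2 (s.reg x) := by
  simp only [binaryLog, denote_seq]
  set s₁ := (assign z (.const 1)).denote ((assign y (.const 0)).denote s) with hs₁
  have e2 : s₁.reg 2 = s.reg 2 := by simp [hs₁, denote_assign, hy2.symm, hz2.symm]
  have ex : s₁.reg x = s.reg x := by simp [hs₁, denote_assign, hxy, hxz]
  have key := denote_rep_induction (c := 4)
    (p := cond (.sub (.add (.reg x) (.const 1)) (.add (.reg z) (.reg z)))
      (seq (assign z (.add (.reg z) (.reg z))) (assign y (.add (.reg y) (.const 1)))) skip)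
    (by simp [wf, writesReg, hy4, hz4, hy2, hz2]) s₁
    (fun i s' => s'.reg y = min i (Nat.log 2 (s.reg x)) ∧
      s'.reg z = 2 ^ min i (Nat.log 2 (s.reg x))) ?_ ?_
  · rw [key.1, e2, min_eq_right ((Nat.log_le_self 2 _).trans h)]
  · simp [hs₁, denote_assign, Expr.eval, hyz, hy4, hz4]
  · intro i hi s' hi' hreg harr hinv
    have ex' : s'.reg x = s.reg x := by
      rw [hreg x (by simp [writesReg, hxy.symm, hxz.symm, hx4.symm]), ex]
    set l := Nat.log 2 (s.reg x) with hl
    obtain ⟨I1, I2⟩ := hinv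
    have hstep : (Expr.sub (.add (.reg x) (.const 1)) (.add (.reg z) (.reg z))).eval s' ≠ 0 ↔
        i < l := by
      have e : (Expr.sub (.add (.reg x) (.const 1)) (.add (.reg z) (.reg z))).eval s' ≠ 0 ↔
          2 ^ (min i l + 1) ≤ s.reg x := by
        simp only [Expr.eval, I2, ex', pow_succ]
        omega
      rw [e]
      rcases Nat.eq_zero_or_pos (s.reg x) with h0 | h0
      · have : l = 0 := by simp [hl, h0]
        simp [h0, this]
      · rw [← Nat.le_log_iff_pow_le (by norm_num) h0.ne', ← hl]
        omega
    by_cases hil : i < l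
    · rw [denote_cond_of_ne_zero (hstep.2 hil)]
      have m1 : min i l = i := by omega
      have m2 : min (i + 1) l = i + 1 := by omega
      rw [m1] at I1 I2
      rw [m2]
      simp [denote_seq, denote_assign, Expr.eval, I1, I2, hyz, hyz.symm, hy4, hz4, pow_succ, mul_two]
    · rw [denote_cond_of_eq_zero (not_not.1 (hstep.not.2 hil))]
      have m1 : min (i + 1) l = min i l := by omega
      rw [m1]
      simp [denote, hy4, hz4, I1, I2]

/-- Put the number of trunks into register `8` and its product with the number of rows into
register `9`. -/
def countTrunks : ForProg :=
  seq (binaryLog 6 7 9) (seq (binaryLog 7 8 9) (seq (binaryLog 8 10 9)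
    (seq (assign 7 (.sub (.reg 7) (.reg 10))) (seq (assign 8 (.const 1))
      (seq (rep 4 (cond (.sub (.reg 7) (.reg 4)) (assign 8 (.add (.reg 8) (.reg 8))) skip))
        (seq (assign 9 (.const 0))
          (rep 4 (cond (.sub (.reg 6) (.reg 4)) (assign 9 (.add (.reg 9) (.reg 8))) skip))))))))

/-- A loop whose body has an effect in the first `k` iterations only. -/
lemma rep_cond_reg {c x y : ℕ} {e : Expr} (hxy : x ≠ y) (hxc : x ≠ c) (hyc : y ≠ c) (hc2 : c ≠ 2)
    (hy2 : y ≠ 2) (s : State) (f : ℕ → ℕ) (h0 : s.reg y = f 0)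
    (hstep : ∀ i < s.reg 2, ∀ s' : State, s'.reg y = f i →
      (∀ r, r ≠ y → r ≠ c → s'.reg r = s.reg r) → e.eval s' = f (i + 1)) :
    ((rep c (cond (.sub (.reg x) (.reg c)) (assign y e) skip)).denote s).reg y =
      f (min (s.reg 2) (s.reg x)) := by
  have key := denote_rep_induction (c := c)
    (p := cond (.sub (.reg x) (.reg c)) (assign y e) skip)
    (by simp [wf, writesReg, hyc, hc2, hy2]) s (fun i s' => s'.reg y = f (min i (s.reg x)))
    (by simp [hyc, h0]) ?_
  · exact key
  · intro i hi s' hi' hreg harr hinv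
    have hreg' : ∀ r, r ≠ y → r ≠ c → s'.reg r = s.reg r := fun r h1 h2 =>
      hreg r (by simp [writesReg, h1.symm, h2.symm])
    have ex := hreg' x hxy hxc
    by_cases hix : i < s.reg x
    · rw [denote_cond_of_ne_zero (by simp only [Expr.eval, ex, hi']; omega)]
      rw [min_eq_left hix.le] at hinv
      rw [min_eq_left (by omega)]
      simp only [denote_assign, State.setReg_reg, if_neg hyc, if_true]
      exact hstep i hi s' hinv hreg'
    · rw [denote_cond_of_eq_zero (by simp only [Expr.eval, ex, hi']; omega)]
      rw [min_eq_right (not_lt.1 hix)] at hinv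
      rw [min_eq_right (by omega)]
      simpa [denote, hyc] using hinv

lemma countTrunks_reg {s : State} {n : ℕ} (h6 : s.reg 6 = n) (hn : n ≤ s.reg 2) :
    (countTrunks.denote s).reg 8 = 2 ^ trunkExp n ∧
      (countTrunks.denote s).reg 9 = n * 2 ^ trunkExp n := by
  simp only [countTrunks, denote_seq]
  have a1 := binaryLog_reg (x := 6) (y := 7) (z := 9) (s := s) (by norm_num) (by norm_num)
    (by norm_num) (by norm_num) (by norm_num) (by norm_num) (by norm_num) (by norm_num) (by omega)
  have b1 : ((binaryLog 6 7 9).denote s).reg 2 = s.reg 2 := denote_reg_of_not_writesReg rfl s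
  have c1 : ((binaryLog 6 7 9).denote s).reg 6 = s.reg 6 := denote_reg_of_not_writesReg rfl s
  set s₁ := (binaryLog 6 7 9).denote s
  have hl : ∀ k, Nat.log 2 k ≤ k := Nat.log_le_self 2
  rw [h6] at a1 c1
  have a2 := binaryLog_reg (x := 7) (y := 8) (z := 9) (s := s₁) (by norm_num) (by norm_num)
    (by norm_num) (by norm_num) (by norm_num) (by norm_num) (by norm_num) (by norm_num)
    (by have := hl n; omega)
  have b2 : ((binaryLog 7 8 9).denote s₁).reg 2 = s₁.reg 2 := denote_reg_of_not_writesReg rfl s₁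
  have c2 : ((binaryLog 7 8 9).denote s₁).reg 6 = s₁.reg 6 := denote_reg_of_not_writesReg rfl s₁
  have d2 : ((binaryLog 7 8 9).denote s₁).reg 7 = s₁.reg 7 := denote_reg_of_not_writesReg rfl s₁
  set s₂ := (binaryLog 7 8 9).denote s₁
  rw [a1] at a2
  have a3 := binaryLog_reg (x := 8) (y := 10) (z := 9) (s := s₂) (by norm_num) (by norm_num)
    (by norm_num) (by norm_num) (by norm_num) (by norm_num) (by norm_num) (by norm_num)
    (by have := hl n; have := hl (Nat.log 2 n); omega)
  have b3 : ((binaryLog 8 10 9).denote s₂).reg 2 = s₂.reg 2 := denote_reg_of_not_writesReg rfl s₂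
  have c3 : ((binaryLog 8 10 9).denote s₂).reg 6 = s₂.reg 6 := denote_reg_of_not_writesReg rfl s₂
  have d3 : ((binaryLog 8 10 9).denote s₂).reg 7 = s₂.reg 7 := denote_reg_of_not_writesReg rfl s₂
  set s₃ := (binaryLog 8 10 9).denote s₂
  rw [a2] at a3
  set s₄ := (assign 8 (.const 1)).denote ((assign 7 (.sub (.reg 7) (.reg 10))).denote s₃) with hs₄
  have a4 : s₄.reg 7 = trunkExp n := by
    simp [hs₄, denote_assign, Expr.eval, a3, d3, d2, a1, trunkExp]
  have b4 : s₄.reg 8 = 1 := by simp [hs₄, denote_assign, Expr.eval]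
  have c4 : s₄.reg 6 = n := by simp [hs₄, denote_assign, c3, c2, c1]
  have d4 : s₄.reg 2 = s.reg 2 := by simp [hs₄, denote_assign, b3, b2, b1]
  have a5 := rep_cond_reg (c := 4) (x := 7) (y := 8) (e := .add (.reg 8) (.reg 8)) (by norm_num)
    (by norm_num) (by norm_num) (by norm_num) (by norm_num) s₄ (fun i => 2 ^ i) (by simp [b4])
    (fun i hi s' hs' _ => by simp [Expr.eval, hs', pow_succ, mul_two])
  rw [a4, min_eq_right (by rw [d4]; have := hl n; unfold trunkExp; omega)] at a5
  set p := rep 4 (cond (.sub (.reg 7) (.reg 4)) (assign 8 (.add (.reg 8) (.reg 8))) skip)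
  have b5 : (p.denote s₄).reg 6 = s₄.reg 6 := denote_reg_of_not_writesReg rfl s₄
  have c5 : (p.denote s₄).reg 2 = s₄.reg 2 := denote_reg_of_not_writesReg rfl s₄
  set s₅ := p.denote s₄
  set s₆ := (assign 9 (.const 0)).denote s₅ with hs₆
  have a6 : s₆.reg 8 = 2 ^ trunkExp n := by simp [hs₆, denote_assign, a5]
  have b6 : s₆.reg 9 = 0 := by simp [hs₆, denote_assign, Expr.eval]
  have c6 : s₆.reg 6 = n := by simp [hs₆, denote_assign, b5, c4]
  have d6 : s₆.reg 2 = s.reg 2 := by simp [hs₆, denote_assign, c5, d4]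
  constructor
  · rw [denote_reg_of_not_writesReg rfl s₆, a6]
  · rw [rep_cond_reg (c := 4) (x := 6) (y := 9) (e := .add (.reg 9) (.reg 8)) (by norm_num)
      (by norm_num) (by norm_num) (by norm_num) (by norm_num) s₆ (fun i => i * 2 ^ trunkExp n)
      (by simp [b6]) (fun i hi s' hs' hreg => ?_), c6, min_eq_right (by omega)]
    simp only [Expr.eval, hs', hreg 8 (by norm_num) (by norm_num), a6]
    ring

/-- Decide whether the parent of the vertex in register `4` is in the same row; register `15` is
not zero in this case. -/
def decideParent : ForProg :=
  seq (assign 10 (.get 3 (.reg 4))) (seq (assign 11 (.get 5 (.reg 4)))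
    (seq (seq (assign 12 (.const 1))
      (rep 13 (cond (.sub (.add (.reg 10) (.const 1)) (.reg 12))
        (assign 12 (.add (.reg 12) (.reg 12))) skip)))
    (seq (assign 16 (.sub (.reg 10) (.reg 11))) (seq (assign 14 (.const 0))
    (seq (rep 13 (cond (.sub (.reg 11) (.reg 13)) (assign 14 (.add (.reg 14) (.reg 8))) skip))
    (seq (rep 13 (cond (.sub (.reg 16) (.reg 13)) (assign 14 (.add (.reg 14) (.reg 6))) skip))
    (cond (.sub (.reg 8) (.reg 10))
      (assign 15 (.sub (.add (.const 1) (.sub (.add (.reg 10) (.reg 10)) (.reg 11))) (.reg 12)))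
      (assign 15 (.sub (.add (.reg 14) (.const 1)) (.reg 9))))))))))

/-- Products are repeated additions, `a + 2 b` is computed as `2 (a + b) - a`, and `u ≤ v` is tested
by `v + 1 - u ≠ 0`. Rank zero is excluded because the doubling loop then stops at `1` instead of `2
^ (log 0 + 1)`. -/
lemma decideParent_reg {s : State} {K n a b v : ℕ} (hv : s.reg 4 = v) (h3 : s.arr 3 v = a + b)
    (h5 : s.arr 5 v = a) (h6 : s.reg 6 = n) (h8 : s.reg 8 = K) (h9 : s.reg 9 = n * K)
    (hN : a + b ≤ s.reg 2) (h0 : a + b ≠ 0) :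
    (decideParent.denote s).reg 10 = a + b ∧ (decideParent.denote s).reg 11 = a ∧
      ((decideParent.denote s).reg 15 ≠ 0 ↔ IsHorizontal K n a b) := by
  simp only [decideParent, denote_seq]
  set s₁ := (assign 12 (.const 1)).denote ((assign 11 (.get 5 (.reg 4))).denote
    ((assign 10 (.get 3 (.reg 4))).denote s)) with hs₁
  have a1 : s₁.reg 10 = a + b := by simp [hs₁, denote_assign, Expr.eval, hv, h3]
  have b1 : s₁.reg 11 = a := by simp [hs₁, denote_assign, Expr.eval, hv, h5]
  have c1 : s₁.reg 12 = 1 := by simp [hs₁, denote_assign, Expr.eval]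
  have d1 : s₁.reg 2 = s.reg 2 := by simp [hs₁, denote_assign]
  have e1 : s₁.reg 6 = n := by simp [hs₁, denote_assign, h6]
  have f1 : s₁.reg 8 = K := by simp [hs₁, denote_assign, h8]
  have g1 : s₁.reg 9 = n * K := by simp [hs₁, denote_assign, h9]
  set p := rep 13 (cond (.sub (.add (.reg 10) (.const 1)) (.reg 12))
        (assign 12 (.add (.reg 12) (.reg 12))) skip) with hp
  have key := denote_rep_induction (c := 13) (p := cond (.sub (.add (.reg 10) (.const 1)) (.reg 12))
        (assign 12 (.add (.reg 12) (.reg 12))) skip) rfl s₁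
    (fun i s' => s'.reg 12 = 2 ^ min i (Nat.log 2 (a + b) + 1)) (by simp [c1]) ?_
  swap
  · intro i hi s' hi' hreg harr hinv
    have e10 := (hreg 10 rfl).trans a1
    set l := Nat.log 2 (a + b) with hl
    have hstep : (Expr.sub (.add (.reg 10) (.const 1)) (.reg 12)).eval s' ≠ 0 ↔ i < l + 1 := by
      have e : (Expr.sub (.add (.reg 10) (.const 1)) (.reg 12)).eval s' ≠ 0 ↔
          2 ^ (min i (l + 1)) ≤ a + b := by
        simp only [Expr.eval, hinv, e10]
        omega
      rw [e, ← Nat.le_log_iff_pow_le (by norm_num) h0, ← hl]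
      omega
    by_cases hil : i < l + 1
    · rw [denote_cond_of_ne_zero (hstep.2 hil)]
      rw [min_eq_left hil.le] at hinv
      rw [min_eq_left (by omega)]
      simp [denote_assign, Expr.eval, hinv, pow_succ, mul_two]
    · rw [denote_cond_of_eq_zero (not_not.1 (hstep.not.2 hil))]
      have m1 : min (i + 1) (l + 1) = min i (l + 1) := by omega
      rw [m1]
      simpa [denote] using hinv
  have hlog : Nat.log 2 (a + b) < a + b := Nat.log_lt_self 2 h0
  rw [← hp, d1, min_eq_right (by omega)] at key
  have a2 : (p.denote s₁).reg 10 = a + b := (denote_reg_of_not_writesReg rfl s₁).trans a1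
  have b2 : (p.denote s₁).reg 11 = a := (denote_reg_of_not_writesReg rfl s₁).trans b1
  have d2 : (p.denote s₁).reg 2 = s.reg 2 := (denote_reg_of_not_writesReg rfl s₁).trans d1
  have e2 : (p.denote s₁).reg 6 = n := (denote_reg_of_not_writesReg rfl s₁).trans e1
  have f2 : (p.denote s₁).reg 8 = K := (denote_reg_of_not_writesReg rfl s₁).trans f1
  have g2 : (p.denote s₁).reg 9 = n * K := (denote_reg_of_not_writesReg rfl s₁).trans g1
  set s₂ := p.denote s₁
  set s₃ := (assign 14 (.const 0)).denote ((assign 16 (.sub (.reg 10) (.reg 11))).denote s₂) with hs₃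
  have a3 : s₃.reg 10 = a + b := by simp [hs₃, denote_assign, a2]
  have b3 : s₃.reg 11 = a := by simp [hs₃, denote_assign, b2]
  have c3 : s₃.reg 12 = 2 ^ (Nat.log 2 (a + b) + 1) := by simp [hs₃, denote_assign, key]
  have d3 : s₃.reg 2 = s.reg 2 := by simp [hs₃, denote_assign, d2]
  have e3 : s₃.reg 6 = n := by simp [hs₃, denote_assign, e2]
  have f3 : s₃.reg 8 = K := by simp [hs₃, denote_assign, f2]
  have g3 : s₃.reg 9 = n * K := by simp [hs₃, denote_assign, g2]
  have i3 : s₃.reg 14 = 0 := by simp [hs₃, denote_assign, Expr.eval]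
  have j3 : s₃.reg 16 = b := by simp [hs₃, denote_assign, Expr.eval, a2, b2]
  have i4 := rep_cond_reg (c := 13) (x := 11) (y := 14) (e := .add (.reg 14) (.reg 8)) (by norm_num)
    (by norm_num) (by norm_num) (by norm_num) (by norm_num) s₃ (fun i => i * K) (by simp [i3])
    (fun i hi s' hs' hreg => by
      simp only [Expr.eval, hs', hreg 8 (by norm_num) (by norm_num), f3]; ring)
  set q := rep 13 (cond (.sub (.reg 11) (.reg 13)) (assign 14 (.add (.reg 14) (.reg 8))) skip)
  rw [b3, min_eq_right (by omega)] at i4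
  have r4 : ∀ r, r ≠ 13 → r ≠ 14 → (q.denote s₃).reg r = s₃.reg r := fun r h1 h2 =>
    denote_reg_of_not_writesReg (by simp [q, writesReg, h1.symm, h2.symm]) s₃
  set s₄ := q.denote s₃
  have i5 := rep_cond_reg (c := 13) (x := 16) (y := 14) (e := .add (.reg 14) (.reg 6)) (by norm_num)
    (by norm_num) (by norm_num) (by norm_num) (by norm_num) s₄ (fun i => a * K + i * n)
    (by simp [i4])
    (fun i hi s' hs' hreg => by
      simp only [Expr.eval, hs', hreg 6 (by norm_num) (by norm_num),
        r4 6 (by norm_num) (by norm_num), e3]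
      ring)
  set q' := rep 13 (cond (.sub (.reg 16) (.reg 13)) (assign 14 (.add (.reg 14) (.reg 6))) skip)
  rw [r4 16 (by norm_num) (by norm_num), r4 2 (by norm_num) (by norm_num), j3, d3,
    min_eq_right (by omega)] at i5
  have r5 : ∀ r, r ≠ 13 → r ≠ 14 → (q'.denote s₄).reg r = s₃.reg r := fun r h1 h2 =>
    (denote_reg_of_not_writesReg (by simp [q', writesReg, h1.symm, h2.symm]) s₄).trans (r4 r h1 h2)
  set s₅ := q'.denote s₄
  have a5 : s₅.reg 10 = a + b := (r5 10 (by norm_num) (by norm_num)).trans a3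
  have b5 : s₅.reg 11 = a := (r5 11 (by norm_num) (by norm_num)).trans b3
  have c5 := (r5 12 (by norm_num) (by norm_num)).trans c3
  have f5 : s₅.reg 8 = K := (r5 8 (by norm_num) (by norm_num)).trans f3
  have g5 : s₅.reg 9 = n * K := (r5 9 (by norm_num) (by norm_num)).trans g3
  refine ⟨by rw [denote_reg_of_not_writesReg rfl s₅, a5],
    by rw [denote_reg_of_not_writesReg rfl s₅, b5], ?_⟩
  rw [IsHorizontal]
  by_cases hK : a + b < K
  · rw [denote_cond_of_ne_zero (by simp only [Expr.eval, f5, a5]; omega), if_pos hK, denote_assign]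
    simp only [State.setReg_reg, if_true, Expr.eval, a5, b5, c5]
    omega
  · rw [denote_cond_of_eq_zero (by simp only [Expr.eval, f5, a5]; omega), if_neg hK, denote_assign]
    simp only [State.setReg_reg, if_true, Expr.eval, i5, g5, mul_comm K n]
    omega

end ForProg

end RAM

lemma Fin.mul_add_inj {N : ℕ} {x y x' y' : Fin N} :
    (x : ℕ) * N + y = x' * N + y' ↔ x = x' ∧ y = y' := by
  refine ⟨fun h => ?_, by rintro ⟨rfl, rfl⟩; rfl⟩
  have key : ∀ u v : Fin N, ((u : ℕ) * N + v) / N = u ∧ ((u : ℕ) * N + v) % N = v := by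
    intro u v
    rw [mul_comm]
    exact ⟨by rw [Nat.mul_add_div (by omega), Nat.div_eq_of_lt v.2, add_zero],
      by rw [Nat.mul_add_mod, Nat.mod_eq_of_lt v.2]⟩
  have h1 := key x y
  rw [h] at h1
  exact ⟨Fin.ext (h1.1.symm.trans (key x' y').1), Fin.ext (h1.2.symm.trans (key x' y').2)⟩

/-- A vertex has at most two neighbors of smaller rank, and the row tells them apart. This is the
local test that `testParent` performs. -/
lemma IsGridCoord.parent_eq_iff {V : Type*} {G : SimpleGraph V} {r : V} {n m K : ℕ} {a b : V → ℕ}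
    {π : V → V} (h : IsGridCoord G r n m a b) (hK : 0 < K)
    (hπ : ∀ v, (a (π v), b (π v)) = parentCoord K n (a v, b v)) {u v : V} (hv : v ≠ r) :
    π v = u ↔ G.Adj u v ∧ a u + b u < a v + b v ∧ (¬ a u < a v ↔ IsHorizontal K n (a v) (b v)) := by
  have h0 := h.rank_parent hK hπ hv
  have hpar : G.Adj (π v) v := by
    refine h.parentGraph_le hK hπ ⟨fun he => ?_, Or.inr rfl⟩
    rw [he] at h0
    omega
  constructor
  · rintro rfl
    refine ⟨hpar, by omega, ?_⟩
    by_cases hh : IsHorizontal K n (a v) (b v)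
    · obtain ⟨h1, h2⟩ := IsGridCoord.parent_of_isHorizontal hπ hh
      simp only [hh, iff_true]
      omega
    · obtain ⟨h1, h2⟩ := IsGridCoord.parent_of_not_isHorizontal hπ hh
      simp only [hh, iff_false]
      omega
  · rintro ⟨h1, h2, h3⟩
    rw [h.adj_iff] at h1
    by_cases hh : IsHorizontal K n (a v) (b v)
    · obtain ⟨h4, h5⟩ := IsGridCoord.parent_of_isHorizontal hπ hh
      simp only [hh, iff_true] at h3
      exact h.inj _ _ (by omega) (by omega)
    · obtain ⟨h4, h5⟩ := IsGridCoord.parent_of_not_isHorizontal hπ hh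
      simp only [hh, iff_false] at h3
      exact h.inj _ _ (by omega) (by omega)

/-! ### Writing the adjacency matrix of the tree. -/

namespace RAM

namespace ForProg

/-- Add the edge between the vertices in registers `4` and `13` to the output matrix. -/
def addEdge : ForProg :=
  seq (store 1 (.add (.get 2 (.reg 13)) (.reg 4)) (.const 1))
    (store 1 (.add (.get 2 (.reg 4)) (.reg 13)) (.const 1))

/-- Add the edge between the vertices in registers `4` and `13` to the output matrix if the latter
is the parent of the former. -/
def testParent : ForProg :=
  cond (adjExpr 13 4)
    (cond (.sub (.reg 10) (.get 3 (.reg 13)))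
      (cond (.reg 15) (cond (.sub (.reg 11) (.get 5 (.reg 13))) skip addEdge)
        (cond (.sub (.reg 11) (.get 5 (.reg 13))) addEdge skip))
      skip)
    skip

/-- Write the adjacency matrix of the tree. -/
def buildTree : ForProg := rep 4 (seq decideParent (rep 13 testParent))

lemma addEdge_arr {N : ℕ} {s : State} {u v : Fin N} (hv : s.reg 4 = v) (hu : s.reg 13 = u)
    (hoff : ∀ w : Fin N, s.arr 2 w = w * N) (x y : Fin N) :
    (addEdge.denote s).arr 1 (x * N + y) =
      if (x = u ∧ y = v) ∨ (x = v ∧ y = u) then 1 else s.arr 1 (x * N + y) := by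
  simp only [addEdge, denote_seq, denote_store, Expr.eval, State.setArr_arr, State.setArr_reg, hv,
    hu, hoff, true_and, Nat.reduceEqDiff, false_and, if_false, Fin.mul_add_inj]
  by_cases h1 : x = v ∧ y = u <;> by_cases h2 : x = u ∧ y = v <;> simp [h1, h2]

lemma testParent_denote {N : ℕ} {G : SimpleGraph (Fin N)} {s : State} (h : Holds G s)
    {a b : Fin N → ℕ} {u v : Fin N} {H : Prop} (hv : s.reg 4 = v) (hu : s.reg 13 = u)
    (h3 : s.arr 3 u = a u + b u) (h5 : s.arr 5 u = a u) (h10 : s.reg 10 = a v + b v)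
    (h11 : s.reg 11 = a v) (h15 : s.reg 15 ≠ 0 ↔ H) :
    ((G.Adj u v ∧ a u + b u < a v + b v ∧ (¬ a u < a v ↔ H)) ∧
      testParent.denote s = addEdge.denote s) ∨
    (¬ (G.Adj u v ∧ a u + b u < a v + b v ∧ (¬ a u < a v ↔ H)) ∧ testParent.denote s = s) := by
  have e1 : (adjExpr 13 4).eval s ≠ 0 ↔ G.Adj u v := h.adjExpr_ne_zero hu hv
  have e2 : (Expr.sub (.reg 10) (.get 3 (.reg 13))).eval s ≠ 0 ↔ a u + b u < a v + b v := by
    simp only [Expr.eval, hu, h3, h10]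
    omega
  have e3 : (Expr.reg 15).eval s ≠ 0 ↔ H := h15
  have e4 : (Expr.sub (.reg 11) (.get 5 (.reg 13))).eval s ≠ 0 ↔ a u < a v := by
    simp only [Expr.eval, hu, h5, h11]
    omega
  simp only [testParent, denote]
  rw [← e1, ← e2, ← e3, ← e4]
  split_ifs <;> simp_all

open Classical in
lemma buildTree_arr {N : ℕ} {G : SimpleGraph (Fin N)} {s : State} (h : Holds G s)
    (hoff : ∀ w : Fin N, s.arr 2 w = w * N) {r : Fin N} {n m K : ℕ} {a b : Fin N → ℕ}
    (hc : IsGridCoord G r n m a b) (hK : 0 < K) {π : Fin N → Fin N}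
    (hπ : ∀ v, (a (π v), b (π v)) = parentCoord K n (a v, b v))
    (h3 : ∀ v : Fin N, s.arr 3 v = a v + b v) (h5 : ∀ v : Fin N, s.arr 5 v = a v)
    (h6 : s.reg 6 = n) (h8 : s.reg 8 = K) (h9 : s.reg 9 = n * K) (h1 : ∀ i, s.arr 1 i = 0)
    (x y : Fin N) :
    (buildTree.denote s).arr 1 (x * N + y) = if (parentGraph π).Adj x y then 1 else 0 := by
  have hN : ∀ v, a v + b v + 1 ≤ N := fun v => by simpa using hc.rank_lt v
  have key := denote_rep_induction (c := 4) (p := seq decideParent (rep 13 testParent)) rfl s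
    (fun i s' => ∀ x y : Fin N, s'.arr 1 (x * N + y) =
      if (y ≠ r ∧ π y = x ∧ (y : ℕ) < i) ∨ (x ≠ r ∧ π x = y ∧ (x : ℕ) < i) then 1 else 0)
    (by simp [h1]) ?_
  · rw [h.reg_two] at key
    rw [buildTree, key x y]
    refine if_congr ?_ rfl rfl
    have hne : ∀ v, v ≠ r → π v ≠ v := fun v hv he => by
      have := hc.rank_parent hK hπ hv
      rw [he] at this
      omega
    have hr := hc.parent_root hπ
    constructor
    · rintro (⟨h1, rfl, -⟩ | ⟨h1, rfl, -⟩)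
      · exact ⟨hne _ h1, Or.inr rfl⟩
      · exact ⟨(hne _ h1).symm, Or.inl rfl⟩
    · rintro ⟨h1, rfl | rfl⟩
      · refine Or.inr ⟨?_, rfl, x.2⟩
        rintro rfl
        exact h1 hr.symm
      · refine Or.inl ⟨?_, rfl, y.2⟩
        rintro rfl
        exact h1 hr
  · intro i hi s₁ hi₁ hreg₁ harr₁ hinv₁ x y
    rw [h.reg_two] at hi
    set v : Fin N := ⟨i, hi⟩ with hv
    have g1 : Holds G s₁ := h.congr (hreg₁ 2 rfl) (harr₁ 0 rfl) (harr₁ 2 rfl)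
    have e3 : ∀ w : Fin N, s₁.arr 3 w = a w + b w := fun w => by rw [harr₁ 3 rfl, h3]
    have e5 : ∀ w : Fin N, s₁.arr 5 w = a w := fun w => by rw [harr₁ 5 rfl, h5]
    have e10 : (decideParent.denote s₁).reg 10 = a v + b v := by
      rw [decideParent, denote_seq, denote_reg_of_not_writesReg rfl, denote_assign]
      simp only [State.setReg_reg, if_true, Expr.eval, hi₁]
      exact e3 v
    have hdec := fun hvr : v ≠ r => decideParent_reg (K := K) hi₁ (e3 v) (e5 v)
      ((hreg₁ 6 rfl).trans h6) ((hreg₁ 8 rfl).trans h8) ((hreg₁ 9 rfl).trans h9)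
      (by rw [g1.reg_two]; have := hN v; omega) ((hc.eq_root_iff v).not.1 hvr)
    have g2 : Holds G (decideParent.denote s₁) := g1.congr (denote_reg_of_not_writesReg rfl s₁)
      (denote_arr_of_not_writesArr rfl s₁) (denote_arr_of_not_writesArr rfl s₁)
    have i2 : (decideParent.denote s₁).reg 4 = v :=
      (denote_reg_of_not_writesReg rfl s₁).trans hi₁
    have f1 := denote_arr_of_not_writesArr (p := decideParent) (a := 1) rfl s₁
    have f2 : ∀ w : Fin N, (decideParent.denote s₁).arr 2 w = w * N := fun w => by
      rw [denote_arr_of_not_writesArr rfl s₁, harr₁ 2 rfl, hoff]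
    have f3 : ∀ w : Fin N, (decideParent.denote s₁).arr 3 w = a w + b w := fun w => by
      rw [denote_arr_of_not_writesArr rfl s₁, e3]
    have f5 : ∀ w : Fin N, (decideParent.denote s₁).arr 5 w = a w := fun w => by
      rw [denote_arr_of_not_writesArr rfl s₁, e5]
    rw [denote_seq, State.setReg_arr]
    set s₂ := decideParent.denote s₁
    have key := denote_rep_induction (c := 13) (p := testParent) rfl s₂
      (fun j s' => ∀ x y : Fin N, s'.arr 1 (x * N + y) =
        if (y ≠ r ∧ π y = x ∧ ((y : ℕ) < i ∨ (y = v ∧ (x : ℕ) < j))) ∨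
          (x ≠ r ∧ π x = y ∧ ((x : ℕ) < i ∨ (x = v ∧ (y : ℕ) < j))) then 1 else 0)
      (by intro x y; simp [f1, hinv₁ x y]) ?_
    · rw [g2.reg_two] at key
      rw [key x y]
      refine if_congr ?_ rfl rfl
      have hlt : ∀ w : Fin N, (w : ℕ) < i + 1 ↔ (w : ℕ) < i ∨ w = v := fun w => by
        rw [Nat.lt_succ_iff_lt_or_eq, hv, Fin.ext_iff]
      simp only [hlt, x.2, y.2, and_true]
    · intro j hj s₃ hj₃ hreg₃ harr₃ hinv₃ x y
      rw [g2.reg_two] at hj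
      set u : Fin N := ⟨j, hj⟩ with hu
      have g3 : Holds G s₃ := g2.congr (hreg₃ 2 rfl) (harr₃ 0 rfl) (harr₃ 2 rfl)
      have hlt : ∀ w : Fin N, (w : ℕ) < j + 1 ↔ (w : ℕ) < j ∨ w = u := fun w => by
        rw [Nat.lt_succ_iff_lt_or_eq, hu, Fin.ext_iff]
      have i3 : s₃.reg 4 = v := (hreg₃ 4 rfl).trans i2
      have hu₃ : s₃.reg 13 = u := hj₃
      have t3 : s₃.arr 3 u = a u + b u := by rw [harr₃ 3 rfl, f3]
      have t5 : s₃.arr 5 u = a u := by rw [harr₃ 5 rfl, f5]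
      have t10 : s₃.reg 10 = a v + b v := (hreg₃ 10 rfl).trans e10
      have hstep : ((v ≠ r ∧ π v = u) ∧ testParent.denote s₃ = addEdge.denote s₃) ∨
          (¬ (v ≠ r ∧ π v = u) ∧ testParent.denote s₃ = s₃) := by
        -- At the root register `15` carries no information, but no vertex has smaller rank, so no
        -- edge is added.
        by_cases hvr : v = r
        · right
          refine ⟨fun hh => hh.1 hvr, ?_⟩
          have h0 := (hc.eq_root_iff v).1 hvr
          have e2 : (Expr.sub (.reg 10) (.get 3 (.reg 13))).eval s₃ = 0 := by
            simp only [Expr.eval, t10, h0, Nat.zero_sub]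
          simp only [testParent, denote]
          rw [if_neg (not_not.2 e2)]
          simp
        · have hd := hdec hvr
          have t15 : s₃.reg 15 ≠ 0 ↔ IsHorizontal K n (a v) (b v) := by
            rw [hreg₃ 15 rfl]
            exact hd.2.2
          have := testParent_denote g3 i3 hu₃ t3 t5 t10 ((hreg₃ 11 rfl).trans hd.2.1) t15
          rw [hc.parent_eq_iff hK hπ hvr]
          simpa [hvr] using this
      rw [State.setReg_arr]
      rcases hstep with ⟨hp, hs⟩ | ⟨hp, hs⟩
      · rw [hs, addEdge_arr i3 hu₃ (fun w => by rw [harr₃ 2 rfl, f2]), hinv₃ x y]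
        simp only [hlt]
        obtain ⟨hp1, hp2⟩ := hp
        by_cases hE : (x = u ∧ y = v) ∨ (x = v ∧ y = u)
        · rw [if_pos hE, if_pos]
          rcases hE with ⟨hx, hy⟩ | ⟨hx, hy⟩
          · exact Or.inl ⟨hy ▸ hp1, by rw [hy, hx, hp2], Or.inr ⟨hy, Or.inr hx⟩⟩
          · exact Or.inr ⟨hx ▸ hp1, by rw [hx, hy, hp2], Or.inr ⟨hx, Or.inr hy⟩⟩
        · rw [if_neg hE]
          refine if_congr ?_ rfl rfl
          constructor
          · rintro (⟨q1, q2, q3 | ⟨q3, q4⟩⟩ | ⟨q1, q2, q3 | ⟨q3, q4⟩⟩)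
            · exact Or.inl ⟨q1, q2, Or.inl q3⟩
            · exact Or.inl ⟨q1, q2, Or.inr ⟨q3, Or.inl q4⟩⟩
            · exact Or.inr ⟨q1, q2, Or.inl q3⟩
            · exact Or.inr ⟨q1, q2, Or.inr ⟨q3, Or.inl q4⟩⟩
          · rintro (⟨q1, q2, q3 | ⟨q3, q4 | q4⟩⟩ | ⟨q1, q2, q3 | ⟨q3, q4 | q4⟩⟩)
            · exact Or.inl ⟨q1, q2, Or.inl q3⟩
            · exact Or.inl ⟨q1, q2, Or.inr ⟨q3, q4⟩⟩
            · exact absurd (Or.inl ⟨q4, q3⟩) hE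
            · exact Or.inr ⟨q1, q2, Or.inl q3⟩
            · exact Or.inr ⟨q1, q2, Or.inr ⟨q3, q4⟩⟩
            · exact absurd (Or.inr ⟨q3, q4⟩) hE
      · rw [hs, hinv₃ x y]
        simp only [hlt]
        refine if_congr ?_ rfl rfl
        constructor
        · rintro (⟨q1, q2, q3 | ⟨q3, q4⟩⟩ | ⟨q1, q2, q3 | ⟨q3, q4⟩⟩)
          · exact Or.inl ⟨q1, q2, Or.inl q3⟩
          · exact Or.inl ⟨q1, q2, Or.inr ⟨q3, Or.inl q4⟩⟩
          · exact Or.inr ⟨q1, q2, Or.inl q3⟩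
          · exact Or.inr ⟨q1, q2, Or.inr ⟨q3, Or.inl q4⟩⟩
        · rintro (⟨q1, q2, q3 | ⟨q3, q4 | q4⟩⟩ | ⟨q1, q2, q3 | ⟨q3, q4 | q4⟩⟩)
          · exact Or.inl ⟨q1, q2, Or.inl q3⟩
          · exact Or.inl ⟨q1, q2, Or.inr ⟨q3, q4⟩⟩
          · rw [q3] at q1 q2
            exact absurd ⟨q1, q2.trans q4⟩ hp
          · exact Or.inr ⟨q1, q2, Or.inl q3⟩
          · exact Or.inr ⟨q1, q2, Or.inr ⟨q3, q4⟩⟩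
          · rw [q3] at q1 q2
            exact absurd ⟨q1, q2.trans q4⟩ hp

/-- Read the root, and compute the row offsets of the adjacency matrix and its size. -/
def prepare : ForProg :=
  seq (assign 3 (.get 0 (.const 1))) (seq (assign 1 (.const 0))
    (rep 4 (seq (store 2 (.reg 4) (.reg 1)) (assign 1 (.add (.reg 1) (.reg 2))))))

lemma prepare_spec {N : ℕ} {s : State} (h : s.reg 2 = N) :
    (prepare.denote s).reg 1 = N * N ∧ (prepare.denote s).reg 3 = s.arr 0 1 ∧
      ∀ i < N, (prepare.denote s).arr 2 i = i * N := by
  simp only [prepare, denote_seq]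
  set s₁ := (assign 1 (.const 0)).denote ((assign 3 (.get 0 (.const 1))).denote s) with hs₁
  have h21 : s₁.reg 2 = N := by simp [hs₁, denote_assign, h]
  have h31 : s₁.reg 3 = s.arr 0 1 := by simp [hs₁, denote_assign, Expr.eval]
  have key := denote_rep_induction (c := 4)
    (p := seq (store 2 (.reg 4) (.reg 1)) (assign 1 (.add (.reg 1) (.reg 2)))) rfl s₁
    (fun i s' => s'.reg 1 = i * N ∧ ∀ k < i, s'.arr 2 k = k * N)
    (by simp [hs₁, denote_assign, Expr.eval]) ?_
  · rw [h21] at key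
    exact ⟨key.1, (denote_reg_of_not_writesReg rfl s₁).trans h31, key.2⟩
  · intro i hi s' hi' hreg harr hinv
    have e2 := (hreg 2 rfl).trans h21
    refine ⟨by simp [denote_seq, denote_store, denote_assign, Expr.eval, hinv.1, e2]; ring,
      fun k hk => ?_⟩
    rcases Nat.lt_succ_iff_lt_or_eq.1 hk with hk | rfl
    · simp [denote_seq, denote_store, denote_assign, Expr.eval, hi', hk.ne, hinv.2 k hk]
    · simp [denote_seq, denote_store, denote_assign, Expr.eval, hi', hinv.1]

/-! ### The whole algorithm on encoded instances. -/

/-- Compute the adjacency matrix of the tree; register `2` holds the number of vertices. -/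
def solve : ForProg := seq prepare (seq coordinates (seq orient (seq countTrunks buildTree)))

end ForProg

/-- The approximation algorithm. -/
def solver : Prog := .seq (.assign 2 (.get 0 (.const 0))) ForProg.solve.toProg

lemma length_le_bitLength (x : List ℕ) : x.length ≤ bitLength x := by
  induction x with
  | nil => simp [bitLength]
  | cons a x ih =>
    simp only [bitLength, List.map_cons, List.sum_cons, List.length_cons] at ih ⊢
    omega

end RAM

lemma Polynomial.eval_le_eval_of_le (p : Polynomial ℕ) {x y : ℕ} (h : x ≤ y) :
    p.eval x ≤ p.eval y := by
  rw [Polynomial.eval_eq_sum_range, Polynomial.eval_eq_sum_range]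
  gcongr

namespace EDNRInstance

variable (I : EDNRInstance)

lemma N_le_bitLength_encode : I.N ≤ RAM.bitLength I.encode := by
  refine le_trans ?_ (RAM.length_le_bitLength _)
  simp only [encode, encodeRationals, List.length_append, List.length_ofFn]
  omega

open Classical in
lemma encode_getD_adj (u v : Fin I.N) :
    I.encode.getD (2 + u * I.N + v) 0 = if I.graph.Adj u v then 1 else 0 := by
  have hlt : (u : ℕ) * I.N + v < I.N * I.N := by
    have h1 := v.2
    have h2 := Nat.mul_le_mul_right I.N u.2
    rw [Nat.succ_mul] at h2
    omega
  have e : I.encode = I.N :: (I.root : ℕ) :: (encodeGraph I.graph ++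
      (encodeRationals (fun v => if v = I.root then 0 else I.demand v) ++
        encodeRationals (fun k : Fin (I.N * I.N) =>
          if I.graph.Adj k.divNat k.modNat then I.resistance s(k.divNat, k.modNat) else 0))) := by
    simp [encode]
  have e2 : 2 + (u : ℕ) * I.N + v = u * I.N + v + 1 + 1 := by omega
  rw [e, e2, List.getD_cons_succ, List.getD_cons_succ, List.getD_append _ _ _ _ (by
    simpa [encodeGraph] using hlt), List.getD_eq_getElem _ _ (by simpa [encodeGraph] using hlt)]
  simp only [encodeGraph, List.getElem_ofFn]
  have h1 : (⟨(u : ℕ) * I.N + v, hlt⟩ : Fin (I.N * I.N)).divNat = u := by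
    ext
    rw [Fin.coe_divNat]
    simp only
    rw [mul_comm, Nat.mul_add_div (by omega), Nat.div_eq_of_lt v.2, add_zero]
  have h2 : (⟨(u : ℕ) * I.N + v, hlt⟩ : Fin (I.N * I.N)).modNat = v := by
    ext
    rw [Fin.coe_modNat]
    simp only
    rw [mul_comm, Nat.mul_add_mod, Nat.mod_eq_of_lt v.2]
  rw [h1, h2]

open RAM ForProg in
-- The coordinates are the ones the run arrives at, hence the quantifier order. The constant `3` is
-- the cost of reading the number of vertices; this happens before `solve`, whose time bound
-- requires register `2` to stay fixed.
lemma solver_outputsWithin (hI : I.IsCornerRootedGrid) :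
    ∃ n m a b, IsGridCoord I.graph I.root n m a b ∧ n ≤ m ∧
      ∀ π : Fin I.N → Fin I.N,
        (∀ v, (a (π v), b (π v)) = parentCoord (2 ^ trunkExp n) n (a v, b v)) →
        RAM.OutputsWithin RAM.solver I.encode
          ((Polynomial.C 3 + ForProg.solve.time).eval (RAM.bitLength I.encode))
          (encodeGraph (parentGraph π)) := by
  classical
  obtain ⟨s₀, hs₀⟩ : ∃ s, s = (ForProg.assign 2 (.get 0 (.const 0))).denote
    (State.start I.encode) := ⟨_, rfl⟩
  have r0 : s₀.reg 2 = I.N := by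
    simp [hs₀, denote_assign, Expr.eval, State.start, encode]
  have hroot : s₀.arr 0 1 = I.root := by
    simp [hs₀, denote_assign, State.start, encode]
  have hout : ∀ i, s₀.arr 1 i = 0 := by
    simp [hs₀, denote_assign, State.start]
  have hadj : ∀ u v : Fin I.N, s₀.arr 0 (2 + u * I.N + v) = if I.graph.Adj u v then 1 else 0 := by
    intro u v
    rw [← I.encode_getD_adj, hs₀]
    rfl
  obtain ⟨s₁, hs₁⟩ : ∃ s, s = prepare.denote s₀ := ⟨_, rfl⟩
  obtain ⟨s₂, hs₂⟩ : ∃ s, s = coordinates.denote s₁ := ⟨_, rfl⟩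
  obtain ⟨s₃, hs₃⟩ : ∃ s, s = orient.denote s₂ := ⟨_, rfl⟩
  obtain ⟨s₄, hs₄⟩ : ∃ s, s = countTrunks.denote s₃ := ⟨_, rfl⟩
  have a1 : ∀ c, prepare.writesArr c = false → s₁.arr c = s₀.arr c := fun c hc => by
    rw [hs₁, denote_arr_of_not_writesArr hc]
  have a2 : ∀ c, coordinates.writesArr c = false → s₂.arr c = s₁.arr c := fun c hc => by
    rw [hs₂, denote_arr_of_not_writesArr hc]
  have a3 : ∀ c, orient.writesArr c = false → s₃.arr c = s₂.arr c := fun c hc => by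
    rw [hs₃, denote_arr_of_not_writesArr hc]
  have a4 : ∀ c, countTrunks.writesArr c = false → s₄.arr c = s₃.arr c := fun c hc => by
    rw [hs₄, denote_arr_of_not_writesArr hc]
  have q1 : ∀ c, prepare.writesReg c = false → s₁.reg c = s₀.reg c := fun c hc => by
    rw [hs₁, denote_reg_of_not_writesReg hc]
  have q2 : ∀ c, coordinates.writesReg c = false → s₂.reg c = s₁.reg c := fun c hc => by
    rw [hs₂, denote_reg_of_not_writesReg hc]
  have q3 : ∀ c, orient.writesReg c = false → s₃.reg c = s₂.reg c := fun c hc => by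
    rw [hs₃, denote_reg_of_not_writesReg hc]
  have q4 : ∀ c, countTrunks.writesReg c = false → s₄.reg c = s₃.reg c := fun c hc => by
    rw [hs₄, denote_reg_of_not_writesReg hc]
  obtain ⟨p1, p2, p3⟩ := prepare_spec r0
  rw [← hs₁] at p1 p2 p3
  have g1 : Holds I.graph s₁ := by
    refine ⟨(q1 2 rfl).trans r0, fun u v => ?_⟩
    rw [p3 u u.2, a1 0 rfl, hadj]
    simp
  obtain ⟨n, m, a, b, hc, hcoord⟩ := coordinates_spec g1 (p2.trans hroot) hI.exists_isGridCoord
  rw [← hs₂] at hcoord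
  have g2 : Holds I.graph s₂ := g1.congr (q2 2 rfl) (a2 0 rfl) (a2 2 rfl)
  obtain ⟨n, m, a, b, hc, hnm, h6, h3, h5⟩ := orient_spec g2.reg_two hc (fun v => (hcoord v).1)
    fun v => (hcoord v).2
  rw [← hs₃] at h6 h3 h5
  have g3 : Holds I.graph s₃ := g2.congr (q3 2 rfl) (a3 0 rfl) (a3 2 rfl)
  have hnN : n ≤ I.N := by
    have : I.N = n * m := by simpa using hc.card_eq
    rw [this]
    exact Nat.le_mul_of_pos_right _ hc.m_pos
  obtain ⟨h8, h9⟩ := countTrunks_reg h6 (by rw [g3.reg_two]; exact hnN)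
  rw [← hs₄] at h8 h9
  have g4 : Holds I.graph s₄ := g3.congr (q4 2 rfl) (a4 0 rfl) (a4 2 rfl)
  refine ⟨n, m, a, b, hc, hnm, fun π hπ => ?_⟩
  have hmat := buildTree_arr g4
    (fun w => by rw [a4 2 rfl, a3 2 rfl, a2 2 rfl, p3 w w.2]) hc (by positivity) hπ
    (fun v => by rw [a4 3 rfl, h3]) (fun v => by rw [a4 5 rfl, h5]) ((q4 6 rfl).trans h6) h8 h9
    (fun i => by rw [a4 1 rfl, a3 1 rfl, a2 1 rfl, a1 1 rfl, hout])
  have hsolve : solve.denote s₀ = buildTree.denote s₄ := by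
    simp only [solve, denote_seq, hs₄, hs₃, hs₂, hs₁]
  have hlen : (buildTree.denote s₄).reg 1 = I.N * I.N := by
    rw [denote_reg_of_not_writesReg (p := buildTree) (r := 1) rfl, q4 1 rfl, q3 1 rfl, q2 1 rfl, p1]
  obtain ⟨t, ht, hexec⟩ := exists_exec (p := solve) rfl rfl s₀
  rw [hsolve] at hexec
  refine ⟨3 + t, buildTree.denote s₄, .seq (s' := s₀) ?_ hexec, ?_, ?_⟩
  · rw [hs₀]
    exact .assign 2 (.get 0 (.const 0)) _
  · rw [Polynomial.eval_add, Polynomial.eval_C]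
    rw [r0] at ht
    exact Nat.add_le_add_left
      (ht.trans (Polynomial.eval_le_eval_of_le _ I.N_le_bitLength_encode)) _
  · rw [State.output, encodeGraph]
    refine List.ext_getElem (by simp [hlen]) fun k hk1 hk2 => ?_
    rw [List.getElem_ofFn, List.getElem_ofFn]
    rw [List.length_ofFn] at hk2
    have := hmat (⟨k, hk2⟩ : Fin (I.N * I.N)).divNat (⟨k, hk2⟩ : Fin (I.N * I.N)).modNat
    rw [Fin.coe_divNat, Fin.coe_modNat] at this
    simp only [Nat.div_add_mod'] at this
    exact this

end EDNRInstance

/-- EDNR on corner-rooted grids with unit resistances and demands in `[dmin, dmax]`, `dmin > 0`,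
has a polynomial-time `α² (9/8 + o(1))`-approximation algorithm, where `α = dmax / dmin` and the
`o(1)` is a function of the number of vertices only. -/
theorem mainTheorem2 :
    ∃ ε : ℕ → ℝ, Tendsto ε atTop (𝓝 0) ∧
      ∃ (p : RAM.Prog) (time : Polynomial ℕ),
        ∀ I : EDNRInstance, I.IsCornerRootedGrid →
          (∀ e ∈ I.graph.edgeSet, I.resistance e = 1) →
          ∀ dmin dmax : ℝ, 0 < dmin →
            (∀ v, v ≠ I.root → (I.demand v : ℝ) ∈ Set.Icc dmin dmax) →
            ∃ T : SimpleGraph (Fin I.N), I.IsSpanningTree T ∧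
              RAM.OutputsWithin p I.encode (time.eval (RAM.bitLength I.encode)) (encodeGraph T) ∧
              ∀ T' : SimpleGraph (Fin I.N), I.IsSpanningTree T' →
                I.loss T ≤ (dmax / dmin) ^ 2 * (9 / 8 + ε I.N) * I.loss T' := by
  obtain ⟨ε, hε, happrox⟩ := EDNRInstance.exists_forall_sum_numDesc_sq_le
  -- The maximum makes the final factor nonnegative, as needed to multiply it with the lower bound
  -- for the loss of `T'`.
  refine ⟨fun N => max (ε N) 0, by simpa using hε.max (tendsto_const_nhds (x := (0 : ℝ))),
    RAM.solver, Polynomial.C 3 + RAM.ForProg.solve.time, fun I hI hres dmin dmax hmin hdem => ?_⟩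
  obtain ⟨n, m, a, b, hc, hnm, hrun⟩ := I.solver_outputsWithin hI
  obtain ⟨π, hπ⟩ := hc.exists_parent (2 ^ trunkExp n)
  have hK : 0 < 2 ^ trunkExp n := by positivity
  have hr := hc.parent_root hπ
  have hD : ∀ v, v ≠ I.root → a (π v) + b (π v) < a v + b v := fun v hv => by
    have := hc.rank_parent hK hπ hv
    omega
  have hle := hc.parentGraph_le hK hπ
  refine ⟨parentGraph π, ⟨hle, isTree_parentGraph (D := fun v => a v + b v) hr hD⟩, hrun π hπ,
    fun T' hT' => ?_⟩
  have h1 := I.loss_parentGraph_le (D := fun v => a v + b v) hr hD hle hres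
    fun v hv => (hdem v hv).2
  have h2 := I.sum_numBelow_sq_le_loss hres hmin.le (fun v hv => (hdem v hv).1) hT'
  have h3 := happrox I n m a b π T' hc hnm hπ hT'
  set S := ∑ v ∈ Finset.univ.erase I.root, (I.numBelow T' v : ℝ) ^ 2
  have hS : 0 ≤ S := Finset.sum_nonneg fun _ _ => by positivity
  have h4 : 9 / 8 + ε I.N ≤ 9 / 8 + max (ε I.N) 0 := add_le_add_right (le_max_left _ _) _
  have h5 : 0 ≤ max (ε I.N) 0 := le_max_right _ _
  calc I.loss (parentGraph π)
      ≤ dmax ^ 2 * ((9 / 8 + max (ε I.N) 0) * S) :=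
        h1.trans (mul_le_mul_of_nonneg_left (h3.trans (mul_le_mul_of_nonneg_right h4 hS))
          (sq_nonneg _))
    _ = (dmax / dmin) ^ 2 * (9 / 8 + max (ε I.N) 0) * (dmin ^ 2 * S) := by
        field_simp
    _ ≤ _ := mul_le_mul_of_nonneg_left h2 (by positivity)
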